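/- **Model.** A cell is crossed by $n$ lines; a mobile user who enters along line $k$ stays for $l_k\ge 1$ slots. The state $s(\tau)$ in slot $\tau$ is the finite collection of pairs (line, remaining number of slots), one pair for each mobile user present. From one slot to the next all remaining times decrease by one, users with remaining time $0$ leave, and new users enter; the vectors of the numbers of arrivals along the lines are bounded and i.i.d. over the slots. "Every state" below means every state of the (finite, irreducible) recurrent class of this chain; the initial state may be any state. If in slot $\tau$ the vector of the fading gains between the base stations and the locations in the cell is $g$, then the data downloaded per unit bandwidth by the mobile (static) users, if they get the entire bandwidth, are $R_{mobile}(s(\tau))=r_{mobile}(s(\tau),g)\ge 0$ (respectively $R_{static}(s(\tau))=r_{static}(s(\tau),g)\ge 0$), measurable and bounded in $g$ for each state. **Fading assumption.** The vector of all fading gains is, across slots, a time-homogeneous Markov chain with values in a bounded set of nonnegative numbers in each coordinate, and it is uniformly ergodic: its $m$-step transition probabilities converge in total variation, uniformly in the starting point, to a law $\pi$. Its initial law is arbitrary. Arrivals, fading and the randomizations of the algorithm are independent. Put $\overline R_{mobile}(s)=\int r_{mobile}(s,g)\,\pi(dg)$ and $\overline R_{static}(s)=\int r_{static}(s,g)\,\pi(dg)$.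 **Optimal value.** For $\xi\ge 0$ let $\lambda^*(\xi)$ be the supremum over all stationary randomized policies (in state $s$ the fraction $\eta_\tau\in[0,1]$ of the bandwidth given to the mobile users is drawn from a law $\eta(\cdot\mid s)$) of $$\liminf_{N\to\infty}\frac1N\sum_{\tau=1}^N \mathbf E\big(\eta_\tau\overline R_{mobile}(s(\tau))+\xi(1-\eta_\tau)\overline R_{static}(s(\tau))\big).$$ **Algorithm.** Let $0<\epsilon\le 1$ and let $a(1)\ge a(2)\ge\dots$ be positive with $\sum_t a(t)=\infty$, $\sum_t a(t)^2<\infty$. Start with arbitrary estimates $R_{mobile}(s)$, $R_{static}(s)$ for all $s$. In slot $\tau$, in state $s=s(\tau)$ and with current estimates $R^{(\tau)}_{mobile}$, $R^{(\tau)}_{static}$, take $\eta_\tau=0$ and $\eta_\tau=1$ with probability $\epsilon/2$ each; with the remaining probability $1-\epsilon$ take $\eta_\tau=1$ if $R^{(\tau)}_{mobile}(s)-\xi R^{(\tau)}_{static}(s)>0$, $\eta_\tau=0$ if it is $<0$, and if it is $0$ choose by an arbitrary rule that may depend on $s$, on $\tau$ and on a fresh independent randomization. Let $\nu(s,x,\tau)$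 be the number of slots up to and including $\tau$ in which the state was $s$ and the decision $x$. Then for all $s$ $$R^{(\tau+1)}_{mobile}(s)=R^{(\tau)}_{mobile}(s)+a(\nu(s,1,\tau))\mathbf 1\{s(\tau)=s,\eta_\tau=1\}\big(R_{mobile}(s)-R^{(\tau)}_{mobile}(s)\big),$$ $$R^{(\tau+1)}_{static}(s)=R^{(\tau)}_{static}(s)+a(\nu(s,0,\tau))\mathbf 1\{s(\tau)=s,\eta_\tau=0\}\big(R_{static}(s)-R^{(\tau)}_{static}(s)\big),$$ where $R_{mobile}(s)$, $R_{static}(s)$ are the rates realized in slot $\tau$. **Theorem.** For every $0<\epsilon\le1$ and every state $s$, almost surely $\lim_{\tau\to\infty}R^{(\tau)}_{mobile}(s)=\overline R_{mobile}(s)$ and $\lim_{\tau\to\infty}R^{(\tau)}_{static}(s)=\overline R_{static}(s)$. Moreover, for every $0<\epsilon\le 1$ the average expected reward per slot under the algorithm, $$\lambda^*_\epsilon(\xi)=\lim_{N\to\infty}\frac1N\sum_{\tau=1}^N \mathbf E\big(\eta_\tau\overline R_{mobile}(s(\tau))+\xi(1-\eta_\tau)\overline R_{static}(s(\tau))\big),$$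 exists, and $\lim_{\epsilon\downarrow0}\lambda^*_\epsilon(\xi)=\lambda^*(\xi)$. -/

import Mathlib

open MeasureTheory ProbabilityTheory Filter Topology

noncomputable section

namespace BandwidthSharing

/-- A state of a cell crossed by `n` lines: the finite collection of the pairs
`(z, t)` = (line, number of remaining slots in the cell), one for each mobile user present. -/
abbrev State (n : ℕ) : Type := Multiset (Fin n × ℕ)

/-- The data of one cell. `L` indexes the radio links (pairs of a base station and a location). -/
structure Cell (n : ℕ) (L : Type*) where
  /-- a mobile user entering along line `k` stays for `len k` slots -/
  len : Fin n → ℕ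
  len_pos : ∀ k, 1 ≤ len k
  /-- law of the vector of the numbers of arrivals along the lines in one slot -/
  arrivalLaw : PMF (Fin n → ℕ)
  /-- the numbers of arrivals in one slot are bounded -/
  arrivalLaw_finite : arrivalLaw.support.Finite
  /-- the set of possible values of a fading gain -/
  gainSet : Set ℝ
  gainSet_nonneg : ∀ x ∈ gainSet, 0 ≤ x
  gainSet_bounded : BddAbove gainSet
  /-- transition kernel of the vector of all fading gains from one slot to the next -/
  fadingKernel : Kernel (L → gainSet) (L → gainSet)
  fadingKernel_markov : IsMarkovKernel fadingKernel
  /-- data downloaded by all mobile users in a slot, per unit bandwidth, if the entire bandwidth is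
  given to them, as a function of the state and of the fading gains in this slot -/
  rateMobile : State n → (L → gainSet) → ℝ
  /-- the same for the static users -/
  rateStatic : State n → (L → gainSet) → ℝ
  rateMobile_measurable : ∀ s, Measurable (rateMobile s)
  rateStatic_measurable : ∀ s, Measurable (rateStatic s)
  rateMobile_nonneg : ∀ s g, 0 ≤ rateMobile s g
  rateStatic_nonneg : ∀ s g, 0 ≤ rateStatic s g
  rateMobile_bounded : ∀ s, ∃ C, ∀ g, rateMobile s g ≤ C
  rateStatic_bounded : ∀ s, ∃ C, ∀ g, rateStatic s g ≤ C

/-- A Markov kernel is (uniformly) ergodic with limit law `π`: its iterates converge to `π` in total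
variation, uniformly in the starting point. -/
def UniformlyErgodic {E : Type*} [MeasurableSpace E] (κ : Kernel E E) (π : Measure E) : Prop :=
  ∀ δ : ℝ, 0 < δ → ∃ N : ℕ, ∀ m, N ≤ m → ∀ x : E, ∀ B : Set E, MeasurableSet B →
    |((κ ^ m) x).real B - π.real B| ≤ δ

namespace Cell

variable {n : ℕ} {L : Type*} (M : Cell n L)

/-- Every user is on a line, with a remaining time between `1` and the length of the line. -/
def IsState (s : State n) : Prop := ∀ u ∈ s, 1 ≤ u.2 ∧ u.2 ≤ M.len u.1

/-- The next state, if `b k` users enter along line `k`: remaining times decrease by one, users with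
remaining time zero are removed, the new users are added. -/
def next (s : State n) (b : Fin n → ℕ) : State n :=
  (s.filter (fun u => 1 < u.2)).map (fun u => (u.1, u.2 - 1))
    + ∑ k, Multiset.replicate (b k) (k, M.len k)

/-- One transition of positive probability. -/
def Step (s s' : State n) : Prop := ∃ b ∈ M.arrivalLaw.support, s' = M.next s b

/-- The (finite, irreducible) state space of the state chain: its recurrent class, that is, the
states that can be reached from every state. -/
def states : Set (State n) :=
  {s | M.IsState s ∧ ∀ s₀, M.IsState s₀ → Relation.ReflTransGen M.Step s₀ s}

/-- Law of the state in slot `τ` (slots are numbered `0, 1, 2, …`), starting from `s₀`. -/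
def stateLaw (s₀ : State n) : ℕ → PMF (State n)
  | 0 => PMF.pure s₀
  | τ + 1 => (stateLaw s₀ τ).bind (fun s => M.arrivalLaw.map (M.next s))

/-- Mean rate of the mobile users in state `s` under the law `π` of the fading gains. -/
def meanMobile (π : Measure (L → M.gainSet)) (s : State n) : ℝ := ∫ g, M.rateMobile s g ∂π

/-- Mean rate of the static users in state `s` under the law `π` of the fading gains. -/
def meanStatic (π : Measure (L → M.gainSet)) (s : State n) : ℝ := ∫ g, M.rateStatic s g ∂π

/-- Expected single-stage reward in state `s` if the fraction `x` of the bandwidth is given to the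
mobile users. -/
def reward (π : Measure (L → M.gainSet)) (ξ : ℝ) (s : State n) (x : ℝ) : ℝ :=
  x * M.meanMobile π s + ξ * (1 - x) * M.meanStatic π s

/-- A stationary randomized policy: for each state a probability law on the action space. -/
abbrev Policy (n : ℕ) : Type := State n → ProbabilityMeasure (Set.Icc (0 : ℝ) 1)

/-- Expected reward in slot `τ` under a stationary policy. -/
def policyReward (π : Measure (L → M.gainSet)) (ξ : ℝ) (s₀ : State n) (η : Policy n) (τ : ℕ) : ℝ :=
  ∑' s, (M.stateLaw s₀ τ s).toReal *
    ∫ x : Set.Icc (0 : ℝ) 1, M.reward π ξ s x ∂(η s : Measure (Set.Icc (0 : ℝ) 1))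

/-- Long-run average expected reward per slot under a stationary policy. -/
def policyValue (π : Measure (L → M.gainSet)) (ξ : ℝ) (s₀ : State n) (η : Policy n) : ℝ :=
  liminf (fun N : ℕ => (1 / (N : ℝ)) * ∑ τ ∈ Finset.range N, M.policyReward π ξ s₀ η τ) atTop

/-- The optimal average reward per slot `λ*(ξ)`. -/
def optimalValue (π : Measure (L → M.gainSet)) (ξ : ℝ) (s₀ : State n) : ℝ :=
  ⨆ η : Policy n, M.policyValue π ξ s₀ η

/-- The random inputs: arrivals `A τ` (during slot `τ`), randomization `U τ` of the decision in slot
`τ`, and fading gains `G τ` in slot `τ`. -/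
structure IsInput {Ω : Type*} [MeasurableSpace Ω] (P : Measure Ω)
    (A : ℕ → Ω → Fin n → ℕ) (U : ℕ → Ω → ℝ) (G : ℕ → Ω → L → M.gainSet) : Prop where
  measurable_arrival : ∀ τ, Measurable (A τ)
  measurable_unif : ∀ τ, Measurable (U τ)
  measurable_gain : ∀ τ, Measurable (G τ)
  /-- arrivals are i.i.d. over the slots -/
  arrival_law : ∀ τ, P.map (A τ) = M.arrivalLaw.toMeasure
  arrival_indep : iIndepFun A P
  /-- the randomizations are i.i.d. uniform on `[0, 1]` -/
  unif_law : ∀ τ, P.map (U τ) = volume.restrict (Set.Icc (0 : ℝ) 1)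
  unif_indep : iIndepFun U P
  /-- the fading gains are a Markov chain with the given kernel, and any initial law -/
  gain_markov : ∀ τ (B : Set (L → M.gainSet)), MeasurableSet B →
    P[(G (τ + 1) ⁻¹' B).indicator (fun _ => (1 : ℝ)) |
        ⨆ i : Fin (τ + 1), MeasurableSpace.comap (G i) inferInstance]
      =ᵐ[P] fun ω => (M.fadingKernel (G τ ω)).real B
  /-- arrivals, randomizations and fading are independent of each other -/
  indep_arrival : IndepFun (fun ω τ => A τ ω) (fun ω => (fun τ => U τ ω, fun τ => G τ ω)) P
  indep_unif_gain : IndepFun (fun ω τ => U τ ω) (fun ω τ => G τ ω) P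

/-- The state in slot `τ`. -/
def stateAt {Ω : Type*} (s₀ : State n) (A : ℕ → Ω → Fin n → ℕ) : ℕ → Ω → State n
  | 0, _ => s₀
  | τ + 1, ω => M.next (stateAt s₀ A τ ω) (A τ ω)

/-- What the learning algorithm remembers at the beginning of a slot: for each state the estimates
of the two mean rates and how often each of the two decisions was taken there so far. -/
structure Memory (n : ℕ) where
  mobile : State n → ℝ
  static : State n → ℝ
  countMobile : State n → ℕ
  countStatic : State n → ℕ

open Classical in
/-- The decision in slot `τ` and state `s`; `true`: entire bandwidth to the mobile users (`η = 1`),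
`false`: to the static users (`η = 0`). If `u` is uniform on `[0, 1]`, each is forced with
probability `ε / 2`; otherwise the decision is greedy, and ties are broken by the rule `tie`. -/
def decision (ε ξ : ℝ) (tie : ℕ → State n → ℝ → Bool) (τ : ℕ) (m : Memory n) (s : State n)
    (u : ℝ) : Bool :=
  if u < ε / 2 then false
  else if u < ε then true
  else if 0 < m.mobile s - ξ * m.static s then true
  else if m.mobile s - ξ * m.static s < 0 then false
  else tie τ s u

open Classical in
/-- The update after decision `d` in state `s`, with fading gains `g`. The step size is `a` at the
number of times that this decision was taken in this state, including the present slot. -/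
def update (a : ℕ → ℝ) (m : Memory n) (s : State n) (d : Bool) (g : L → M.gainSet) : Memory n where
  countMobile s' := m.countMobile s' + if s = s' ∧ d = true then 1 else 0
  countStatic s' := m.countStatic s' + if s = s' ∧ d = false then 1 else 0
  mobile s' := if s = s' ∧ d = true then
      m.mobile s' + a (m.countMobile s' + 1) * (M.rateMobile s' g - m.mobile s')
    else m.mobile s'
  static s' := if s = s' ∧ d = false then
      m.static s' + a (m.countStatic s' + 1) * (M.rateStatic s' g - m.static s')
    else m.static s'

/-- The parameters of the learning algorithm other than `ε` and `ξ`. -/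
structure Setup (n : ℕ) where
  /-- step sizes, used at positive integers -/
  a : ℕ → ℝ
  /-- tie-breaking rule, possibly randomized and time-dependent -/
  tie : ℕ → State n → ℝ → Bool
  /-- initial estimates -/
  mobile₀ : State n → ℝ
  static₀ : State n → ℝ
  /-- initial state -/
  s₀ : State n

section Algorithm

variable {Ω : Type*} (S : Setup n) (ξ ε : ℝ)
  (A : ℕ → Ω → Fin n → ℕ) (U : ℕ → Ω → ℝ) (G : ℕ → Ω → L → M.gainSet)

/-- The memory of the algorithm at the beginning of slot `τ`. -/
def memory : ℕ → Ω → Memory n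
  | 0, _ => ⟨S.mobile₀, S.static₀, fun _ => 0, fun _ => 0⟩
  | τ + 1, ω =>
    M.update S.a (memory τ ω) (M.stateAt S.s₀ A τ ω)
      (decision ε ξ S.tie τ (memory τ ω) (M.stateAt S.s₀ A τ ω) (U τ ω)) (G τ ω)

/-- The decision of the algorithm in slot `τ`, as a number `η_τ ∈ {0, 1}`. -/
def action (τ : ℕ) (ω : Ω) : ℝ :=
  if decision ε ξ S.tie τ (M.memory S ξ ε A U G τ ω) (M.stateAt S.s₀ A τ ω) (U τ ω) = true
  then 1 else 0

/-- Average over the first `N` slots of the expected reward under the algorithm. -/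
def averageReward [MeasurableSpace Ω] (P : Measure Ω) (π : Measure (L → M.gainSet)) (N : ℕ) : ℝ :=
  (1 / (N : ℝ)) * ∑ τ ∈ Finset.range N,
    ∫ ω, M.reward π ξ (M.stateAt S.s₀ A τ ω) (M.action S ξ ε A U G τ ω) ∂P

/-- Long-run average expected reward per slot `λ*_ε(ξ)` under the algorithm. -/
def algorithmValue [MeasurableSpace Ω] (P : Measure Ω) (π : Measure (L → M.gainSet)) : ℝ :=
  liminf (fun N : ℕ => M.averageReward S ξ ε A U G P π N) atTop

end Algorithm

end Cell

end BandwidthSharing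

end

/-!
The state chain forgets its initial state after `horizon` slots: from then on, the state is a
function of the arrivals in the last `horizon` slots (`Cell.stateAt_add_horizon`), and its law is
`Cell.limitLaw`, which has finite support and charges every recurrent state. The optimal value is
therefore the mean of the largest expected reward per state (`Cell.optimalValue_eq`). Once the
estimates are known to be consistent, the algorithm makes in the long run the optimal decisions,
except for the forced ones and for true ties, where the decision does not matter; dominated
convergence gives its average reward (`Cell.tendsto_averageReward`), which tends to the optimal value
as `ε` tends to zero.

The substance is the consistency of the estimates. The arrivals are independent of all the rest, so
they may be fixed (`Cell.ae_tendsto_memory`); then the slots in which a given state is visited are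
deterministic, and in these slots the two estimates are a pair of competing estimates (`Arms`,
`Cell.exists_arms`), of which one is updated in each slot: a forced one with probability at least
`ε / 2` each, else the larger one. The difficulty is that the greedy choice depends on the past,
hence on the fading, and that the fading in successive slots is dependent. A uniformly ergodic kernel
mixes at a summable rate (`exists_mixing_rate`), so weighted sums of the rewards converge if the
weights vary slowly. The weights here vary slowly except when the class, the sign of the difference
of the estimates, changes. Thus a function of an estimate is the sum of its drift, a convergent noise
and an error carried by the changes of the class (`Arms.ae_smooth_identity`), and it remains to show
that these changes are harmless.

* The lower envelope of the two mixtures of a function of the estimates with weights `α` and `1 - α`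
  evolves with weights whose mean does not depend on the class. Hence the estimates do not stay above
  the larger one of the two means (`Arms.ae_tendsto_excess`).
* A class changes only near a tie. A tie is unstable if one of the arms, when preferred, has a drift
  that increases its lead by at least a fixed multiple of the step sizes: a sequence of forced choices
  leads away from the tie with positive probability, and the drift then prevents the return. A
  potential that decreases at such ties and essentially nowhere increases in mean shows that the sum
  of the step sizes at these times is finite (`Arms.ae_summable_near`).
* A tie that is not unstable has both estimates near the common mean, or, if the means differ, the
  estimate of the better arm near the smaller mean while this arm has a relatively small step size. As
  both arms use up their step sizes at comparable rates, the latter cannot go on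
  (`Arms.ae_frequently_of_summable`). What remains are summable errors, and the estimates converge to
  the means (`Arms.ae_tendsto_mean`).

If `ξ = 0`, the greedy choice is the sign of the estimate of the mobile users alone, which settles
because the rates are nonnegative (`Arms.ae_tendsto_mean_of_nonneg`).
-/

noncomputable section

namespace BandwidthSharing

/-! ### Bounded random variables and convergent random series -/

section Tools

variable {Ω : Type*} {mΩ : MeasurableSpace Ω} {P : Measure Ω}

theorem integrable_of_abs_le [IsFiniteMeasure P] {f : Ω → ℝ} (hf : Measurable f) {K : ℝ}
    (hK : ∀ ω, |f ω| ≤ K) : Integrable f P :=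
  Integrable.of_bound hf.aestronglyMeasurable K (ae_of_all _ hK)

theorem condExp_eq_zero_of_setIntegral_eq_zero [IsFiniteMeasure P] {m : MeasurableSpace Ω}
    (hm : m ≤ mΩ) {f : Ω → ℝ} (hf : Integrable f P)
    (h0 : ∀ S, MeasurableSet[m] S → ∫ ω in S, f ω ∂P = 0) : P[f | m] =ᵐ[P] 0 := by
  refine (ae_eq_condExp_of_forall_setIntegral_eq hm hf (g := 0) ?_ ?_ ?_).symm
  · intro s _ _; exact integrableOn_zero
  · intro s hs _; simp [h0 s hs]
  · exact aestronglyMeasurable_zero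

theorem integral_mul_eq_zero_of_setIntegral_eq_zero [IsFiniteMeasure P] {m : MeasurableSpace Ω}
    (hm : m ≤ mΩ) {f Y : Ω → ℝ} (hf : Measurable[mΩ] f) {K : ℝ} (hK : ∀ ω, |f ω| ≤ K)
    (hY : Measurable[m] Y) {K' : ℝ} (hK' : ∀ ω, |Y ω| ≤ K')
    (h0 : ∀ S, MeasurableSet[m] S → ∫ ω in S, f ω ∂P = 0) : ∫ ω, Y ω * f ω ∂P = 0 := by
  have hfi : Integrable f P := integrable_of_abs_le hf hK
  have hYf : Integrable (Y * f) P := by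
    refine hfi.bdd_mul (c := K') (hY.mono hm le_rfl).aestronglyMeasurable (ae_of_all _ hK')
  have h1 := condExp_mul_of_stronglyMeasurable_left (μ := P) hY.stronglyMeasurable hYf hfi
  have h2 := condExp_eq_zero_of_setIntegral_eq_zero hm hfi h0
  have h3 : ∫ ω, (Y * f) ω ∂P = ∫ ω, (P[Y * f | m]) ω ∂P := (integral_condExp hm).symm
  have h4 : ∫ ω, (P[Y * f | m]) ω ∂P = 0 := by
    rw [integral_congr_ae (g := fun _ => (0 : ℝ))]
    · simp
    · filter_upwards [h1, h2] with ω h1 h2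
      simp [h1, h2]
  simpa using h3.trans h4

/-- A series of bounded martingale differences converges almost surely if the second moments of
its terms are summable. -/
theorem ae_tendsto_sum_of_martingale_differences [IsProbabilityMeasure P]
    (𝓕 : Filtration ℕ mΩ) (D : ℕ → Ω → ℝ) (hadp : ∀ t, Measurable[𝓕 (t + 1)] (D t))
    (hb : ∀ t, ∃ K, ∀ ω, |D t ω| ≤ K)
    (h0 : ∀ t S, MeasurableSet[𝓕 t] S → ∫ ω in S, D t ω ∂P = 0)
    (hs : Summable fun t => ∫ ω, D t ω ^ 2 ∂P) :
    ∀ᵐ ω ∂P, ∃ z, Tendsto (fun T => ∑ t ∈ Finset.range T, D t ω) atTop (𝓝 z) := by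
  have hDm : ∀ t, Measurable (D t) := fun t => (hadp t).mono (𝓕.le _) le_rfl
  choose K hK using hb
  set f : ℕ → Ω → ℝ := fun T ω => ∑ t ∈ Finset.range T, D t ω with hf
  have hfm : ∀ T, Measurable[𝓕 T] (f T) := by
    intro T
    refine Finset.measurable_sum _ fun t ht => ?_
    exact (hadp t).mono (𝓕.mono (by simpa using Finset.mem_range.1 ht)) le_rfl
  have hfm' : ∀ T, Measurable (f T) := fun T => (hfm T).mono (𝓕.le _) le_rfl
  have hfb : ∀ T ω, |f T ω| ≤ ∑ t ∈ Finset.range T, K t := fun T ω =>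
    (Finset.abs_sum_le_sum_abs _ _).trans (Finset.sum_le_sum fun t _ => hK t ω)
  have hfi : ∀ T, Integrable (f T) P := fun T => integrable_of_abs_le (hfm' T) (hfb T)
  have hDi : ∀ t, Integrable (D t) P := fun t => integrable_of_abs_le (hDm t) (hK t)
  have hmart : Martingale f 𝓕 P := by
    refine martingale_of_setIntegral_eq_succ (fun T => (hfm T).stronglyMeasurable) hfi ?_
    intro T S hS
    have : ∀ ω, f (T + 1) ω = f T ω + D T ω := fun ω => Finset.sum_range_succ _ _
    simp_rw [this]
    rw [integral_add (hfi T).integrableOn (hDi T).integrableOn, h0 T S hS, add_zero]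
  have hsq : ∀ T, ∫ ω, f T ω ^ 2 ∂P = ∑ t ∈ Finset.range T, ∫ ω, D t ω ^ 2 ∂P := by
    intro T
    induction T with
    | zero => simp [hf]
    | succ T ih =>
      have hx : ∫ ω, f T ω * D T ω ∂P = 0 :=
        integral_mul_eq_zero_of_setIntegral_eq_zero (𝓕.le T) (hDm T) (hK T) (hfm T) (hfb T) (h0 T)
      have hexp : ∀ ω, f (T + 1) ω ^ 2 = f T ω ^ 2 + 2 * (f T ω * D T ω) + D T ω ^ 2 := by
        intro ω
        have : f (T + 1) ω = f T ω + D T ω := Finset.sum_range_succ _ _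
        rw [this]; ring
      have hi1 : Integrable (fun ω => f T ω ^ 2) P := by
        refine integrable_of_abs_le ((hfm' T).pow_const 2)
          (K := (∑ t ∈ Finset.range T, K t) ^ 2) fun ω => ?_
        rw [abs_pow]; exact pow_le_pow_left₀ (abs_nonneg _) (hfb T ω) 2
      have hi2 : Integrable (fun ω => D T ω ^ 2) P := by
        refine integrable_of_abs_le ((hDm T).pow_const 2) (K := (K T) ^ 2) fun ω => ?_
        rw [abs_pow]; exact pow_le_pow_left₀ (abs_nonneg _) (hK T ω) 2
      have hi3 : Integrable (fun ω => 2 * (f T ω * D T ω)) P :=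
        ((hDi T).bdd_mul (c := ∑ t ∈ Finset.range T, K t) (hfm' T).aestronglyMeasurable
          (ae_of_all _ (hfb T))).const_mul 2
      have hi4 : Integrable (fun ω => f T ω ^ 2 + 2 * (f T ω * D T ω)) P := hi1.add hi3
      simp_rw [hexp]
      rw [integral_add hi4 hi2, integral_add hi1 hi3, integral_const_mul, hx, ih,
        Finset.sum_range_succ]
      ring
  set R : ℝ := 1 + ∑' t, ∫ ω, D t ω ^ 2 ∂P
  have hbdd : ∀ T, eLpNorm (f T) 1 P ≤ (R.toNNReal : ENNReal) := by
    intro T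
    rw [eLpNorm_one_eq_lintegral_enorm, ← ofReal_integral_norm_eq_lintegral_enorm (hfi T)]
    refine ENNReal.ofReal_le_ofReal ?_
    have hi1 : Integrable (fun ω => f T ω ^ 2) P := by
      refine integrable_of_abs_le ((hfm' T).pow_const 2)
        (K := (∑ t ∈ Finset.range T, K t) ^ 2) fun ω => ?_
      rw [abs_pow]; exact pow_le_pow_left₀ (abs_nonneg _) (hfb T ω) 2
    calc ∫ ω, ‖f T ω‖ ∂P ≤ ∫ ω, (1 + f T ω ^ 2) ∂P := by
          refine integral_mono (hfi T).norm ((integrable_const _).add hi1) fun ω => ?_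
          simp only [Real.norm_eq_abs]
          nlinarith [sq_nonneg (|f T ω| - 1), sq_abs (f T ω), abs_nonneg (f T ω)]
      _ = 1 + ∑ t ∈ Finset.range T, ∫ ω, D t ω ^ 2 ∂P := by
          rw [integral_add (integrable_const _) hi1, hsq T]; simp
      _ ≤ R := by
          have := hs.sum_le_tsum (Finset.range T) fun t _ => integral_nonneg fun ω => sq_nonneg _
          linarith
  filter_upwards [hmart.submartingale.ae_tendsto_limitProcess hbdd] with ω hω
  exact ⟨_, hω⟩

/-- Nonnegative bounded random variables with summable expectations are summable almost surely. -/
theorem ae_summable_of_summable_integral [IsFiniteMeasure P] (f : ℕ → Ω → ℝ)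
    (hm : ∀ t, Measurable (f t)) (hpos : ∀ t ω, 0 ≤ f t ω) (hb : ∀ t, ∃ K, ∀ ω, f t ω ≤ K)
    (hs : Summable fun t => ∫ ω, f t ω ∂P) : ∀ᵐ ω ∂P, Summable fun t => f t ω := by
  have hi : ∀ t, Integrable (f t) P := fun t => by
    obtain ⟨K, hK⟩ := hb t
    exact integrable_of_abs_le (hm t) (K := K) fun ω => by rw [abs_of_nonneg (hpos t ω)]; exact hK ω
  have h1 : ∫⁻ ω, ∑' t, ENNReal.ofReal (f t ω) ∂P ≠ ⊤ := by
    rw [lintegral_tsum fun t => (hm t).ennreal_ofReal.aemeasurable]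
    have : ∀ t, ∫⁻ ω, ENNReal.ofReal (f t ω) ∂P = ENNReal.ofReal (∫ ω, f t ω ∂P) := fun t =>
      (ofReal_integral_eq_lintegral_ofReal (hi t) (ae_of_all _ (hpos t))).symm
    simp_rw [this]
    exact hs.tsum_ofReal_ne_top
  have h2 := ae_lt_top (Measurable.tsum fun t => (hm t).ennreal_ofReal) h1
  filter_upwards [h2] with ω hω
  have := ENNReal.summable_toReal hω.ne
  refine this.congr fun t => ?_
  exact ENNReal.toReal_ofReal (hpos t ω)

/-- Independence in terms of expectations of products of bounded functions. -/
theorem integral_mul_of_indep [IsProbabilityMeasure P] {m₁ m₂ : MeasurableSpace Ω}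
    (h₁ : m₁ ≤ mΩ) (h₂ : m₂ ≤ mΩ) (hind : Indep m₁ m₂ P) {f g : Ω → ℝ}
    (hf : Measurable[m₁] f) (hg : Measurable[m₂] g) :
    ∫ ω, f ω * g ω ∂P = (∫ ω, f ω ∂P) * ∫ ω, g ω ∂P := by
  have hfg : IndepFun f g P := by
    rw [IndepFun_iff_Indep]
    exact indep_of_indep_of_le_left (indep_of_indep_of_le_right hind hg.comap_le) hf.comap_le
  exact hfg.integral_fun_mul_eq_mul_integral (hf.mono h₁ le_rfl).aestronglyMeasurable
    (hg.mono h₂ le_rfl).aestronglyMeasurable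

/-- If the conditional expectation of `f` is `β`-close to `c`, then so is its average with respect
to any bounded nonnegative weight that is measurable for the conditioning σ-algebra. -/
theorem abs_integral_mul_sub_le_of_condExp [IsFiniteMeasure P] {m : MeasurableSpace Ω} (hm : m ≤ mΩ)
    {f Y : Ω → ℝ} (hf : Measurable[mΩ] f) {K K' c β : ℝ} (hK : ∀ ω, |f ω| ≤ K)
    (hY : Measurable[m] Y) (hK' : ∀ ω, |Y ω| ≤ K') (hY0 : ∀ ω, 0 ≤ Y ω)
    (hc : ∀ᵐ ω ∂P, |(P[f | m]) ω - c| ≤ β) :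
    |∫ ω, Y ω * (f ω - c) ∂P| ≤ β * ∫ ω, Y ω ∂P := by
  have hfi : Integrable f P := integrable_of_abs_le hf hK
  have hYm : Measurable[mΩ] Y := hY.mono hm le_rfl
  have hYi : Integrable Y P := integrable_of_abs_le hYm hK'
  have hYf : Integrable (fun ω => Y ω * f ω) P :=
    hfi.bdd_mul (c := K') hYm.aestronglyMeasurable (ae_of_all _ hK')
  have h1 := condExp_mul_of_stronglyMeasurable_left (μ := P) hY.stronglyMeasurable hYf hfi
  have h2 : ∫ ω, Y ω * (f ω - c) ∂P = ∫ ω, Y ω * ((P[f | m]) ω - c) ∂P := by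
    have e1 : ∫ ω, Y ω * f ω ∂P = ∫ ω, Y ω * (P[f | m]) ω ∂P := by
      rw [← integral_condExp hm]
      exact integral_congr_ae h1
    have hYg : Integrable (fun ω => Y ω * (P[f | m]) ω) P :=
      integrable_condExp.bdd_mul (c := K') hYm.aestronglyMeasurable (ae_of_all _ hK')
    simp_rw [mul_sub]
    rw [integral_sub hYf (hYi.mul_const c), integral_sub hYg (hYi.mul_const c)]
    rw [e1]
  rw [h2, ← integral_const_mul]
  refine (abs_integral_le_integral_abs).trans ?_
  refine integral_mono_ae ?_ (hYi.const_mul β) ?_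
  · refine Integrable.abs ?_
    exact (integrable_condExp.sub (integrable_const c)).bdd_mul (c := K')
      hYm.aestronglyMeasurable (ae_of_all _ hK')
  · filter_upwards [hc] with ω hω
    show |_| ≤ _
    rw [abs_mul, abs_of_nonneg (hY0 ω), mul_comm]
    exact mul_le_mul_of_nonneg_right hω (hY0 ω)

end Tools

/-! ### Two competing estimates -/

/-- Two running estimates `X true` and `X false` ("arms"), exactly one of which is updated at each
time. With `N i t` the number of updates of arm `i` before time `t`, the update at time `t` has step
size `a (N i t)`. The arm is chosen by `β`: if the class of the history (in the application, the
sign of the difference of the estimates) is `c`, arm `i` is chosen if and only if `β i c t = 1`,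
where `β i c t` depends only on the fresh randomization `rnd t`. The rewards `R i t` do not depend
on the choices, they may depend on each other, but they mix. -/
structure Arms {Ω : Type*} [mΩ : MeasurableSpace Ω] (P : Measure Ω) where
  /-- step sizes -/
  a : ℕ → ℝ
  a_pos : ∀ k, 0 < a k
  a_anti : Antitone a
  a_sum : ¬ Summable a
  a_sq : Summable fun k => a k ^ 2
  /-- what is known before time `t` -/
  past : Filtration ℕ mΩ
  /-- the randomization at time `t` -/
  rnd : ℕ → MeasurableSpace Ω
  /-- the σ-algebra of all the rewards -/
  rew : MeasurableSpace Ω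
  rnd_le : ∀ t, rnd t ≤ past (t + 1)
  rew_le : rew ≤ mΩ
  indep : ∀ t, Indep (⨆ k, rnd (t + k)) (past t ⊔ rew) P
  /-- the rewards -/
  R : Bool → ℕ → Ω → ℝ
  /-- a bound of the rewards -/
  C : ℝ
  R_bdd : ∀ i t ω, |R i t ω| ≤ C
  R_past : ∀ i t, Measurable[past (t + 1)] (R i t)
  R_rew : ∀ i t, Measurable[rew] (R i t)
  /-- limits of the mean rewards -/
  mean : Bool → ℝ
  /-- mixing rate -/
  mix : ℕ → ℝ
  mix_nonneg : ∀ k, 0 ≤ mix k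
  mix_summable : Summable mix
  mixing : ∀ i t k, ∀ᵐ ω ∂P, |(P[R i (t + k) | past t]) ω - mean i| ≤ mix k
  /-- each arm is chosen with at least this probability -/
  α : ℝ
  α_pos : 0 < α
  α_le : α ≤ 1 / 2
  /-- indicator of the choice of an arm, in each class -/
  β : Bool → SignType → ℕ → Ω → ℝ
  β_val : ∀ i c t ω, β i c t ω = 0 ∨ β i c t ω = 1
  β_mono : ∀ i t ω, Monotone fun c => β i c t ω
  β_not : ∀ i c t ω, β (!i) (-c) t ω = 1 - β i c t ω
  β_meas : ∀ i c t, Measurable[rnd t] (β i c t)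
  β_neg : ∀ i t, ∫ ω, β i (-1) t ω ∂P = α
  /-- class of the history, seen from an arm -/
  cls : Bool → ℕ → Ω → SignType
  cls_not : ∀ i t ω, cls (!i) t ω = -cls i t ω
  cls_meas : ∀ i t c, MeasurableSet[past t] {ω | cls i t ω = c}
  /-- the estimates -/
  X : Bool → ℕ → Ω → ℝ
  /-- numbers of updates -/
  N : Bool → ℕ → Ω → ℕ
  /-- initial estimates -/
  x₀ : Bool → ℝ
  X_zero : ∀ i ω, X i 0 ω = x₀ i
  N_zero : ∀ i ω, N i 0 ω = 0
  X_succ : ∀ i t ω, X i (t + 1) ω =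
    X i t ω + β i (cls i t ω) t ω * (a (N i t ω) * (R i t ω - X i t ω))
  N_succ : ∀ i t ω, N i (t + 1) ω = N i t ω + if β i (cls i t ω) t ω = 1 then 1 else 0

namespace Arms

variable {Ω : Type*} [mΩ : MeasurableSpace Ω] {P : Measure Ω} (W : Arms P)

/-- The step size of an update of arm `i` at time `t`. -/
def s (i : Bool) (t : ℕ) (ω : Ω) : ℝ := W.a (W.N i t ω)

/-- Indicator of the choice of arm `i` at time `t`. -/
def b (i : Bool) (t : ℕ) (ω : Ω) : ℝ := W.β i (W.cls i t ω) t ω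

/-- Probability of the choice of arm `i` at time `t` in class `c`. -/
def p (i : Bool) (c : SignType) (t : ℕ) : ℝ := ∫ ω, W.β i c t ω ∂P

theorem b_val (i t ω) : W.b i t ω = 0 ∨ W.b i t ω = 1 := W.β_val _ _ _ _

theorem β_nonneg (i c t ω) : 0 ≤ W.β i c t ω := by
  rcases W.β_val i c t ω with h | h <;> rw [h]
  norm_num

theorem β_le_one (i c t ω) : W.β i c t ω ≤ 1 := by
  rcases W.β_val i c t ω with h | h <;> rw [h]
  norm_num

theorem b_nonneg (i t ω) : 0 ≤ W.b i t ω := W.β_nonneg _ _ _ _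

theorem b_le_one (i t ω) : W.b i t ω ≤ 1 := W.β_le_one _ _ _ _

theorem b_not (i t ω) : W.b (!i) t ω = 1 - W.b i t ω := by
  unfold b; rw [W.cls_not, W.β_not]

theorem X_step (i t ω) :
    W.X i (t + 1) ω = W.X i t ω + W.b i t ω * (W.s i t ω * (W.R i t ω - W.X i t ω)) :=
  W.X_succ i t ω

theorem N_step (i t ω) :
    W.N i (t + 1) ω = W.N i t ω + if W.b i t ω = 1 then 1 else 0 := W.N_succ i t ω

theorem s_pos (i t ω) : 0 < W.s i t ω := W.a_pos _

theorem N_mono (i ω) : Monotone fun t => W.N i t ω :=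
  monotone_nat_of_le_succ fun t => by rw [W.N_step]; omega

theorem s_anti (i ω) : Antitone fun t => W.s i t ω := fun _ _ h => W.a_anti (W.N_mono i ω h)

theorem s_le (i t ω) : W.s i t ω ≤ W.a 0 := W.a_anti (Nat.zero_le _)

theorem N_le (i t ω) : W.N i t ω ≤ t := by
  induction t with
  | zero => simp [W.N_zero]
  | succ t ih => rw [W.N_step]; split_ifs <;> omega

theorem a_zero : Tendsto W.a atTop (𝓝 0) := by
  have h := W.a_sq.tendsto_atTop_zero
  have h2 := (Real.continuous_sqrt.tendsto _).comp h
  simp only [Real.sqrt_zero] at h2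
  refine h2.congr fun k => ?_
  simp [Real.sqrt_sq (W.a_pos k).le]

theorem exists_bound : ∃ B : ℝ, 0 ≤ B ∧ W.C ≤ B ∧ (∀ i, |W.mean i| ≤ B) ∧
    ∀ i t ω, |W.X i t ω| ≤ B := by
  classical
  obtain ⟨K, hK⟩ : ∃ K, ∀ k, K ≤ k → W.a k ≤ 1 / 2 := by
    have := (W.a_zero.eventually (gt_mem_nhds (show (0 : ℝ) < 1 / 2 by norm_num)))
    obtain ⟨K, hK⟩ := eventually_atTop.1 this
    exact ⟨K, fun k hk => (hK k hk).le⟩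
  set M : ℝ := max (max (|W.x₀ true|) (|W.x₀ false|)) (max W.C 0) with hM
  have hM0 : 0 ≤ M := (le_max_right _ _).trans (le_max_right _ _)
  have hMC : W.C ≤ M := (le_max_left _ _).trans (le_max_right _ _)
  have hMx : ∀ i, |W.x₀ i| ≤ M := by
    intro i
    cases i
    · exact (le_max_right _ _).trans (le_max_left _ _)
    · exact (le_max_left _ _).trans (le_max_left _ _)
  set f : ℕ → ℝ := fun k => M * ∏ j ∈ Finset.range k, max 1 (2 * W.a j) with hf
  have hfs : ∀ k, f (k + 1) = f k * max 1 (2 * W.a k) := fun k => by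
    simp [hf, Finset.prod_range_succ, mul_assoc]
  have hprod : ∀ k, 1 ≤ ∏ j ∈ Finset.range k, max 1 (2 * W.a j) := fun k => by
    induction k with
    | zero => simp
    | succ k ih =>
      rw [Finset.prod_range_succ]
      exact one_le_mul_of_one_le_of_one_le ih (le_max_left _ _)
  have hfM : ∀ k, M ≤ f k := fun k => le_mul_of_one_le_right hM0 (hprod k)
  have hf0 : ∀ k, 0 ≤ f k := fun k => hM0.trans (hfM k)
  have hfmono : Monotone f := monotone_nat_of_le_succ fun k => by
    rw [hfs]; exact le_mul_of_one_le_right (hf0 k) (le_max_left _ _)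
  have hfK : ∀ k, f k ≤ f K := by
    intro k
    rcases le_total k K with h | h
    · exact hfmono h
    · induction k, h using Nat.le_induction with
      | base => exact le_rfl
      | succ k hk ih =>
        rw [hfs, max_eq_left (by linarith [hK k hk]), mul_one]; exact ih
  have hX : ∀ i t ω, |W.X i t ω| ≤ f (W.N i t ω) := by
    intro i t ω
    induction t with
    | zero => rw [W.X_zero]; exact (hMx i).trans (hfM _)
    | succ t ih =>
      rw [W.X_step, W.N_step]
      rcases W.b_val i t ω with h | h
      · simpa [h] using ih
      · rw [h, if_pos rfl, hfs, one_mul]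
        set s := W.s i t ω
        have hs : W.a (W.N i t ω) = s := rfl
        have hs0 : 0 < s := W.s_pos i t ω
        have hR : |W.R i t ω| ≤ f (W.N i t ω) := (W.R_bdd i t ω).trans (hMC.trans (hfM _))
        set F := f (W.N i t ω)
        rw [hs]
        have hF : 0 ≤ F := hf0 _
        have e : W.X i t ω + s * (W.R i t ω - W.X i t ω)
          = (1 - s) * W.X i t ω + s * W.R i t ω := by ring
        rw [e]
        calc |(1 - s) * W.X i t ω + s * W.R i t ω|
            ≤ |1 - s| * |W.X i t ω| + s * |W.R i t ω| := by
              refine (abs_add_le _ _).trans (le_of_eq ?_)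
              rw [abs_mul, abs_mul, abs_of_pos hs0]
          _ ≤ |1 - s| * F + s * F := by gcongr
          _ = F * (|1 - s| + s) := by ring
          _ ≤ F * max 1 (2 * s) := by
              refine mul_le_mul_of_nonneg_left ?_ hF
              rcases le_total s 1 with h1 | h1
              · rw [abs_of_nonneg (by linarith)]
                exact le_trans (by linarith) (le_max_left _ _)
              · rw [abs_of_nonpos (by linarith)]
                exact le_trans (by linarith) (le_max_right _ _)
  refine ⟨max (f K) (max (|W.mean true|) (|W.mean false|)), ?_, ?_, ?_, ?_⟩
  · exact (hf0 K).trans (le_max_left _ _)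
  · exact hMC.trans ((hfM K).trans (le_max_left _ _))
  · intro i
    refine le_trans ?_ (le_max_right _ _)
    cases i
    · exact le_max_right _ _
    · exact le_max_left _ _
  · exact fun i t ω => ((hX i t ω).trans (hfK _)).trans (le_max_left _ _)

/-- A common bound of the rewards, their means and the estimates. -/
def B : ℝ := W.exists_bound.choose

theorem B_nonneg : 0 ≤ W.B := W.exists_bound.choose_spec.1
theorem R_le (i t ω) : |W.R i t ω| ≤ W.B := (W.R_bdd i t ω).trans W.exists_bound.choose_spec.2.1
theorem mean_le (i) : |W.mean i| ≤ W.B := W.exists_bound.choose_spec.2.2.1 i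
theorem X_le (i t ω) : |W.X i t ω| ≤ W.B := W.exists_bound.choose_spec.2.2.2 i t ω

theorem R_sub_X_le (i t u ω) : |W.R i u ω - W.X i t ω| ≤ 2 * W.B :=
  (abs_sub _ _).trans (by linarith [W.R_le i u ω, W.X_le i t ω])

theorem mean_sub_X_le (i t ω) : |W.mean i - W.X i t ω| ≤ 2 * W.B :=
  (abs_sub _ _).trans (by linarith [W.mean_le i, W.X_le i t ω])

theorem R_sub_mean_le (i t ω) : |W.R i t ω - W.mean i| ≤ 2 * W.B :=
  (abs_sub _ _).trans (by linarith [W.R_le i t ω, W.mean_le i])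

theorem X_step_le (i t ω) :
    |W.X i (t + 1) ω - W.X i t ω| ≤ 2 * W.B * W.s i t ω := by
  rw [W.X_step, add_sub_cancel_left]
  rcases W.b_val i t ω with h | h <;> rw [h]
  · simp; exact mul_nonneg (mul_nonneg two_pos.le W.B_nonneg) (W.s_pos i t ω).le
  · rw [one_mul, abs_mul, abs_of_pos (W.s_pos i t ω), mul_comm]
    exact mul_le_mul_of_nonneg_right (W.R_sub_X_le i t t ω) (W.s_pos i t ω).le

/-! #### Measurability -/

theorem rnd_le' (t) : W.rnd t ≤ mΩ := (W.rnd_le t).trans (W.past.le _)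

theorem b_eq_sum (i t ω) : W.b i t ω =
    ∑ c : SignType, {ω | W.cls i t ω = c}.indicator (fun _ => (1 : ℝ)) ω * W.β i c t ω := by
  rw [Finset.sum_eq_single (W.cls i t ω)]
  · simp [b]
  · intro c _ hc
    simp [Set.indicator, hc.symm]
  · simp

theorem b_meas (i t) : Measurable[W.past (t + 1)] (W.b i t) := by
  have : W.b i t = fun ω => ∑ c : SignType,
      {ω | W.cls i t ω = c}.indicator (fun _ => (1 : ℝ)) ω * W.β i c t ω :=
    funext fun ω => W.b_eq_sum i t ω
  rw [this]
  refine Finset.measurable_sum _ fun c _ => ?_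
  refine Measurable.mul ?_ ((W.β_meas i c t).mono (W.rnd_le t) le_rfl)
  refine Measurable.indicator measurable_const ?_
  exact W.past.mono (Nat.le_succ t) _ (W.cls_meas i t c)

theorem N_meas (i t) : Measurable[W.past t] (W.N i t) := by
  induction t with
  | zero =>
    have : W.N i 0 = fun _ => 0 := funext fun ω => W.N_zero i ω
    rw [this]; exact measurable_const
  | succ t ih =>
    have : W.N i (t + 1) = fun ω => W.N i t ω + if W.b i t ω = 1 then 1 else 0 :=
      funext fun ω => W.N_step i t ω
    rw [this]
    refine Measurable.add (ih.mono (W.past.mono (Nat.le_succ t)) le_rfl) ?_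
    refine Measurable.ite ?_ measurable_const measurable_const
    exact (W.b_meas i t) (measurableSet_singleton 1)

theorem s_meas (i t) : Measurable[W.past t] (W.s i t) :=
  (measurable_from_nat (f := W.a)).comp (W.N_meas i t)

theorem X_meas (i t) : Measurable[W.past t] (W.X i t) := by
  induction t with
  | zero =>
    have : W.X i 0 = fun _ => W.x₀ i := funext fun ω => W.X_zero i ω
    rw [this]; exact measurable_const
  | succ t ih =>
    have : W.X i (t + 1) = fun ω =>
        W.X i t ω + W.b i t ω * (W.s i t ω * (W.R i t ω - W.X i t ω)) :=
      funext fun ω => W.X_step i t ω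
    rw [this]
    have hX := ih.mono (W.past.mono (Nat.le_succ t)) le_rfl
    have hs := (W.s_meas i t).mono (W.past.mono (Nat.le_succ t)) le_rfl
    exact hX.add ((W.b_meas i t).mul (hs.mul ((W.R_past i t).sub hX)))

theorem β_meas' (i c t) : Measurable (W.β i c t) := (W.β_meas i c t).mono (W.rnd_le' t) le_rfl

theorem abs_β_le (i c t ω) : |W.β i c t ω| ≤ 1 := by
  rw [abs_of_nonneg (W.β_nonneg i c t ω)]; exact W.β_le_one i c t ω

theorem β_integrable [IsProbabilityMeasure P] (i c t) : Integrable (W.β i c t) P :=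
  integrable_of_abs_le (W.β_meas' i c t) (W.abs_β_le i c t)

theorem p_not [IsProbabilityMeasure P] (i c t) : W.p (!i) (-c) t = 1 - W.p i c t := by
  unfold p
  simp_rw [W.β_not]
  rw [integral_sub (integrable_const _) (W.β_integrable i c t)]
  simp

theorem p_neg (i t) : W.p i (-1) t = W.α := W.β_neg i t

theorem p_pos [IsProbabilityMeasure P] (i t) : W.p i 1 t = 1 - W.α := by
  have h := W.p_not (!i) (-1) t
  simpa [W.p_neg] using h

theorem p_mono [IsProbabilityMeasure P] (i t) : Monotone fun c => W.p i c t := fun _ _ h =>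
  integral_mono (W.β_integrable _ _ _) (W.β_integrable _ _ _) fun ω => W.β_mono i t ω h

theorem α_le_p [IsProbabilityMeasure P] (i c t) : W.α ≤ W.p i c t := by
  rw [← W.p_neg i t]; exact W.p_mono i t (by cases c <;> decide)

theorem p_le [IsProbabilityMeasure P] (i c t) : W.p i c t ≤ 1 - W.α := by
  rw [← W.p_pos i t]; exact W.p_mono i t (by cases c <;> decide)

end Arms

/-! ### Convergent sequences -/

/-- The real sequence `z` converges. -/
def Conv (z : ℕ → ℝ) : Prop := ∃ l, Tendsto z atTop (𝓝 l)

namespace Conv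

theorem const (c : ℝ) : Conv fun _ => c := ⟨c, tendsto_const_nhds⟩

theorem add {x y : ℕ → ℝ} (hx : Conv x) (hy : Conv y) : Conv fun t => x t + y t :=
  ⟨_, hx.choose_spec.add hy.choose_spec⟩

theorem sub {x y : ℕ → ℝ} (hx : Conv x) (hy : Conv y) : Conv fun t => x t - y t :=
  ⟨_, hx.choose_spec.sub hy.choose_spec⟩

theorem mul_left {x : ℕ → ℝ} (hx : Conv x) (c : ℝ) : Conv fun t => c * x t :=
  ⟨_, hx.choose_spec.const_mul c⟩

theorem sum {ι : Type*} (S : Finset ι) {x : ι → ℕ → ℝ} (hx : ∀ i, Conv (x i)) :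
    Conv fun t => ∑ i ∈ S, x i t :=
  ⟨_, tendsto_finsetSum S fun i _ => (hx i).choose_spec⟩

theorem of_summable {x : ℕ → ℝ} (hx : Summable x) : Conv fun T => ∑ t ∈ Finset.range T, x t :=
  ⟨_, hx.hasSum.tendsto_sum_nat⟩

theorem of_abs_le {x y : ℕ → ℝ} (hy : Summable y) (h : ∀ t, |x t| ≤ y t) :
    Conv fun T => ∑ t ∈ Finset.range T, x t :=
  of_summable (Summable.of_norm_bounded hy h)

theorem exists_abs_le {x : ℕ → ℝ} (hx : Conv x) : ∃ K, ∀ t, |x t| ≤ K := by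
  obtain ⟨K, hK⟩ := (hx.choose_spec.abs).bddAbove_range
  exact ⟨K, fun t => hK ⟨t, rfl⟩⟩

end Conv

theorem exists_split_of_abs_le_add {v p q : ℝ} (hp : 0 ≤ p) (hq : 0 ≤ q) (h : |v| ≤ p + q) :
    ∃ v₁ v₂, v = v₁ + v₂ ∧ |v₁| ≤ p ∧ |v₂| ≤ q := by
  obtain ⟨h1, h2⟩ := abs_le.1 h
  refine ⟨max (-p) (min p v), v - max (-p) (min p v), by ring, ?_, ?_⟩
  · exact abs_le.2 ⟨le_max_left _ _, max_le (by linarith) (min_le_left _ _)⟩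
  · rcases le_total p v with h3 | h3
    · rw [min_eq_left h3, max_eq_right (by linarith)]; exact abs_le.2 ⟨by linarith, by linarith⟩
    · rw [min_eq_right h3]
      rcases le_total (-p) v with h4 | h4
      · rw [max_eq_right h4]; simpa using hq
      · rw [max_eq_left h4]; exact abs_le.2 ⟨by linarith, by linarith⟩

namespace Arms

variable {Ω : Type*} [mΩ : MeasurableSpace Ω] {P : Measure Ω} (W : Arms P)

/-! ### Step sizes along the random updates -/

theorem sum_b_mul (i : Bool) (h : ℕ → ℝ) (T : ℕ) (ω : Ω) :
    ∑ t ∈ Finset.range T, W.b i t ω * h (W.N i t ω) = ∑ k ∈ Finset.range (W.N i T ω), h k := by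
  induction T with
  | zero => simp [W.N_zero]
  | succ T ih =>
    rw [Finset.sum_range_succ, ih, W.N_step]
    rcases W.b_val i T ω with hb | hb
    · simp [hb]
    · rw [if_pos hb, Finset.sum_range_succ, hb, one_mul]

theorem integral_rnd_mul [IsProbabilityMeasure P] {t : ℕ} {γ Z : Ω → ℝ}
    (hγ : Measurable[⨆ k, W.rnd (t + k)] γ) (hZ : Measurable[W.past t ⊔ W.rew] Z) :
    ∫ ω, γ ω * Z ω ∂P = (∫ ω, γ ω ∂P) * ∫ ω, Z ω ∂P :=
  integral_mul_of_indep (iSup_le fun _ => W.rnd_le' _) (sup_le (W.past.le _) W.rew_le)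
    (W.indep t) hγ hZ

theorem rnd_le_iSup (t k : ℕ) : W.rnd (t + k) ≤ ⨆ k, W.rnd (t + k) :=
  le_iSup (fun k => W.rnd (t + k)) k

theorem β_neg_le_b (i t ω) : W.β i (-1) t ω ≤ W.b i t ω :=
  W.β_mono i t ω (by cases W.cls i t ω <;> decide)

theorem s_meas' (i t) : Measurable (W.s i t) := (W.s_meas i t).mono (W.past.le _) le_rfl

theorem abs_s_le (i t ω) : |W.s i t ω| ≤ W.a 0 := by
  rw [abs_of_pos (W.s_pos i t ω)]; exact W.s_le i t ω

theorem s_sq_le (i t ω) : |W.s i t ω ^ 2| ≤ W.a 0 ^ 2 := by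
  rw [abs_pow]; exact pow_le_pow_left₀ (abs_nonneg _) (W.abs_s_le i t ω) 2

theorem s_sq_integrable [IsProbabilityMeasure P] (i t) : Integrable (fun ω => W.s i t ω ^ 2) P :=
  integrable_of_abs_le ((W.s_meas' i t).pow_const 2) (W.s_sq_le i t)

theorem summable_integral_s_sq [IsProbabilityMeasure P] (i : Bool) :
    Summable fun t => ∫ ω, W.s i t ω ^ 2 ∂P := by
  refine summable_of_sum_range_le (c := W.α⁻¹ * ∑' k, W.a k ^ 2)
    (fun t => integral_nonneg fun ω => sq_nonneg _) fun T => ?_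
  have h1 : ∀ t, W.α * ∫ ω, W.s i t ω ^ 2 ∂P = ∫ ω, W.β i (-1) t ω * W.s i t ω ^ 2 ∂P := by
    intro t
    rw [W.integral_rnd_mul (t := t), W.β_neg]
    · exact (W.β_meas i (-1) t).mono (W.rnd_le_iSup t 0) le_rfl
    · exact ((W.s_meas i t).pow_const 2).mono le_sup_left le_rfl
  have hint : ∀ t, Integrable (fun ω => W.β i (-1) t ω * W.s i t ω ^ 2) P := fun t =>
    (W.s_sq_integrable i t).bdd_mul (c := 1) (W.β_meas' i _ t).aestronglyMeasurable
      (ae_of_all _ (W.abs_β_le i _ t))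
  rw [inv_mul_eq_div, le_div_iff₀' W.α_pos, Finset.mul_sum]
  simp_rw [h1]
  rw [← integral_finsetSum _ fun t _ => hint t]
  have h2 : ∀ ω, ∑ t ∈ Finset.range T, W.β i (-1) t ω * W.s i t ω ^ 2 ≤ ∑' k, W.a k ^ 2 := by
    intro ω
    calc ∑ t ∈ Finset.range T, W.β i (-1) t ω * W.s i t ω ^ 2
        ≤ ∑ t ∈ Finset.range T, W.b i t ω * W.a (W.N i t ω) ^ 2 :=
          Finset.sum_le_sum fun t _ =>
            mul_le_mul_of_nonneg_right (W.β_neg_le_b i t ω) (sq_nonneg _)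
      _ = ∑ k ∈ Finset.range (W.N i T ω), W.a k ^ 2 := W.sum_b_mul i (fun k => W.a k ^ 2) T ω
      _ ≤ _ := W.a_sq.sum_le_tsum _ fun k _ => sq_nonneg _
  calc ∫ ω, ∑ t ∈ Finset.range T, W.β i (-1) t ω * W.s i t ω ^ 2 ∂P
      ≤ ∫ _, ∑' k, W.a k ^ 2 ∂P :=
        integral_mono (integrable_finsetSum _ fun t _ => hint t) (integrable_const _) h2
    _ = _ := by simp

theorem ae_summable_s_sq [IsProbabilityMeasure P] (i : Bool) :
    ∀ᵐ ω ∂P, Summable fun t => W.s i t ω ^ 2 :=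
  ae_summable_of_summable_integral _ (fun t => (W.s_meas' i t).pow_const 2)
    (fun _ _ => sq_nonneg _) (fun t => ⟨W.a 0 ^ 2, fun ω => (le_abs_self _).trans (W.s_sq_le i t ω)⟩)
    (W.summable_integral_s_sq i)

theorem tendsto_s_zero_of_summable {i : Bool} {ω : Ω} (h : Summable fun t => W.s i t ω ^ 2) :
    Tendsto (fun t => W.s i t ω) atTop (𝓝 0) := by
  have h2 := (Real.continuous_sqrt.tendsto _).comp h.tendsto_atTop_zero
  simp only [Real.sqrt_zero] at h2
  refine h2.congr fun k => ?_
  simp [Real.sqrt_sq (W.s_pos i k ω).le]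

theorem summable_s_sub (i : Bool) (ω : Ω) : Summable fun t => W.s i t ω - W.s i (t + 1) ω := by
  refine summable_of_sum_range_le (c := W.a 0)
    (fun t => sub_nonneg.2 (W.s_anti i ω (Nat.le_succ t))) fun T => ?_
  rw [Finset.sum_range_sub']
  linarith [W.s_le i 0 ω, W.s_pos i T ω]

/-! ### Noise -/

/-- The fresh randomization contributes a convergent noise, whatever weights the history and the
rewards give to it. -/
theorem ae_conv_choice_noise [IsProbabilityMeasure P] (i : Bool) (γ Z : ℕ → Ω → ℝ)
    (hγ : ∀ t, Measurable[W.rnd t] (γ t)) (hγ1 : ∀ t ω, |γ t ω| ≤ 1)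
    (hZ : ∀ t, Measurable[W.past t ⊔ W.rew] (Z t)) (hZ' : ∀ t, Measurable[W.past (t + 1)] (Z t))
    {K : ℝ} (hK : ∀ t ω, |Z t ω| ≤ K * W.s i t ω) :
    ∀ᵐ ω ∂P, Conv fun T => ∑ t ∈ Finset.range T, (γ t ω - ∫ ω, γ t ω ∂P) * Z t ω := by
  have hγm : ∀ t, Measurable (γ t) := fun t => (hγ t).mono (W.rnd_le' t) le_rfl
  have hγi : ∀ t, Integrable (γ t) P := fun t => integrable_of_abs_le (hγm t) (hγ1 t)
  have hg : ∀ t, |∫ ω, γ t ω ∂P| ≤ 1 := fun t => by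
    refine abs_integral_le_integral_abs.trans ?_
    calc ∫ ω, |γ t ω| ∂P ≤ ∫ _, (1 : ℝ) ∂P :=
          integral_mono (hγi t).abs (integrable_const _) (hγ1 t)
      _ = 1 := by simp
  have hd : ∀ t ω, |γ t ω - ∫ ω, γ t ω ∂P| ≤ 2 := fun t ω =>
    (abs_sub _ _).trans (by linarith [hγ1 t ω, hg t])
  have hD : ∀ t ω, |(γ t ω - ∫ ω, γ t ω ∂P) * Z t ω| ≤ 2 * (K * W.s i t ω) := fun t ω => by
    rw [abs_mul]; exact mul_le_mul (hd t ω) (hK t ω) (abs_nonneg _) two_pos.le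
  have hm : ∀ t, Measurable[W.past (t + 1)] fun ω => (γ t ω - ∫ ω, γ t ω ∂P) * Z t ω := fun t =>
    (((hγ t).mono (W.rnd_le t) le_rfl).sub_const _).mul (hZ' t)
  have hm' := fun t => (hm t).mono (W.past.le _) le_rfl
  have hsq : ∀ t ω, ((γ t ω - ∫ ω, γ t ω ∂P) * Z t ω) ^ 2 ≤ (2 * K) ^ 2 * W.s i t ω ^ 2 := by
    intro t ω
    rw [← mul_pow, mul_assoc]
    exact sq_le_sq' (by linarith [neg_le_of_abs_le (hD t ω)]) (le_of_abs_le (hD t ω))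
  refine ae_tendsto_sum_of_martingale_differences W.past _ hm (fun t => ?_) (fun t S hS => ?_) ?_
  · refine ⟨2 * (|K| * W.a 0), fun ω => (hD t ω).trans ?_⟩
    have : K * W.s i t ω ≤ |K| * W.a 0 :=
      mul_le_mul (le_abs_self K) (W.s_le i t ω) (W.s_pos i t ω).le (abs_nonneg _)
    linarith
  · have hSm : MeasurableSet S := W.past.le t S hS
    rw [← integral_indicator hSm]
    have e : ∀ ω, S.indicator (fun ω => (γ t ω - ∫ ω, γ t ω ∂P) * Z t ω) ω
        = (γ t ω - ∫ ω, γ t ω ∂P) * S.indicator (Z t) ω := fun ω => by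
      by_cases h : ω ∈ S <;> simp [h]
    simp_rw [e]
    rw [W.integral_rnd_mul (t := t)]
    · rw [integral_sub (hγi t) (integrable_const _)]; simp
    · exact ((hγ t).sub_const _).mono (W.rnd_le_iSup t 0) le_rfl
    · exact (hZ t).indicator ((le_sup_left : W.past t ≤ _) S hS)
  · refine Summable.of_nonneg_of_le (fun t => integral_nonneg fun ω => sq_nonneg _) (fun t => ?_)
      ((W.summable_integral_s_sq i).mul_left ((2 * K) ^ 2))
    rw [← integral_const_mul]
    refine integral_mono ?_ ((W.s_sq_integrable i t).const_mul _) (hsq t)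
    refine integrable_of_abs_le ((hm' t).pow_const 2) (K := (2 * K) ^ 2 * W.a 0 ^ 2) fun ω => ?_
    rw [abs_of_nonneg (sq_nonneg _)]
    exact (hsq t ω).trans (mul_le_mul_of_nonneg_left
      ((le_abs_self _).trans (W.s_sq_le i t ω)) (sq_nonneg _))

/-- Total of the mixing rates. -/
def κ : ℝ := ∑' k, W.mix k

theorem κ_nonneg : 0 ≤ W.κ := tsum_nonneg W.mix_nonneg

/-- The rewards, weighted by a deterministic bounded sequence, are martingale differences up to a
bounded telescoping term (the solution of the Poisson equation). -/
theorem exists_corrector [IsProbabilityMeasure P] (i : Bool) (π : ℕ → ℝ) {M : ℝ}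
    (hπ : ∀ t, |π t| ≤ M) :
    ∃ V : ℕ → Ω → ℝ, (∀ t, Measurable[W.past t] (V t)) ∧ (∀ t ω, |V t ω| ≤ M * W.κ) ∧
      ∀ t S, MeasurableSet[W.past t] S →
        ∫ ω in S, (π t * (W.R i t ω - W.mean i) + V (t + 1) ω - V t ω) ∂P = 0 := by
  have hM : 0 ≤ M := (abs_nonneg _).trans (hπ 0)
  set c : ℕ → ℕ → Ω → ℝ := fun t k ω =>
    max (-W.mix k) (min (W.mix k) ((P[W.R i (t + k) | W.past t]) ω - W.mean i)) with hc
  have hcb : ∀ t k ω, |c t k ω| ≤ W.mix k := fun t k ω =>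
    abs_le.2 ⟨le_max_left _ _, max_le (by linarith [W.mix_nonneg k]) (min_le_left _ _)⟩
  have hcm : ∀ t k, Measurable[W.past t] (c t k) := fun t k =>
    measurable_const.max (measurable_const.min (stronglyMeasurable_condExp.measurable.sub_const _))
  have hcm' : ∀ t k, Measurable (c t k) := fun t k => (hcm t k).mono (W.past.le t) le_rfl
  have hterm : ∀ t k ω, |π (t + k) * c t k ω| ≤ M * W.mix k := fun t k ω => by
    rw [abs_mul]; exact mul_le_mul (hπ _) (hcb t k ω) (abs_nonneg _) hM
  have hsm : Summable fun k => M * W.mix k := W.mix_summable.mul_left M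
  have hsum : ∀ t ω, Summable fun k => π (t + k) * c t k ω := fun t ω =>
    Summable.of_norm_bounded hsm fun k => hterm t k ω
  have hRi : ∀ u, Integrable (W.R i u) P := fun u =>
    integrable_of_abs_le ((W.R_rew i u).mono W.rew_le le_rfl) (W.R_le i u)
  set V : ℕ → Ω → ℝ := fun t ω => ∑' k, π (t + k) * c t k ω with hV
  have hVm : ∀ t, Measurable[W.past t] (V t) := fun t => by
    refine @measurable_of_tendsto_metrizable Ω ℝ (W.past t) _ _ _ _ (fun n ω => ∑ k ∈ Finset.range n,
      π (t + k) * c t k ω) _ (fun n => ?_) (tendsto_pi_nhds.2 fun ω =>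
        (hsum t ω).hasSum.tendsto_sum_nat)
    exact Finset.measurable_sum _ fun k _ => (hcm t k).const_mul _
  have hVb : ∀ t ω, |V t ω| ≤ M * W.κ := fun t ω => by
    have := tsum_of_norm_bounded (f := fun k => π (t + k) * c t k ω) hsm.hasSum
      fun k => hterm t k ω
    rwa [tsum_mul_left] at this
  have hVS : ∀ t S, MeasurableSet[W.past t] S →
      HasSum (fun k => π (t + k) * ∫ ω in S, (W.R i (t + k) ω - W.mean i) ∂P)
        (∫ ω in S, V t ω ∂P) := by
    intro t S hS
    have h1 := hasSum_integral_of_summable_integral_norm (μ := P.restrict S)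
      (F := fun k ω => π (t + k) * c t k ω)
      (fun k => (integrable_of_abs_le ((hcm' t k).const_mul _) (hterm t k)))
      (by
        refine Summable.of_nonneg_of_le (fun k => integral_nonneg fun ω => norm_nonneg _)
          (fun k => ?_) (hsm.mul_right (P.real S))
        calc ∫ ω in S, ‖π (t + k) * c t k ω‖ ∂P ≤ ∫ _ in S, M * W.mix k ∂P :=
              integral_mono (integrable_of_abs_le ((hcm' t k).const_mul _) (hterm t k)).norm
                (integrable_const _) (hterm t k)
          _ = M * W.mix k * P.real S := by simp [mul_comm])
    refine Eq.subst (motive := fun f => HasSum f _) (funext fun k => ?_) h1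
    rw [integral_const_mul]
    congr 1
    have hce : ∫ ω in S, c t k ω ∂P = ∫ ω in S, ((P[W.R i (t + k) | W.past t]) ω - W.mean i) ∂P := by
      refine setIntegral_congr_ae (W.past.le t S hS) ?_
      filter_upwards [W.mixing i t k] with ω hω _
      obtain ⟨h2, h3⟩ := abs_le.1 hω
      simp only [hc]
      rw [min_eq_right h3, max_eq_right h2]
    rw [hce, integral_sub (hRi _).integrableOn (integrable_const _),
      integral_sub integrable_condExp.integrableOn (integrable_const _),
      setIntegral_condExp (W.past.le t) (hRi _) hS]
  refine ⟨V, hVm, hVb, fun t S hS => ?_⟩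
  have h1 := hVS t S hS
  have h2 := hVS (t + 1) S (W.past.mono (Nat.le_succ t) S hS)
  have h3 := (hasSum_nat_add_iff' (f := fun k => π (t + k) * ∫ ω in S,
    (W.R i (t + k) ω - W.mean i) ∂P) 1).2 h1
  have h4 : ∫ ω in S, V (t + 1) ω ∂P
      = ∫ ω in S, V t ω ∂P - π t * ∫ ω in S, (W.R i t ω - W.mean i) ∂P := by
    refine h2.unique ?_
    simp only [Finset.range_one, Finset.sum_singleton, add_zero] at h3
    refine Eq.subst (motive := fun f => HasSum f _) (funext fun k => ?_) h3
    rw [show t + 1 + k = t + (k + 1) by ring]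
  have hVi : ∀ u, Integrable (V u) P := fun u =>
    integrable_of_abs_le ((hVm u).mono (W.past.le u) le_rfl) (hVb u)
  have hz : Integrable (fun ω => π t * (W.R i t ω - W.mean i)) P :=
    ((hRi t).sub (integrable_const _)).const_mul _
  have hz' : Integrable (fun ω => π t * (W.R i t ω - W.mean i) + V (t + 1) ω) P :=
    hz.add (hVi _)
  rw [integral_sub hz'.integrableOn (hVi t).integrableOn,
    integral_add hz.integrableOn (hVi _).integrableOn, h4, integral_const_mul]
  ring

/-- The noise of the rewards, with slowly varying weights that depend on the history, converges up
to the variation of the weights. -/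
theorem ae_reward_noise [IsProbabilityMeasure P] (i : Bool) (π : ℕ → ℝ) {M : ℝ}
    (hπ : ∀ t, |π t| ≤ M) (w : ℕ → Ω → ℝ) (hw : ∀ t, Measurable[W.past t] (w t)) {K : ℝ}
    (hK : ∀ t ω, |w t ω| ≤ K * W.s i t ω) :
    ∀ᵐ ω ∂P, ∃ z v : ℕ → ℝ, Conv z ∧ (∀ t, |v t| ≤ M * W.κ * |w (t + 1) ω - w t ω|) ∧
      ∀ T, ∑ t ∈ Finset.range T, w t ω * (π t * (W.R i t ω - W.mean i))
        = z T + ∑ t ∈ Finset.range T, v t := by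
  obtain ⟨V, hVm, hVb, hV0⟩ := W.exists_corrector i π hπ
  have hM : 0 ≤ M := (abs_nonneg _).trans (hπ 0)
  set m : ℕ → Ω → ℝ := fun t ω => π t * (W.R i t ω - W.mean i) + V (t + 1) ω - V t ω with hm
  have hmm : ∀ t, Measurable[W.past (t + 1)] (m t) := fun t =>
    ((((W.R_past i t).sub_const _).const_mul _).add (hVm (t + 1))).sub
      ((hVm t).mono (W.past.mono (Nat.le_succ t)) le_rfl)
  set L : ℝ := M * (2 * W.B) + 2 * (M * W.κ) with hL
  have hL0 : 0 ≤ L := by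
    have := W.B_nonneg; have := W.κ_nonneg; positivity
  have hmb : ∀ t ω, |m t ω| ≤ L := fun t ω => by
    have h1 : |π t * (W.R i t ω - W.mean i)| ≤ M * (2 * W.B) := by
      rw [abs_mul]; exact mul_le_mul (hπ t) (W.R_sub_mean_le i t ω) (abs_nonneg _) hM
    have h2 := hVb (t + 1) ω
    have h3 := hVb t ω
    have h4 := abs_add_le (π t * (W.R i t ω - W.mean i)) (V (t + 1) ω)
    have h5 := abs_sub (π t * (W.R i t ω - W.mean i) + V (t + 1) ω) (V t ω)
    simp only [hm]; linarith
  have hD : ∀ t ω, |w t ω * m t ω| ≤ K * W.s i t ω * L := fun t ω => by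
    rw [abs_mul]
    exact mul_le_mul (hK t ω) (hmb t ω) (abs_nonneg _) ((abs_nonneg _).trans (hK t ω))
  have hDm : ∀ t, Measurable[W.past (t + 1)] fun ω => w t ω * m t ω := fun t =>
    ((hw t).mono (W.past.mono (Nat.le_succ t)) le_rfl).mul (hmm t)
  have hsq : ∀ t ω, (w t ω * m t ω) ^ 2 ≤ (K * L) ^ 2 * W.s i t ω ^ 2 := by
    intro t ω
    rw [← mul_pow, mul_right_comm]
    exact sq_le_sq' (by linarith [neg_le_of_abs_le (hD t ω)]) (le_of_abs_le (hD t ω))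
  have hKa : ∀ t ω, K * W.s i t ω ≤ |K| * W.a 0 := fun t ω =>
    mul_le_mul (le_abs_self K) (W.s_le i t ω) (W.s_pos i t ω).le (abs_nonneg _)
  have hconv := ae_tendsto_sum_of_martingale_differences (P := P) W.past
    (fun t ω => w t ω * m t ω) hDm
    (fun t => ⟨|K| * W.a 0 * L, fun ω => (hD t ω).trans
      (mul_le_mul_of_nonneg_right (hKa t ω) hL0)⟩)
    (fun t S hS => by
      have hSm : MeasurableSet S := W.past.le t S hS
      have e : ∀ ω, S.indicator (fun ω => w t ω * m t ω) ω = S.indicator (w t) ω * m t ω :=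
        fun ω => by by_cases h : ω ∈ S <;> simp [h]
      rw [← integral_indicator hSm]
      simp_rw [e]
      refine integral_mul_eq_zero_of_setIntegral_eq_zero (W.past.le t)
        ((hmm t).mono (W.past.le _) le_rfl) (hmb t) ((hw t).indicator hS)
        (K' := |K| * W.a 0) (fun ω => ?_) (hV0 t)
      by_cases h : ω ∈ S
      · simpa [h] using (hK t ω).trans (hKa t ω)
      · simpa [h] using mul_nonneg (abs_nonneg K) (W.a_pos 0).le)
    (by
      refine Summable.of_nonneg_of_le (fun t => integral_nonneg fun ω => sq_nonneg _) (fun t => ?_)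
        ((W.summable_integral_s_sq i).mul_left ((K * L) ^ 2))
      rw [← integral_const_mul]
      refine integral_mono ?_ ((W.s_sq_integrable i t).const_mul _) (hsq t)
      refine integrable_of_abs_le (((hDm t).mono (W.past.le _) le_rfl).pow_const 2)
        (K := (K * L) ^ 2 * W.a 0 ^ 2) fun ω => ?_
      rw [abs_of_nonneg (sq_nonneg _)]
      exact (hsq t ω).trans (mul_le_mul_of_nonneg_left
        ((le_abs_self _).trans (W.s_sq_le i t ω)) (sq_nonneg _)))
  filter_upwards [hconv, W.ae_summable_s_sq i] with ω h1 h2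
  have hw0 : Tendsto (fun T => w T ω * V T ω) atTop (𝓝 0) := by
    have h3 := ((W.tendsto_s_zero_of_summable h2).const_mul K).mul_const (M * W.κ)
    simp only [mul_zero, zero_mul] at h3
    refine squeeze_zero_norm (fun T => ?_) h3
    rw [Real.norm_eq_abs, abs_mul]
    exact mul_le_mul (hK T ω) (hVb T ω) (abs_nonneg _) ((abs_nonneg _).trans (hK T ω))
  refine ⟨fun T => ∑ t ∈ Finset.range T, w t ω * m t ω + (w 0 ω * V 0 ω - w T ω * V T ω),
    fun t => (w (t + 1) ω - w t ω) * V (t + 1) ω,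
    Conv.add h1 ((Conv.const _).sub ⟨0, hw0⟩), fun t => ?_, fun T => ?_⟩
  · rw [abs_mul, mul_comm]
    exact mul_le_mul_of_nonneg_right (hVb _ ω) (abs_nonneg _)
  · induction T with
    | zero => simp
    | succ T ih =>
      rw [Finset.sum_range_succ, ih]
      simp only [Finset.sum_range_succ, hm]
      ring

end Arms

namespace Arms

variable {Ω : Type*} [mΩ : MeasurableSpace Ω] {P : Measure Ω} (W : Arms P)

/-! ### The evolution of a function of an estimate -/

open Classical in
/-- The step size of arm `i` if the class of the history changes after time `t`, and `0` if not. -/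
def chg (i : Bool) (t : ℕ) (ω : Ω) : ℝ :=
  if W.cls i (t + 1) ω = W.cls i t ω then 0 else W.s i t ω

theorem chg_nonneg (i t ω) : 0 ≤ W.chg i t ω := by
  unfold chg; split_ifs
  · exact le_rfl
  · exact (W.s_pos i t ω).le

theorem chg_le (i t ω) : W.chg i t ω ≤ W.s i t ω := by
  unfold chg; split_ifs
  · exact (W.s_pos i t ω).le
  · exact le_rfl

/-- Indicator of a class of the history. -/
def ind (i : Bool) (c : SignType) (t : ℕ) (ω : Ω) : ℝ := if W.cls i t ω = c then 1 else 0

theorem ind_val (i c t ω) : W.ind i c t ω = 0 ∨ W.ind i c t ω = 1 := by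
  unfold ind; split_ifs <;> simp

theorem abs_ind_le (i c t ω) : |W.ind i c t ω| ≤ 1 := by
  rcases W.ind_val i c t ω with h | h <;> simp [h]

theorem ind_meas (i c t) : Measurable[W.past t] (W.ind i c t) := by
  unfold ind
  exact Measurable.ite (W.cls_meas i t c) measurable_const measurable_const

theorem sum_ind_mul (i t ω) (f : SignType → ℝ) :
    ∑ c : SignType, W.ind i c t ω * f c = f (W.cls i t ω) := by
  rw [Finset.sum_eq_single (W.cls i t ω)]
  · simp [ind]
  · intro c _ hc; simp [ind, hc.symm]
  · simp

theorem ind_congr {i c t ω} (h : W.cls i (t + 1) ω = W.cls i t ω) :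
    W.ind i c (t + 1) ω = W.ind i c t ω := by
  simp [ind, h]

theorem abs_comp_X_le (i : Bool) {ψ : ℝ → ℝ} {K : ℝ} (hK : 0 ≤ K)
    (hψ : ∀ x y, |ψ x - ψ y| ≤ K * |x - y|) (t : ℕ) (ω : Ω) :
    |ψ (W.X i t ω)| ≤ |ψ 0| + K * W.B := by
  have h1 := hψ (W.X i t ω) 0
  have h2 := abs_sub_abs_le_abs_sub (ψ (W.X i t ω)) (ψ 0)
  rw [sub_zero] at h1
  have := mul_le_mul_of_nonneg_left (W.X_le i t ω) hK
  linarith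

theorem s_sub_nonneg (i t ω) : 0 ≤ W.s i t ω - W.s i (t + 1) ω :=
  sub_nonneg.2 (W.s_anti i ω (Nat.le_succ t))

/-- Weights that are smooth functions of the estimate, times the step size, vary slowly. -/
theorem abs_weight_sub_le (i : Bool) {ψ : ℝ → ℝ} {K : ℝ} (hK : 0 ≤ K)
    (hψ : ∀ x y, |ψ x - ψ y| ≤ K * |x - y|) (t : ℕ) (ω : Ω) :
    |ψ (W.X i (t + 1) ω) * W.s i (t + 1) ω - ψ (W.X i t ω) * W.s i t ω| ≤
      (|ψ 0| + K * W.B) * (W.s i t ω - W.s i (t + 1) ω) + 2 * K * W.B * W.s i t ω ^ 2 := by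
  have e : ψ (W.X i (t + 1) ω) * W.s i (t + 1) ω - ψ (W.X i t ω) * W.s i t ω
      = ψ (W.X i (t + 1) ω) * (W.s i (t + 1) ω - W.s i t ω)
      + (ψ (W.X i (t + 1) ω) - ψ (W.X i t ω)) * W.s i t ω := by ring
  rw [e]
  refine (abs_add_le _ _).trans (add_le_add ?_ ?_)
  · rw [abs_mul, abs_sub_comm, abs_of_nonneg (W.s_sub_nonneg i t ω)]
    exact mul_le_mul_of_nonneg_right (W.abs_comp_X_le i hK hψ _ ω) (W.s_sub_nonneg i t ω)
  · rw [abs_mul, abs_of_pos (W.s_pos i t ω)]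
    calc _ ≤ K * (2 * W.B * W.s i t ω) * W.s i t ω := by
          refine mul_le_mul_of_nonneg_right ((hψ _ _).trans ?_) (W.s_pos i t ω).le
          exact mul_le_mul_of_nonneg_left (W.X_step_le i t ω) hK
      _ = _ := by ring

/-- The rewards, taken regardless of the choices, contribute a convergent noise. -/
theorem ae_conv_smooth_noise [IsProbabilityMeasure P] (i : Bool) {ψ : ℝ → ℝ} {K : ℝ} (hK : 0 ≤ K)
    (hψ : ∀ x y, |ψ x - ψ y| ≤ K * |x - y|) (hψm : Measurable ψ) : ∀ᵐ ω ∂P, Conv fun T =>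
      ∑ t ∈ Finset.range T, ψ (W.X i t ω) * W.s i t ω * (W.R i t ω - W.mean i) := by
  have h := W.ae_reward_noise i (fun _ => 1) (M := 1) (fun _ => by simp)
    (fun t ω => ψ (W.X i t ω) * W.s i t ω) (fun t => (hψm.comp (W.X_meas i t)).mul (W.s_meas i t))
    (K := |ψ 0| + K * W.B) (fun t ω => by
      rw [abs_mul, abs_of_pos (W.s_pos i t ω)]
      exact mul_le_mul_of_nonneg_right (W.abs_comp_X_le i hK hψ _ ω) (W.s_pos i t ω).le)
  filter_upwards [h, W.ae_summable_s_sq i] with ω h h4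
  obtain ⟨z, v, hz, hv, he⟩ := h
  simp only [one_mul] at he hv
  rw [show (fun T => ∑ t ∈ Finset.range T, ψ (W.X i t ω) * W.s i t ω * (W.R i t ω - W.mean i))
    = fun T => z T + ∑ t ∈ Finset.range T, v t from funext he]
  refine hz.add (Conv.of_abs_le ((((W.summable_s_sub i ω).mul_left (|ψ 0| + K * W.B)).add
    (h4.mul_left (2 * K * W.B))).mul_left W.κ) fun t => (hv t).trans ?_)
  exact mul_le_mul_of_nonneg_left (W.abs_weight_sub_le i hK hψ t ω) W.κ_nonneg

/-- For a smooth function `f` with derivative `ψ`, `f (X i T)` is the sum of its mean drift, a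
convergent noise, and a noise that arises only where the class of the history changes. The last term
is the only trace of the dependence between the choices and the rewards. -/
theorem ae_smooth_identity [IsProbabilityMeasure P] (i : Bool) {f ψ : ℝ → ℝ} {K : ℝ}
    (hK : 0 ≤ K) (hf : ∀ x y, |f y - f x - ψ x * (y - x)| ≤ K * (y - x) ^ 2)
    (hψ : ∀ x y, |ψ x - ψ y| ≤ K * |x - y|) (hψm : Measurable ψ) :
    ∀ᵐ ω ∂P, ∃ z v : ℕ → ℝ, Conv z ∧
      (∀ t, |v t| ≤ 6 * W.κ * (1 - 2 * W.α) * (|ψ (W.X i t ω)| * W.chg i t ω)) ∧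
      ∀ T, f (W.X i T ω) = ∑ t ∈ Finset.range T, ψ (W.X i t ω) *
          (W.b i t ω * (W.s i t ω * (W.mean i - W.X i t ω)))
        + z T + ∑ t ∈ Finset.range T, v t := by
  classical
  set Ψ : ℝ := |ψ 0| + K * W.B with hΨ
  have hB := W.B_nonneg
  have hΨ0 : 0 ≤ Ψ := by positivity
  have hψb : ∀ t ω, |ψ (W.X i t ω)| ≤ Ψ := fun t ω => W.abs_comp_X_le i hK hψ t ω
  set w : ℕ → Ω → ℝ := fun t ω => ψ (W.X i t ω) * W.s i t ω with hw
  have hwm : ∀ t, Measurable[W.past t] (w t) := fun t =>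
    (hψm.comp (W.X_meas i t)).mul (W.s_meas i t)
  have hwK : ∀ t ω, |w t ω| ≤ Ψ * W.s i t ω := fun t ω => by
    simp only [hw]
    rw [abs_mul, abs_of_pos (W.s_pos i t ω)]
    exact mul_le_mul_of_nonneg_right (hψb t ω) (W.s_pos i t ω).le
  -- the weights vary slowly
  set slow : ℕ → Ω → ℝ := fun t ω =>
    Ψ * (W.s i t ω - W.s i (t + 1) ω) + 2 * K * W.B * W.s i t ω ^ 2 with hslow
  have hslow0 : ∀ t ω, 0 ≤ slow t ω := fun t ω => by
    have := W.s_sub_nonneg i t ω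
    simp only [hslow]; positivity
  have hwd : ∀ t ω, |w (t + 1) ω - w t ω| ≤ slow t ω := fun t ω =>
    W.abs_weight_sub_le i hK hψ t ω
  have hα : 0 ≤ 1 - 2 * W.α := by linarith [W.α_le]
  have hκ := W.κ_nonneg
  -- the fresh randomizations of the choices
  have h1 : ∀ c : SignType, ∀ᵐ ω ∂P, Conv fun T => ∑ t ∈ Finset.range T,
      (W.β i c t ω - W.p i c t) * (W.ind i c t ω * w t ω * (W.R i t ω - W.mean i)) := fun c => by
    refine W.ae_conv_choice_noise i (fun t => W.β i c t) _ (fun t => W.β_meas i c t)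
      (fun t => W.abs_β_le i c t) (fun t => ?_) (fun t => ?_) (K := Ψ * (2 * W.B)) fun t ω => ?_
    · exact (((W.ind_meas i c t).mul (hwm t)).mono le_sup_left le_rfl).mul
        (((W.R_rew i t).mono le_sup_right le_rfl).sub_const _)
    · exact (((W.ind_meas i c t).mul (hwm t)).mono (W.past.mono (Nat.le_succ t)) le_rfl).mul
        ((W.R_past i t).sub_const _)
    · rw [abs_mul, abs_mul]
      calc _ ≤ 1 * (Ψ * W.s i t ω) * (2 * W.B) := by
            have := W.s_pos i t ω
            have h3 := W.abs_ind_le i c t ω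
            have h4 := hwK t ω
            have h5 := W.R_sub_mean_le i t ω
            gcongr
        _ = _ := by ring
  have h2 := W.ae_reward_noise i (fun _ => W.α) (M := W.α)
    (fun _ => by rw [abs_of_pos W.α_pos]) w hwm hwK
  have h3 : ∀ c : SignType, ∀ᵐ ω ∂P, ∃ z v : ℕ → ℝ, Conv z ∧
      (∀ t, |v t| ≤ (1 - 2 * W.α) * W.κ * |W.ind i c (t + 1) ω * w (t + 1) ω
        - W.ind i c t ω * w t ω|) ∧
      ∀ T, ∑ t ∈ Finset.range T, (W.ind i c t ω * w t ω) *
        ((W.p i c t - W.α) * (W.R i t ω - W.mean i)) = z T + ∑ t ∈ Finset.range T, v t := fun c => by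
    refine W.ae_reward_noise i (fun t => W.p i c t - W.α) (fun t => ?_)
      (fun t ω => W.ind i c t ω * w t ω) (fun t => (W.ind_meas i c t).mul (hwm t)) (K := Ψ)
      fun t ω => ?_
    · rw [abs_of_nonneg (by linarith [W.α_le_p i c t])]
      linarith [W.p_le i c t]
    · rw [abs_mul]
      calc _ ≤ 1 * |w t ω| := mul_le_mul_of_nonneg_right (W.abs_ind_le i c t ω) (abs_nonneg _)
        _ ≤ _ := by rw [one_mul]; exact hwK t ω
  filter_upwards [ae_all_iff.2 h1, h2, ae_all_iff.2 h3, W.ae_summable_s_sq i] with ω h1 h2 h3 h4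
  have hsl : Summable fun t => slow t ω :=
    ((W.summable_s_sub i ω).mul_left Ψ).add (h4.mul_left _)
  obtain ⟨z0, v0, hz0, hv0, he0⟩ := h2
  choose z v hz hv he using h3
  -- split the variation of the weights of a class into a slow part and the class changes
  have hsplit : ∀ c t, ∃ v₁ v₂, v c t = v₁ + v₂ ∧
      |v₁| ≤ (1 - 2 * W.α) * W.κ * (2 * (|ψ (W.X i t ω)| * W.chg i t ω)) ∧
      |v₂| ≤ (1 - 2 * W.α) * W.κ * slow t ω := by
    intro c t
    have hchg := W.chg_nonneg i t ω
    refine exists_split_of_abs_le_add (by positivity)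
      (mul_nonneg (mul_nonneg hα hκ) (hslow0 t ω)) ((hv c t).trans ?_)
    rw [← mul_add]
    refine mul_le_mul_of_nonneg_left ?_ (mul_nonneg hα hκ)
    by_cases hc : W.cls i (t + 1) ω = W.cls i t ω
    · rw [W.ind_congr hc, ← mul_sub, abs_mul]
      have := mul_le_mul_of_nonneg_right (W.abs_ind_le i c t ω) (abs_nonneg (w (t + 1) ω - w t ω))
      have h6 := hwd t ω
      have h7 : 0 ≤ 2 * (|ψ (W.X i t ω)| * W.chg i t ω) := by positivity
      linarith
    · have h5 : W.chg i t ω = W.s i t ω := if_neg hc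
      rw [h5]
      have h6 : |w t ω| = |ψ (W.X i t ω)| * W.s i t ω := by
        simp only [hw]; rw [abs_mul, abs_of_pos (W.s_pos i t ω)]
      rw [← h6]
      have h7 := abs_sub (W.ind i c (t + 1) ω * w (t + 1) ω) (W.ind i c t ω * w t ω)
      rw [abs_mul (W.ind i c (t + 1) ω) (w (t + 1) ω), abs_mul (W.ind i c t ω) (w t ω)] at h7
      have h8 := mul_le_mul_of_nonneg_right (W.abs_ind_le i c t ω) (abs_nonneg (w t ω))
      have h9 := mul_le_mul_of_nonneg_right (W.abs_ind_le i c (t + 1) ω)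
        (abs_nonneg (w (t + 1) ω))
      have h10 := abs_sub_abs_le_abs_sub (w (t + 1) ω) (w t ω)
      have h11 := hwd t ω
      linarith
  choose v₁ v₂ hv12 hv1 hv2 using hsplit
  set r : ℕ → ℝ := fun t => f (W.X i (t + 1) ω) - f (W.X i t ω)
    - ψ (W.X i t ω) * (W.X i (t + 1) ω - W.X i t ω) with hr
  have hrs : Conv fun T => ∑ t ∈ Finset.range T, r t := by
    refine Conv.of_abs_le (h4.mul_left (K * (2 * W.B) ^ 2)) fun t => (hf _ _).trans ?_
    rw [mul_assoc, ← mul_pow]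
    refine mul_le_mul_of_nonneg_left ?_ hK
    exact sq_le_sq' (by linarith [neg_le_of_abs_le (W.X_step_le i t ω)])
      (le_of_abs_le (W.X_step_le i t ω))
  refine ⟨fun T => f (W.x₀ i) + ∑ t ∈ Finset.range T, r t
      + ∑ c, ∑ t ∈ Finset.range T,
        (W.β i c t ω - W.p i c t) * (W.ind i c t ω * w t ω * (W.R i t ω - W.mean i))
      + (z0 T + ∑ t ∈ Finset.range T, v0 t)
      + ∑ c, (z c T + ∑ t ∈ Finset.range T, v₂ c t),
    fun t => ∑ c, v₁ c t, ?_, fun t => ?_, fun T => ?_⟩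
  · refine ((((Conv.const _).add hrs).add (Conv.sum _ h1)).add (hz0.add ?_)).add
      (Conv.sum _ fun c => (hz c).add ?_)
    · refine Conv.of_abs_le (hsl.mul_left (W.α * W.κ)) fun t => (hv0 t).trans ?_
      exact mul_le_mul_of_nonneg_left (hwd t ω) (mul_nonneg W.α_pos.le hκ)
    · exact Conv.of_abs_le (hsl.mul_left _) (hv2 c)
  · refine (Finset.abs_sum_le_sum_abs _ _).trans ((Finset.sum_le_sum fun c _ => hv1 c t).trans ?_)
    have hcard : Fintype.card SignType = 3 := rfl
    simp only [Finset.sum_const, Finset.card_univ, hcard, nsmul_eq_mul]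
    push_cast
    exact le_of_eq (by ring)
  · have key : ∀ t, f (W.X i (t + 1) ω) - f (W.X i t ω) =
        ψ (W.X i t ω) * (W.b i t ω * (W.s i t ω * (W.mean i - W.X i t ω))) + r t
        + ∑ c, (W.β i c t ω - W.p i c t) * (W.ind i c t ω * w t ω * (W.R i t ω - W.mean i))
        + w t ω * (W.α * (W.R i t ω - W.mean i))
        + ∑ c, (W.ind i c t ω * w t ω) * ((W.p i c t - W.α) * (W.R i t ω - W.mean i)) := by
      intro t
      have e1 : ∑ c, (W.β i c t ω - W.p i c t) *
          (W.ind i c t ω * w t ω * (W.R i t ω - W.mean i))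
          = (W.b i t ω - W.p i (W.cls i t ω) t) * (w t ω * (W.R i t ω - W.mean i)) := by
        rw [b, ← W.sum_ind_mul i t ω fun c => (W.β i c t ω - W.p i c t)
          * (w t ω * (W.R i t ω - W.mean i))]
        exact Finset.sum_congr rfl fun c _ => by ring
      have e2 : ∑ c, (W.ind i c t ω * w t ω) * ((W.p i c t - W.α) * (W.R i t ω - W.mean i))
          = (W.p i (W.cls i t ω) t - W.α) * (w t ω * (W.R i t ω - W.mean i)) := by
        rw [← W.sum_ind_mul i t ω fun c => (W.p i c t - W.α)
          * (w t ω * (W.R i t ω - W.mean i))]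
        exact Finset.sum_congr rfl fun c _ => by ring
      rw [e1, e2]
      simp only [hr, hw]
      rw [show W.X i (t + 1) ω - W.X i t ω = W.b i t ω * (W.s i t ω * (W.R i t ω - W.X i t ω)) by
        rw [W.X_step]; ring]
      ring
    have tel : f (W.X i T ω) = f (W.x₀ i)
        + ∑ t ∈ Finset.range T, (f (W.X i (t + 1) ω) - f (W.X i t ω)) := by
      rw [Finset.sum_range_sub (fun t => f (W.X i t ω)), W.X_zero]; ring
    rw [tel]
    simp_rw [key]
    simp only [Finset.sum_add_distrib]
    rw [← he0 T]
    have e3 : ∑ c, z c T + ∑ c, ∑ t ∈ Finset.range T, v₂ c t + ∑ t ∈ Finset.range T, ∑ c, v₁ c t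
        = ∑ t ∈ Finset.range T, ∑ c,
          (W.ind i c t ω * w t ω) * ((W.p i c t - W.α) * (W.R i t ω - W.mean i)) := by
      rw [Finset.sum_comm (s := Finset.range T), Finset.sum_comm (s := Finset.range T),
        ← Finset.sum_add_distrib, ← Finset.sum_add_distrib]
      refine Finset.sum_congr rfl fun c _ => ?_
      rw [he c T, add_assoc, ← Finset.sum_add_distrib]
      congr 1
      exact Finset.sum_congr rfl fun t _ => by rw [hv12 c t]; ring
    rw [← e3, Finset.sum_comm (s := Finset.range T) (t := Finset.univ)
      (f := fun t c => (W.β i c t ω - W.p i c t) *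
        (W.ind i c t ω * w t ω * (W.R i t ω - W.mean i)))]
    ring

/-! ### Both arms are updated at comparable rates -/

/-- The two arms use up their step sizes at comparable rates. -/
theorem ae_rates [IsProbabilityMeasure P] (i : Bool) : ∀ᵐ ω ∂P,
    (∃ K, ∀ T, W.α * ∑ t ∈ Finset.range T, W.s i t ω
      ≤ ∑ t ∈ Finset.range T, W.b i t ω * W.s i t ω + K) ∧
    (∃ K, ∀ T, W.α * ∑ t ∈ Finset.range T, W.a t
      ≤ ∑ t ∈ Finset.range T, W.b i t ω * W.s i t ω + K) := by
  have h1 : ∀ᵐ ω ∂P, Conv fun T => ∑ t ∈ Finset.range T,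
      (W.β i (-1) t ω - W.p i (-1) t) * W.s i t ω :=
    W.ae_conv_choice_noise i (fun t => W.β i (-1) t) (W.s i) (fun t => W.β_meas i _ t)
      (fun t => W.abs_β_le i _ t) (fun t => (W.s_meas i t).mono le_sup_left le_rfl)
      (fun t => (W.s_meas i t).mono (W.past.mono (Nat.le_succ t)) le_rfl) (K := 1)
      fun t ω => by rw [abs_of_pos (W.s_pos i t ω), one_mul]
  have h2 : ∀ᵐ ω ∂P, Conv fun T => ∑ t ∈ Finset.range T,
      (W.β i (-1) t ω - W.p i (-1) t) * W.a t :=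
    W.ae_conv_choice_noise i (fun t => W.β i (-1) t) (fun t _ => W.a t)
      (fun t => W.β_meas i _ t)
      (fun t => W.abs_β_le i _ t) (fun t => measurable_const)
      (fun t => measurable_const) (K := 1)
      fun t ω => by
        rw [abs_of_pos (W.a_pos t), one_mul]
        exact W.a_anti (W.N_le i t ω)
  filter_upwards [h1, h2] with ω h1 h2
  constructor
  · obtain ⟨K, hK⟩ := h1.exists_abs_le
    refine ⟨K, fun T => ?_⟩
    have h3 := neg_le_of_abs_le (hK T)
    simp only [W.p_neg, sub_mul, Finset.sum_sub_distrib, ← Finset.mul_sum] at h3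
    have h4 : ∑ t ∈ Finset.range T, W.β i (-1) t ω * W.s i t ω
        ≤ ∑ t ∈ Finset.range T, W.b i t ω * W.s i t ω := Finset.sum_le_sum fun t _ =>
      mul_le_mul_of_nonneg_right (W.β_neg_le_b i t ω) (W.s_pos i t ω).le
    linarith
  · obtain ⟨K, hK⟩ := h2.exists_abs_le
    refine ⟨K, fun T => ?_⟩
    have h3 := neg_le_of_abs_le (hK T)
    simp only [W.p_neg, sub_mul, Finset.sum_sub_distrib, ← Finset.mul_sum] at h3
    have h4 : ∑ t ∈ Finset.range T, W.β i (-1) t ω * W.a t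
        ≤ ∑ t ∈ Finset.range T, W.b i t ω * W.s i t ω := Finset.sum_le_sum fun t _ =>
      mul_le_mul (W.β_neg_le_b i t ω) (W.a_anti (W.N_le i t ω)) (W.a_pos t).le (W.b_nonneg i t ω)
    linarith

theorem tendsto_sum_a : Tendsto (fun T => ∑ t ∈ Finset.range T, W.a t) atTop atTop :=
  (not_summable_iff_tendsto_nat_atTop_of_nonneg fun t => (W.a_pos t).le).1 W.a_sum

theorem ae_tendsto_sum_b_s [IsProbabilityMeasure P] (i : Bool) : ∀ᵐ ω ∂P,
    Tendsto (fun T => ∑ t ∈ Finset.range T, W.b i t ω * W.s i t ω) atTop atTop := by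
  filter_upwards [W.ae_rates i] with ω h
  obtain ⟨K, hK⟩ := h.2
  have h1 := tendsto_atTop_add_const_right atTop (-K) (W.tendsto_sum_a.const_mul_atTop W.α_pos)
  exact tendsto_atTop_mono (fun T => by linarith [hK T]) h1

/-- The step sizes of one arm are, on average, at most `α⁻²` times those of the other one. -/
theorem ae_sum_s_le [IsProbabilityMeasure P] (i j : Bool) : ∀ᵐ ω ∂P, ∃ K, ∀ T,
    W.α ^ 2 * ∑ t ∈ Finset.range T, W.s i t ω ≤ ∑ t ∈ Finset.range T, W.s j t ω + K := by
  filter_upwards [W.ae_rates i, W.ae_rates j] with ω hi hj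
  obtain ⟨K, hK⟩ := hi.1
  obtain ⟨K', hK'⟩ := hj.2
  refine ⟨W.α * K + K', fun T => ?_⟩
  have h1 : ∑ t ∈ Finset.range T, W.b i t ω * W.s i t ω ≤ ∑ t ∈ Finset.range T, W.a t := by
    rw [show ∑ t ∈ Finset.range T, W.b i t ω * W.s i t ω
      = ∑ t ∈ Finset.range T, W.b i t ω * W.a (W.N i t ω) from rfl, W.sum_b_mul]
    exact Finset.sum_le_sum_of_subset_of_nonneg (by
      rw [Finset.range_subset_range]; exact W.N_le i T ω) fun k _ _ => (W.a_pos k).le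
  have h2 : ∑ t ∈ Finset.range T, W.b j t ω * W.s j t ω ≤ ∑ t ∈ Finset.range T, W.s j t ω :=
    Finset.sum_le_sum fun t _ => by
      have := mul_le_mul_of_nonneg_right (W.b_le_one j t ω) (W.s_pos j t ω).le
      linarith
  have h3 := mul_le_mul_of_nonneg_left (hK T) W.α_pos.le
  have h4 := mul_le_mul_of_nonneg_left h1 W.α_pos.le
  nlinarith [hK' T]

end Arms

/-! ### Positive parts and their squares -/

theorem abs_posPart_sq_le (l x y : ℝ) :
    |max (y - l) 0 ^ 2 - max (x - l) 0 ^ 2 - 2 * max (x - l) 0 * (y - x)| ≤ 1 * (y - x) ^ 2 := by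
  rw [abs_le, one_mul]
  rcases le_total (x - l) 0 with hx | hx <;> rcases le_total (y - l) 0 with hy | hy <;>
    simp only [max_eq_right, max_eq_left, hx, hy] <;> constructor <;> nlinarith

theorem abs_posPart_sub_le (l x y : ℝ) :
    |2 * max (x - l) 0 - 2 * max (y - l) 0| ≤ 2 * |x - y| := by
  rw [← mul_sub, abs_mul, abs_two]
  have := abs_max_sub_max_le_abs (x - l) (y - l) 0
  have h : x - l - (y - l) = x - y := by ring
  rw [h] at this
  linarith

/-- A nonnegative sequence with convergent noise `n` and a drift that is at least proportional to
it, at non-summable rates `a`, tends to zero. -/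
theorem tendsto_zero_of_drift {q n d a : ℕ → ℝ} (hq0 : ∀ t, 0 ≤ q t) (ha : ∀ t, 0 ≤ a t)
    (hasum : ¬ Summable a) (hd : ∀ t, a t * q t ≤ d t)
    (hn : Conv fun T => ∑ t ∈ Finset.range T, n t)
    (hstep : ∀ t, q (t + 1) ≤ q t + (n t - d t)) : Tendsto q atTop (𝓝 0) := by
  have hd0 : ∀ t, 0 ≤ d t := fun t => (mul_nonneg (ha t) (hq0 t)).trans (hd t)
  set N : ℕ → ℝ := fun T => ∑ t ∈ Finset.range T, n t with hN
  set D : ℕ → ℝ := fun T => ∑ t ∈ Finset.range T, d t with hD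
  have hmono : Antitone fun T => q T + D T - N T := antitone_nat_of_succ_le fun T => by
    simp only [hD, hN, Finset.sum_range_succ]
    linarith [hstep T]
  have hD0 : ∀ T, 0 ≤ D T := fun T => Finset.sum_nonneg fun t _ => hd0 t
  obtain ⟨K, hK⟩ := hn.exists_abs_le
  have hDb : ∀ T, D T ≤ q 0 + K := fun T => by
    have h5 := hmono (Nat.zero_le T)
    simp only [hD, hN, Finset.range_zero, Finset.sum_empty] at h5
    have h6 := le_of_abs_le (hK T)
    have h7 := hq0 T
    simp only [hD] at h6 ⊢
    linarith
  have hsum : Summable d := summable_of_sum_range_le hd0 hDb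
  have hqconv : Conv q := by
    have h5 : Conv fun T => q T + D T - N T := by
      refine ⟨_, tendsto_atTop_ciInf hmono ⟨-K, ?_⟩⟩
      rintro _ ⟨T, rfl⟩
      have h6 := le_of_abs_le (hK T)
      have h7 := hq0 T
      have h8 := hD0 T
      show -K ≤ q T + D T - N T
      linarith
    have := (h5.sub (Conv.of_summable hsum)).add hn
    refine this.imp fun l hl => hl.congr fun T => by ring
  obtain ⟨l, hl⟩ := hqconv
  have hl0 : 0 ≤ l := ge_of_tendsto' hl hq0
  rcases hl0.eq_or_lt with h | hlpos
  · rwa [← h] at hl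
  · exfalso
    obtain ⟨T0, hT0⟩ := eventually_atTop.1 (hl.eventually (lt_mem_nhds (half_lt_self hlpos)))
    have h5 : Summable fun t => l / 2 * a (t + T0) :=
      Summable.of_nonneg_of_le (fun t => mul_nonneg (by linarith) (ha _))
        (fun t => le_trans (by
          rw [mul_comm]
          exact mul_le_mul_of_nonneg_left (hT0 _ (Nat.le_add_left _ _)).le (ha _)) (hd _))
        ((summable_nat_add_iff T0).2 hsum)
    have h6 := (summable_mul_left_iff (half_pos hlpos).ne').1 h5
    exact hasum ((summable_nat_add_iff T0).1 h6)

namespace Arms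

variable {Ω : Type*} [mΩ : MeasurableSpace Ω] {P : Measure Ω} (W : Arms P)

/-! ### The estimates do not stay above both means -/

/-- The lower envelope of the two weighted means of `x` and `y` with weights `α` and `1 - α`. -/
def env (x y : ℝ) : ℝ := min (W.α * x + (1 - W.α) * y) ((1 - W.α) * x + W.α * y)

theorem env_comm (x y : ℝ) : W.env x y = W.env y x := by
  unfold env; rw [min_comm]; congr 1 <;> ring

theorem env_nonneg {x y : ℝ} (hx : 0 ≤ x) (hy : 0 ≤ y) : 0 ≤ W.env x y := by
  have := W.α_pos; have h2 := W.α_le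
  have h3 : 0 ≤ 1 - W.α := by linarith
  exact le_min (by positivity) (by positivity)

theorem env_le {x y : ℝ} (hx : 0 ≤ x) (hy : 0 ≤ y) : W.env x y ≤ x + y := by
  have := W.α_pos; have h2 := W.α_le
  refine (min_le_left _ _).trans ?_
  nlinarith

theorem mul_le_env {x y : ℝ} (hx : 0 ≤ x) (hy : 0 ≤ y) : W.α * x ≤ W.env x y := by
  have := W.α_pos; have h2 := W.α_le
  refine le_min ?_ ?_ <;> nlinarith

/-- The weight of an update of arm `i` in the evolution of the envelope. Its mean is
`α * (1 - α)` in every class, so that the envelope does not see the dependence of the choice on the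
class. -/
def wt (i : Bool) (c : SignType) (t : ℕ) (ω : Ω) : ℝ :=
  W.β i (-1) t ω * (1 - W.p i c t) + (W.β i c t ω - W.β i (-1) t ω) * W.α

theorem wt_eq_zero {i c t ω} (h : W.β i c t ω = 0) : W.wt i c t ω = 0 := by
  have h1 : W.β i (-1) t ω ≤ W.β i c t ω := W.β_mono i t ω (by cases c <;> decide)
  have h2 := W.β_nonneg i (-1) t ω
  have h3 : W.β i (-1) t ω = 0 := by linarith
  simp [wt, h, h3]

theorem wt_mem [IsProbabilityMeasure P] {i c t ω} (h : W.β i c t ω = 1) :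
    W.α ≤ W.wt i c t ω ∧ W.wt i c t ω ≤ 1 - W.α := by
  have := W.α_le_p i c t; have := W.p_le i c t; have := W.α_le
  unfold wt
  rw [h]
  rcases W.β_val i (-1) t ω with h3 | h3 <;> rw [h3] <;> constructor <;> linarith

theorem abs_wt_le [IsProbabilityMeasure P] (i c t ω) : |W.wt i c t ω| ≤ 1 := by
  rcases W.β_val i c t ω with h | h
  · rw [W.wt_eq_zero h]; simp
  · have := W.wt_mem h; have := W.α_pos
    rw [abs_le]; constructor <;> linarith

theorem wt_meas (i c t) : Measurable[W.rnd t] (W.wt i c t) :=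
  ((W.β_meas i _ t).mul_const _).add (((W.β_meas i c t).sub (W.β_meas i _ t)).mul_const _)

theorem integral_wt [IsProbabilityMeasure P] (i c t) :
    ∫ ω, W.wt i c t ω ∂P = W.α * (1 - W.α) := by
  unfold wt
  have h1 := W.β_integrable i (-1) t
  have h2 := W.β_integrable i c t
  have h3 : Integrable (fun ω => W.β i c t ω - W.β i (-1) t ω) P := h2.sub h1
  rw [integral_add (h1.mul_const _) (h3.mul_const _), integral_mul_const, integral_mul_const,
    integral_sub h2 h1, W.β_neg]
  change W.α * (1 - W.p i c t) + (W.p i c t - W.α) * W.α = _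
  ring

/-- If arm `i` is updated and `φ` of its estimate changes by `δ`, the envelope changes by at most the
weight of the update times `δ`. -/
theorem env_step [IsProbabilityMeasure P]
    (hcls : ∀ i t ω, W.cls i t ω = SignType.sign (W.X i t ω - W.X (!i) t ω))
    {i : Bool} {t : ℕ} {ω : Ω} (hb : W.b i t ω = 1) {φ : ℝ → ℝ} (hφ : Monotone φ) (δ : ℝ) :
    W.env (φ (W.X i t ω) + δ) (φ (W.X (!i) t ω)) ≤
      W.env (φ (W.X i t ω)) (φ (W.X (!i) t ω)) + W.wt i (W.cls i t ω) t ω * δ := by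
  set x := φ (W.X i t ω)
  set y := φ (W.X (!i) t ω)
  have hα := W.α_pos; have hα2 := W.α_le
  rcases lt_trichotomy (W.X i t ω - W.X (!i) t ω) 0 with h | h | h
  · have hc : W.cls i t ω = -1 := by rw [hcls, sign_neg h]
    have hb' : W.β i (-1) t ω = 1 := by rw [← hc]; exact hb
    have hxy : x ≤ y := hφ (by linarith)
    have hw : W.wt i (W.cls i t ω) t ω = 1 - W.α := by
      rw [hc]; unfold wt; rw [hb', W.p_neg]; ring
    rw [hw]
    refine (min_le_right _ _).trans ?_
    have : W.env x y = (1 - W.α) * x + W.α * y := min_eq_right (by nlinarith)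
    rw [this]; linarith
  · have hb' : W.β i (W.cls i t ω) t ω = 1 := hb
    have hxy : x = y := by
      have : W.X i t ω = W.X (!i) t ω := by linarith
      simp only [x, y, this]
    obtain ⟨h1, h2⟩ := W.wt_mem hb'
    rw [← hxy]
    have : W.env x x = x := by
      unfold env; rw [min_eq_left] <;> linarith
    rw [this]
    unfold env
    rcases le_total 0 δ with hd | hd
    · refine (min_le_left _ _).trans ?_; nlinarith
    · refine (min_le_right _ _).trans ?_; nlinarith
  · have hc : W.cls i t ω = 1 := by rw [hcls, sign_pos h]
    have hb' : W.β i 1 t ω = 1 := by rw [← hc]; exact hb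
    have hxy : y ≤ x := hφ (by linarith)
    have hw : W.wt i (W.cls i t ω) t ω = W.α := by
      rw [hc]; unfold wt; rw [hb', W.p_pos]; ring
    rw [hw]
    refine (min_le_left _ _).trans ?_
    have : W.env x y = W.α * x + (1 - W.α) * y := min_eq_left (by nlinarith)
    rw [this]; linarith

set_option maxHeartbeats 400000 in
/-- In the limit, the estimates are at most the larger one of the two means. -/
theorem ae_tendsto_excess [IsProbabilityMeasure P]
    (hcls : ∀ i t ω, W.cls i t ω = SignType.sign (W.X i t ω - W.X (!i) t ω))
    {m : ℝ} (hm : ∀ i, W.mean i ≤ m) :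
    ∀ᵐ ω ∂P, ∀ i, Tendsto (fun t => max (W.X i t ω - m) 0) atTop (𝓝 0) := by
  have hψm : Measurable fun x : ℝ => 2 * max (x - m) 0 := by fun_prop
  have h1 : ∀ i, ∀ᵐ ω ∂P, Conv fun T => ∑ t ∈ Finset.range T,
      2 * max (W.X i t ω - m) 0 * W.s i t ω * (W.R i t ω - W.mean i) := fun i =>
    W.ae_conv_smooth_noise (ψ := fun x : ℝ => 2 * max (x - m) 0) i zero_le_two
      (fun x y => abs_posPart_sub_le m x y) hψm
  have h2 : ∀ i (c : SignType), ∀ᵐ ω ∂P, Conv fun T => ∑ t ∈ Finset.range T,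
      (W.wt i c t ω - ∫ ω, W.wt i c t ω ∂P) *
        (W.ind i c t ω * (2 * max (W.X i t ω - m) 0 * (W.s i t ω * (W.R i t ω - W.X i t ω)))) := by
    intro i c
    have hZ : ∀ t, Measurable[W.past t] fun ω => 2 * max (W.X i t ω - m) 0 :=
      fun t => hψm.comp (W.X_meas i t)
    have hX1 := fun t => (W.X_meas i t).mono (le_sup_left : W.past t ≤ W.past t ⊔ W.rew) le_rfl
    have hs1 := fun t => (W.s_meas i t).mono (le_sup_left : W.past t ≤ W.past t ⊔ W.rew) le_rfl
    have hX2 := fun t => (W.X_meas i t).mono (W.past.mono (Nat.le_succ t)) le_rfl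
    have hs2 := fun t => (W.s_meas i t).mono (W.past.mono (Nat.le_succ t)) le_rfl
    refine W.ae_conv_choice_noise i (fun t => W.wt i c t) _ (fun t => W.wt_meas i c t)
      (fun t => W.abs_wt_le i c t) (fun t => ?_) (fun t => ?_)
      (K := 2 * (W.B + |m|) * (2 * W.B)) fun t ω => ?_
    · exact ((W.ind_meas i c t).mono le_sup_left le_rfl).mul
        (((hZ t).mono le_sup_left le_rfl).mul
          ((hs1 t).mul (((W.R_rew i t).mono le_sup_right le_rfl).sub (hX1 t))))
    · exact ((W.ind_meas i c t).mono (W.past.mono (Nat.le_succ t)) le_rfl).mul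
        (((hZ t).mono (W.past.mono (Nat.le_succ t)) le_rfl).mul
          ((hs2 t).mul ((W.R_past i t).sub (hX2 t))))
    · have hB := W.B_nonneg
      have hs := W.s_pos i t ω
      have h3 : |2 * max (W.X i t ω - m) 0| ≤ 2 * (W.B + |m|) := by
        rw [abs_mul, abs_two, abs_of_nonneg (le_max_right _ _)]
        have h4 := le_of_abs_le (W.X_le i t ω)
        have h5 := neg_abs_le m
        have h6 : max (W.X i t ω - m) 0 ≤ W.B + |m| :=
          max_le (by linarith) (by positivity)
        linarith
      rw [abs_mul, abs_mul, abs_mul (W.s i t ω), abs_of_pos hs]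
      calc _ ≤ 1 * (2 * (W.B + |m|) * (W.s i t ω * (2 * W.B))) := by
            have h7 := W.abs_ind_le i c t ω
            have h8 := W.R_sub_X_le i t t ω
            gcongr
        _ = _ := by ring
  filter_upwards [ae_all_iff.2 h1, ae_all_iff.2 fun i => ae_all_iff.2 (h2 i),
    ae_all_iff.2 W.ae_summable_s_sq] with ω h1 h2 h4
  set u : Bool → ℕ → ℝ := fun i t => max (W.X i t ω - m) 0 with hu
  have hu0 : ∀ i t, 0 ≤ u i t := fun i t => le_max_right _ _
  set φ : ℝ → ℝ := fun x => max (x - m) 0 ^ 2 with hφ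
  have hφm : Monotone φ := fun x y h =>
    pow_le_pow_left₀ (le_max_right _ _) (max_le_max (by linarith) le_rfl) 2
  set q : ℕ → ℝ := fun t => W.env (φ (W.X true t ω)) (φ (W.X false t ω)) with hq
  have hq0 : ∀ t, 0 ≤ q t := fun t => W.env_nonneg (sq_nonneg _) (sq_nonneg _)
  have hα := W.α_pos; have hα2 := W.α_le
  set ρ := W.α * (1 - W.α) with hρ
  have hρ0 : 0 < ρ := mul_pos hα (by linarith)
  have hqi : ∀ i t, q t = W.env (φ (W.X i t ω)) (φ (W.X (!i) t ω)) := fun i t => by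
    cases i
    · simp only [hq, Bool.not_false]; rw [W.env_comm]
    · rfl
  -- the mean drift and the noise of one arm
  set d : Bool → ℕ → ℝ := fun i t => ρ * (2 * u i t * (W.s i t ω * (W.X i t ω - W.mean i))) with hd
  set n : Bool → ℕ → ℝ := fun i t =>
    ∑ c, (W.wt i c t ω - ∫ ω, W.wt i c t ω ∂P) *
        (W.ind i c t ω * (2 * max (W.X i t ω - m) 0 * (W.s i t ω * (W.R i t ω - W.X i t ω))))
    + ρ * (2 * u i t * W.s i t ω * (W.R i t ω - W.mean i)) + (2 * W.B) ^ 2 * W.s i t ω ^ 2 with hn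
  have harm : ∀ i t, W.wt i (W.cls i t ω) t ω * (φ (W.X i t ω + W.s i t ω *
      (W.R i t ω - W.X i t ω)) - φ (W.X i t ω)) ≤ n i t - d i t := by
    intro i t
    set h := W.s i t ω * (W.R i t ω - W.X i t ω) with hh
    have e1 : ∑ c, (W.wt i c t ω - ∫ ω, W.wt i c t ω ∂P) *
        (W.ind i c t ω * (2 * max (W.X i t ω - m) 0 * h))
        = (W.wt i (W.cls i t ω) t ω - ρ) * (2 * u i t * h) := by
      rw [← W.sum_ind_mul i t ω fun c => (W.wt i c t ω - ρ) * (2 * u i t * h)]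
      exact Finset.sum_congr rfl fun c _ => by rw [W.integral_wt]; ring
    have e2 := le_of_abs_le (abs_posPart_sq_le m (W.X i t ω) (W.X i t ω + h))
    have hw : 0 ≤ W.wt i (W.cls i t ω) t ω ∧ W.wt i (W.cls i t ω) t ω ≤ 1 := by
      refine ⟨?_, le_of_abs_le (W.abs_wt_le _ _ _ _)⟩
      rcases W.b_val i t ω with hb | hb
      · rw [W.wt_eq_zero hb]
      · exact hα.le.trans (W.wt_mem hb).1
    have e3 : h ^ 2 ≤ (2 * W.B) ^ 2 * W.s i t ω ^ 2 := by
      rw [hh, mul_pow, mul_comm]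
      refine mul_le_mul_of_nonneg_right ?_ (sq_nonneg _)
      exact sq_le_sq' (by linarith [neg_le_of_abs_le (W.R_sub_X_le i t t ω)])
        (le_of_abs_le (W.R_sub_X_le i t t ω))
    simp only [hn, hd]
    rw [e1]
    simp only [add_sub_cancel_left] at e2
    have e4 : φ (W.X i t ω + h) - φ (W.X i t ω) ≤ 2 * u i t * h + h ^ 2 := by
      simp only [hφ, hu]; linarith
    have e5 := mul_le_mul_of_nonneg_left e4 hw.1
    have e6 : W.wt i (W.cls i t ω) t ω * h ^ 2 ≤ h ^ 2 :=
      mul_le_of_le_one_left (sq_nonneg _) hw.2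
    have e7 : ρ * (2 * u i t * h) = ρ * (2 * u i t * W.s i t ω * (W.R i t ω - W.mean i))
        - ρ * (2 * u i t * (W.s i t ω * (W.X i t ω - W.mean i))) := by rw [hh]; ring
    linarith
  have hstep : ∀ t, q (t + 1) ≤ q t + ∑ i, (n i t - d i t) := by
    intro t
    have hkey : ∀ i, W.b i t ω = 1 → q (t + 1) ≤ q t + ∑ i, (n i t - d i t) := by
      intro i hb
      have hb2 : W.b (!i) t ω = 0 := by rw [W.b_not, hb, sub_self]
      have e1 : W.X i (t + 1) ω = W.X i t ω + W.s i t ω * (W.R i t ω - W.X i t ω) := by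
        rw [W.X_step, hb, one_mul]
      have e2 : W.X (!i) (t + 1) ω = W.X (!i) t ω := by rw [W.X_step, hb2]; ring
      rw [hqi i, hqi i, e2, e1]
      have h5 := W.env_step hcls hb hφm
        (φ (W.X i t ω + W.s i t ω * (W.R i t ω - W.X i t ω)) - φ (W.X i t ω))
      rw [add_sub_cancel] at h5
      have h6 := harm i t
      have h7 := harm (!i) t
      have h8 : W.wt (!i) (W.cls (!i) t ω) t ω = 0 := W.wt_eq_zero hb2
      rw [h8, zero_mul] at h7
      have h9 : ∑ i, (n i t - d i t) = (n i t - d i t) + (n (!i) t - d (!i) t) := by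
        rw [Fintype.sum_bool]
        cases i
        · rw [Bool.not_false, add_comm]
        · rw [Bool.not_true]
      rw [h9]
      linarith
    rcases W.b_val true t ω with hb | hb
    · exact hkey false (by have := W.b_not true t ω; rw [hb] at this; simpa using this)
    · exact hkey true hb
  have hdu : ∀ i t, 2 * ρ * (u i t ^ 2 * W.s i t ω) ≤ d i t := by
    intro i t
    have h5 : u i t ^ 2 ≤ u i t * (W.X i t ω - W.mean i) := by
      rcases le_total (W.X i t ω - m) 0 with h | h
      · have : u i t = 0 := max_eq_right h
        rw [this]; simp
      · have : u i t = W.X i t ω - m := max_eq_left h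
        rw [sq]
        exact mul_le_mul_of_nonneg_left (by linarith [hm i]) (hu0 i t)
    simp only [hd]
    have := mul_le_mul_of_nonneg_right h5 (W.s_pos i t ω).le
    nlinarith
  have hd0 : ∀ i t, 0 ≤ d i t := fun i t => by
    have := W.s_pos i t ω
    exact le_trans (by positivity) (hdu i t)
  have hN : Conv fun T => ∑ t ∈ Finset.range T, ∑ i, n i t := by
    have : (fun T => ∑ t ∈ Finset.range T, ∑ i, n i t) = fun T => ∑ i, (∑ c,
        ∑ t ∈ Finset.range T, (W.wt i c t ω - ∫ ω, W.wt i c t ω ∂P) *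
        (W.ind i c t ω * (2 * max (W.X i t ω - m) 0 * (W.s i t ω * (W.R i t ω - W.X i t ω))))
        + ρ * ∑ t ∈ Finset.range T, 2 * u i t * W.s i t ω * (W.R i t ω - W.mean i)
        + ∑ t ∈ Finset.range T, (2 * W.B) ^ 2 * W.s i t ω ^ 2) := by
      funext T
      rw [Finset.sum_comm]
      refine Finset.sum_congr rfl fun i _ => ?_
      simp only [hn]
      rw [Finset.sum_add_distrib, Finset.sum_add_distrib, Finset.sum_comm, Finset.mul_sum]
    rw [this]
    exact Conv.sum _ fun i => ((Conv.sum _ (h2 i)).add ((h1 i).mul_left ρ)).add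
      (Conv.of_summable ((h4 i).mul_left _))
  have hl : Tendsto q atTop (𝓝 0) := by
    refine tendsto_zero_of_drift (a := fun t => 2 * ρ * W.a t) hq0
      (fun t => (mul_pos (mul_pos two_pos hρ0) (W.a_pos t)).le)
      (fun h => W.a_sum ((summable_mul_left_iff (mul_pos two_pos hρ0).ne').1 h))
      (fun t => ?_) hN (d := fun t => ∑ i, d i t)
      fun t => (hstep t).trans_eq (by rw [Finset.sum_sub_distrib])
    have h5 : q t ≤ u true t ^ 2 + u false t ^ 2 := W.env_le (sq_nonneg _) (sq_nonneg _)
    have h7 := hdu true t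
    have h8 := hdu false t
    have h9 : ∀ i, W.a t ≤ W.s i t ω := fun i => W.a_anti (W.N_le i t ω)
    have h10 := mul_le_mul_of_nonneg_left (h9 true) (sq_nonneg (u true t))
    have h11 := mul_le_mul_of_nonneg_left (h9 false) (sq_nonneg (u false t))
    rw [Fintype.sum_bool]
    have h12 := mul_le_mul_of_nonneg_right h5 (W.a_pos t).le
    have h13 : q t * W.a t ≤ u true t ^ 2 * W.s true t ω + u false t ^ 2 * W.s false t ω := by
      linarith
    have h14 := mul_le_mul_of_nonneg_left h13 hρ0.le
    linarith
  intro i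
  have h5 : Tendsto (fun t => u i t ^ 2) atTop (𝓝 0) := by
    have h6 := hl.const_mul W.α⁻¹
    rw [mul_zero] at h6
    refine squeeze_zero (fun t => sq_nonneg _) (fun t => ?_) h6
    rw [inv_mul_eq_div, le_div_iff₀' hα, hqi i]
    exact W.mul_le_env (sq_nonneg _) (sq_nonneg _)
  have h7 := (Real.continuous_sqrt.tendsto _).comp h5
  simp only [Real.sqrt_zero] at h7
  exact h7.congr fun t => Real.sqrt_sq (hu0 i t)

end Arms

/-! ### Bounded measurable functions -/

/-- `f` is bounded, and measurable with respect to `m`. -/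
def BddMeas {Ω : Type*} (m : MeasurableSpace Ω) (f : Ω → ℝ) : Prop :=
  Measurable[m] f ∧ ∃ K, ∀ ω, |f ω| ≤ K

namespace BddMeas

variable {Ω : Type*} {m m' mΩ : MeasurableSpace Ω} {f g : Ω → ℝ}

theorem mono (hf : BddMeas m f) (h : m ≤ m') : BddMeas m' f := ⟨hf.1.mono h le_rfl, hf.2⟩

theorem const (c : ℝ) : BddMeas m fun _ => c := ⟨measurable_const, |c|, fun _ => le_rfl⟩

theorem add (hf : BddMeas m f) (hg : BddMeas m g) : BddMeas m fun ω => f ω + g ω := by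
  obtain ⟨hf, K, hK⟩ := hf
  obtain ⟨hg, L, hL⟩ := hg
  exact ⟨hf.add hg, K + L, fun ω => (abs_add_le _ _).trans (add_le_add (hK ω) (hL ω))⟩

theorem sub (hf : BddMeas m f) (hg : BddMeas m g) : BddMeas m fun ω => f ω - g ω := by
  obtain ⟨hf, K, hK⟩ := hf
  obtain ⟨hg, L, hL⟩ := hg
  exact ⟨hf.sub hg, K + L, fun ω => (abs_sub _ _).trans (add_le_add (hK ω) (hL ω))⟩

theorem mul (hf : BddMeas m f) (hg : BddMeas m g) : BddMeas m fun ω => f ω * g ω := by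
  obtain ⟨hf, K, hK⟩ := hf
  obtain ⟨hg, L, hL⟩ := hg
  refine ⟨hf.mul hg, K * L, fun ω => ?_⟩
  rw [abs_mul]
  exact mul_le_mul (hK ω) (hL ω) (abs_nonneg _) ((abs_nonneg _).trans (hK ω))

theorem prod (f : ℕ → Ω → ℝ) (hf : ∀ i, BddMeas m (f i)) (n : ℕ) :
    BddMeas m fun ω => ∏ i ∈ Finset.range n, f i ω := by
  induction n with
  | zero => simpa using const 1
  | succ n ih => simp_rw [Finset.prod_range_succ]; exact ih.mul (hf n)

theorem ite {p : Ω → Prop} [DecidablePred p] (hp : MeasurableSet[m] {ω | p ω}) :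
    BddMeas m fun ω => if p ω then (1 : ℝ) else 0 :=
  ⟨Measurable.ite hp measurable_const measurable_const, 1, fun ω => by
    show |if p ω then (1 : ℝ) else 0| ≤ 1
    split_ifs <;> simp⟩

theorem integrable {P : Measure Ω} [IsFiniteMeasure P] (hf : BddMeas mΩ f) : Integrable f P := by
  obtain ⟨hf, K, hK⟩ := hf
  exact integrable_of_abs_le hf hK

end BddMeas

namespace Arms

variable {Ω : Type*} [mΩ : MeasurableSpace Ω] {P : Measure Ω} (W : Arms P)

/-! ### Blocks of time -/

/-- The sum of the two step sizes. -/
def A (t : ℕ) (ω : Ω) : ℝ := W.s true t ω + W.s false t ω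

theorem A_eq (i t ω) : W.A t ω = W.s i t ω + W.s (!i) t ω := by
  cases i
  · exact add_comm _ _
  · rfl

theorem A_pos (t ω) : 0 < W.A t ω := add_pos (W.s_pos _ _ _) (W.s_pos _ _ _)

theorem s_le_A (i t ω) : W.s i t ω ≤ W.A t ω := by
  rw [W.A_eq i]; linarith [W.s_pos (!i) t ω]

theorem A_anti (ω) : Antitone fun t => W.A t ω := fun _ _ h =>
  add_le_add (W.s_anti _ ω h) (W.s_anti _ ω h)

theorem A_le (t ω) : W.A t ω ≤ 2 * W.a 0 := by
  have := W.s_le true t ω; have := W.s_le false t ω; unfold A; linarith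

theorem bddMeas_s (i t) : BddMeas (W.past t) (W.s i t) := ⟨W.s_meas i t, W.a 0, W.abs_s_le i t⟩

theorem bddMeas_A (t) : BddMeas (W.past t) (W.A t) := (W.bddMeas_s _ t).add (W.bddMeas_s _ t)

theorem bddMeas_X (i t) : BddMeas (W.past t) (W.X i t) := ⟨W.X_meas i t, W.B, W.X_le i t⟩

theorem bddMeas_R (i t) : BddMeas W.rew (W.R i t) := ⟨W.R_rew i t, W.B, W.R_le i t⟩

theorem bddMeas_β (i c t) : BddMeas (W.rnd t) (W.β i c t) := ⟨W.β_meas i c t, 1, W.abs_β_le i c t⟩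

theorem abs_X_sub_le (i t k ω) :
    |W.X i (t + k) ω - W.X i t ω| ≤ 2 * W.B * k * W.s i t ω := by
  induction k with
  | zero => simp
  | succ k ih =>
    have h1 := W.X_step_le i (t + k) ω
    have h2 := W.s_anti i ω (Nat.le_add_right t k)
    have h3 := abs_sub_le (W.X i (t + k + 1) ω) (W.X i (t + k) ω) (W.X i t ω)
    have hB := W.B_nonneg
    have h4 : 2 * W.B * W.s i (t + k) ω ≤ 2 * W.B * W.s i t ω := by
      exact mul_le_mul_of_nonneg_left h2 (by positivity)
    rw [← add_assoc]; push_cast; linarith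

/-- The difference of the estimates, seen from arm `i`. -/
def D (i : Bool) (t : ℕ) (ω : Ω) : ℝ := W.X i t ω - W.X (!i) t ω

theorem bddMeas_D (i t) : BddMeas (W.past t) (W.D i t) := (W.bddMeas_X _ t).sub (W.bddMeas_X _ t)

theorem abs_D_sub_le (i t k ω) :
    |W.D i (t + k) ω - W.D i t ω| ≤ 2 * W.B * k * W.A t ω := by
  have h1 := W.abs_X_sub_le i t k ω
  have h2 := W.abs_X_sub_le (!i) t k ω
  have e : W.D i (t + k) ω - W.D i t ω = (W.X i (t + k) ω - W.X i t ω)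
    - (W.X (!i) (t + k) ω - W.X (!i) t ω) := by unfold D; ring
  rw [e, W.A_eq i]
  refine (abs_sub _ _).trans ?_
  linarith

theorem D_step (i t ω) : W.D i (t + 1) ω = W.D i t ω
    + W.b i t ω * (W.s i t ω * (W.R i t ω - W.X i t ω))
    - W.b (!i) t ω * (W.s (!i) t ω * (W.R (!i) t ω - W.X (!i) t ω)) := by
  unfold D; rw [W.X_step, W.X_step]; ring

theorem D_add (i t n ω) : W.D i (t + n) ω - W.D i t ω =
    ∑ k ∈ Finset.range n, (W.b i (t + k) ω * (W.s i (t + k) ω * (W.R i (t + k) ω - W.X i (t + k) ω))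
      - W.b (!i) (t + k) ω *
        (W.s (!i) (t + k) ω * (W.R (!i) (t + k) ω - W.X (!i) (t + k) ω))) := by
  induction n with
  | zero => simp
  | succ n ih =>
    rw [Finset.sum_range_succ, ← ih, ← add_assoc, W.D_step]; ring

/-- The error made by freezing step sizes and estimates over a block of `n` time steps. -/
def err (n t : ℕ) (ω : Ω) : ℝ := W.A t ω - W.A (t + n) ω + W.A t ω ^ 2

theorem err_nonneg (n t ω) : 0 ≤ W.err n t ω :=
  add_nonneg (sub_nonneg.2 (W.A_anti ω (Nat.le_add_right t n))) (sq_nonneg _)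

theorem bddMeas_err (n t) : BddMeas mΩ (W.err n t) := by
  have h1 := (W.bddMeas_A t).mono (W.past.le _)
  have h2 := (W.bddMeas_A (t + n)).mono (W.past.le _)
  have h3 := (h1.sub h2).add (h1.mul h1)
  have e : W.err n t = fun ω => W.A t ω - W.A (t + n) ω + W.A t ω * W.A t ω := by
    funext ω; unfold err; ring
  rw [e]; exact h3

theorem summable_integral_err [IsProbabilityMeasure P] (n : ℕ) :
    Summable fun t => ∫ ω, W.err n t ω ∂P := by
  have hA := fun t => ((W.bddMeas_A t).mono (W.past.le _)).integrable (P := P)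
  have hA2 : ∀ t, Integrable (fun ω => W.A t ω ^ 2) P := fun t => by
    have := (((W.bddMeas_A t).mul (W.bddMeas_A t)).mono (W.past.le _)).integrable (P := P)
    refine this.congr (ae_of_all _ fun ω => ?_)
    show W.A t ω * W.A t ω = W.A t ω ^ 2
    ring
  have h1 : Summable fun t => ∫ ω, W.A t ω ∂P - ∫ ω, W.A (t + n) ω ∂P := by
    refine summable_of_sum_range_le (c := n * (2 * W.a 0)) (fun t => ?_) fun T => ?_
    · exact sub_nonneg.2 (integral_mono (hA _) (hA _) fun ω => W.A_anti ω (Nat.le_add_right t n))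
    · have hx0 : ∀ t, 0 ≤ ∫ ω, W.A t ω ∂P := fun t => integral_nonneg fun ω => (W.A_pos t ω).le
      have hx1 : ∀ t, ∫ ω, W.A t ω ∂P ≤ 2 * W.a 0 := fun t => by
        calc ∫ ω, W.A t ω ∂P ≤ ∫ _, 2 * W.a 0 ∂P :=
              integral_mono (hA _) (integrable_const _) fun ω => W.A_le t ω
          _ = _ := by simp
      have h2 := Finset.sum_range_add (fun t => ∫ ω, W.A t ω ∂P) n T
      have h3 := Finset.sum_range_add (fun t => ∫ ω, W.A t ω ∂P) T n
      rw [Nat.add_comm n T, h3] at h2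
      have h4 : ∑ t ∈ Finset.range n, ∫ ω, W.A t ω ∂P ≤ n * (2 * W.a 0) := by
        refine (Finset.sum_le_sum fun t _ => hx1 t).trans (le_of_eq ?_)
        simp
      have h5 : 0 ≤ ∑ t ∈ Finset.range n, ∫ ω, W.A (T + t) ω ∂P :=
        Finset.sum_nonneg fun t _ => hx0 _
      rw [Finset.sum_sub_distrib]
      simp_rw [Nat.add_comm _ n]
      linarith
  have h2 : Summable fun t => ∫ ω, W.A t ω ^ 2 ∂P := by
    refine Summable.of_nonneg_of_le (fun t => integral_nonneg fun ω => sq_nonneg _) (fun t => ?_)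
      (((W.summable_integral_s_sq true).add (W.summable_integral_s_sq false)).mul_left 2)
    rw [← integral_add (W.s_sq_integrable _ t) (W.s_sq_integrable _ t), ← integral_const_mul]
    refine integral_mono (hA2 t)
      (((W.s_sq_integrable _ t).add (W.s_sq_integrable _ t)).const_mul 2) fun ω => ?_
    show W.A t ω ^ 2 ≤ 2 * (W.s true t ω ^ 2 + W.s false t ω ^ 2)
    unfold A
    nlinarith [sq_nonneg (W.s true t ω - W.s false t ω)]
  refine (h1.add h2).congr fun t => ?_
  unfold err
  have hd : Integrable (fun ω => W.A t ω - W.A (t + n) ω) P := (hA t).sub (hA (t + n))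
  rw [integral_add hd (hA2 t), integral_sub (hA t) (hA (t + n))]

/-- Freezing step size and estimate at the beginning of a block. -/
theorem abs_frozen_sub_le (i : Bool) (t k n : ℕ) (hk : k ≤ n) (ω : Ω) :
    |W.s i (t + k) ω * (W.R i (t + k) ω - W.X i (t + k) ω)
      - W.s i t ω * (W.R i (t + k) ω - W.X i t ω)| ≤
      2 * W.B * (W.s i t ω - W.s i (t + n) ω) + 2 * W.B * n * W.s i t ω ^ 2 := by
  have hB := W.B_nonneg
  have hs := W.s_pos i t ω
  have h1 := W.s_anti i ω (Nat.le_add_right t k)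
  have h2 := W.s_anti i ω (Nat.add_le_add_left hk t)
  simp only at h1 h2
  have e : W.s i (t + k) ω * (W.R i (t + k) ω - W.X i (t + k) ω)
      - W.s i t ω * (W.R i (t + k) ω - W.X i t ω)
      = (W.s i (t + k) ω - W.s i t ω) * (W.R i (t + k) ω - W.X i (t + k) ω)
        - W.s i t ω * (W.X i (t + k) ω - W.X i t ω) := by ring
  rw [e]
  refine (abs_sub _ _).trans (add_le_add ?_ ?_)
  · rw [abs_mul, abs_sub_comm, abs_of_nonneg (by linarith), mul_comm]
    exact mul_le_mul (W.R_sub_X_le i _ _ ω) (by linarith) (by linarith) (by positivity)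
  · rw [abs_mul, abs_of_pos hs]
    calc W.s i t ω * |W.X i (t + k) ω - W.X i t ω|
        ≤ W.s i t ω * (2 * W.B * n * W.s i t ω) := by
          refine mul_le_mul_of_nonneg_left ((W.abs_X_sub_le i t k ω).trans ?_) hs.le
          have : (k : ℝ) ≤ n := by exact_mod_cast hk
          gcongr
      _ = _ := by ring

theorem frozen_err_le (i : Bool) (t n : ℕ) (ω : Ω) :
    2 * W.B * (W.s i t ω - W.s i (t + n) ω) + 2 * W.B * n * W.s i t ω ^ 2
    + (2 * W.B * (W.s (!i) t ω - W.s (!i) (t + n) ω) + 2 * W.B * n * W.s (!i) t ω ^ 2)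
      ≤ 2 * W.B * (1 + n) * W.err n t ω := by
  have hB := W.B_nonneg
  have h1 := W.s_pos i t ω
  have h2 := W.s_pos (!i) t ω
  have h3 : 0 ≤ W.A t ω - W.A (t + n) ω := sub_nonneg.2 (W.A_anti ω (Nat.le_add_right t n))
  have h4 := W.A_eq i t ω
  have h5 := W.A_eq i (t + n) ω
  have h6 : W.s i t ω ^ 2 + W.s (!i) t ω ^ 2 ≤ W.A t ω ^ 2 := by rw [h4]; nlinarith
  have h7 : 0 ≤ 2 * W.B * (n : ℝ) := by positivity
  have h8 := mul_le_mul_of_nonneg_left h6 h7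
  have h9 : 0 ≤ 2 * W.B * (n : ℝ) * (W.A t ω - W.A (t + n) ω) := mul_nonneg h7 h3
  have h10 : 0 ≤ 2 * W.B * W.A t ω ^ 2 := by positivity
  unfold err
  rw [h4, h5] at *
  linarith

theorem abs_frozen_sub_le_err (i : Bool) (t k n : ℕ) (hk : k ≤ n) (ω : Ω) :
    |W.s i (t + k) ω * (W.R i (t + k) ω - W.X i (t + k) ω)
      - W.s i t ω * (W.R i (t + k) ω - W.X i t ω)| ≤ 2 * W.B * (1 + n) * W.err n t ω := by
  refine (W.abs_frozen_sub_le i t k n hk ω).trans (le_trans ?_ (W.frozen_err_le i t n ω))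
  have hB := W.B_nonneg
  have h1 := W.s_anti (!i) ω (Nat.le_add_right t n)
  simp only at h1
  have : 0 ≤ 2 * W.B * (W.s (!i) t ω - W.s (!i) (t + n) ω) :=
    mul_nonneg (by positivity) (by linarith)
  have : 0 ≤ 2 * W.B * n * W.s (!i) t ω ^ 2 := by positivity
  linarith

/-- With frozen step size and estimate, the mean effect of a reward is the drift towards its mean,
up to the mixing error, if the update is decided by a fresh randomization. -/
theorem abs_integral_frozen_sub_le [IsProbabilityMeasure P] (i : Bool) (t k : ℕ) {γ Y : Ω → ℝ}
    (hγ : BddMeas (⨆ k, W.rnd (t + k)) γ) (hγ0 : ∀ ω, 0 ≤ γ ω)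
    (hY : BddMeas (W.past t) Y) (hY0 : ∀ ω, 0 ≤ Y ω) :
    |∫ ω, γ ω * (Y ω * (W.s i t ω * (W.R i (t + k) ω - W.X i t ω))) ∂P
      - (∫ ω, γ ω ∂P) * ∫ ω, Y ω * (W.s i t ω * (W.mean i - W.X i t ω)) ∂P|
      ≤ (∫ ω, γ ω ∂P) * (W.mix k * ∫ ω, Y ω * W.s i t ω ∂P) := by
  have hle1 : W.past t ≤ W.past t ⊔ W.rew := le_sup_left
  have hle2 : W.rew ≤ W.past t ⊔ W.rew := le_sup_right
  have hZ : BddMeas (W.past t ⊔ W.rew)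
      fun ω => Y ω * (W.s i t ω * (W.R i (t + k) ω - W.X i t ω)) :=
    (hY.mono hle1).mul (((W.bddMeas_s i t).mono hle1).mul
      (((W.bddMeas_R i _).mono hle2).sub ((W.bddMeas_X i t).mono hle1)))
  have hYs : BddMeas (W.past t) fun ω => Y ω * W.s i t ω := hY.mul (W.bddMeas_s i t)
  have hg0 : 0 ≤ ∫ ω, γ ω ∂P := integral_nonneg hγ0
  rw [W.integral_rnd_mul hγ.1 hZ.1, ← mul_sub, abs_mul, abs_of_nonneg hg0]
  refine mul_le_mul_of_nonneg_left ?_ hg0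
  obtain ⟨K', hK'⟩ := hYs.2
  have h1 := abs_integral_mul_sub_le_of_condExp (P := P) (W.past.le t)
    ((W.R_rew i (t + k)).mono W.rew_le le_rfl) (W.R_le i (t + k)) hYs.1 hK'
    (fun ω => mul_nonneg (hY0 ω) (W.s_pos i t ω).le) (W.mixing i t k)
  have hle3 : W.past t ⊔ W.rew ≤ mΩ := sup_le (W.past.le t) W.rew_le
  have hi1 : Integrable (fun ω => Y ω * (W.s i t ω * (W.R i (t + k) ω - W.X i t ω))) P :=
    (hZ.mono hle3).integrable
  have hi2 : Integrable (fun ω => Y ω * (W.s i t ω * (W.mean i - W.X i t ω))) P :=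
    ((hY.mul ((W.bddMeas_s i t).mul ((BddMeas.const _).sub (W.bddMeas_X i t)))).mono
      (W.past.le t)).integrable
  rw [← integral_sub hi1 hi2]
  refine le_trans (le_of_eq ?_) h1
  congr 1
  exact integral_congr_ae (ae_of_all _ fun ω => by ring)

/-- The probability that an arm is forced `n` times in a row. -/
theorem integral_prod_β_neg [IsProbabilityMeasure P] (i : Bool) (n t : ℕ) :
    ∫ ω, ∏ k ∈ Finset.range n, W.β i (-1) (t + k) ω ∂P = W.α ^ n := by
  induction n generalizing t with
  | zero => simp
  | succ n ih =>
    have e : ∀ ω, ∏ k ∈ Finset.range (n + 1), W.β i (-1) (t + k) ω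
        = (∏ k ∈ Finset.range n, W.β i (-1) (t + 1 + k) ω) * W.β i (-1) t ω := fun ω => by
      rw [Finset.prod_range_succ']
      simp only [add_zero]
      congr 1
      exact Finset.prod_congr rfl fun k _ => by rw [show t + (k + 1) = t + 1 + k by ring]
    simp_rw [e]
    rw [W.integral_rnd_mul (t := t + 1), ih, W.β_neg, pow_succ]
    · exact (BddMeas.prod _ (fun k => (W.bddMeas_β i (-1) (t + 1 + k)).mono
        (W.rnd_le_iSup (t + 1) k)) n).1
    · exact (W.β_meas i (-1) t).mono ((W.rnd_le t).trans le_sup_left) le_rfl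

end Arms

/-! ### An unstable tie is left for good -/

namespace Arms

variable {Ω : Type*} [mΩ : MeasurableSpace Ω] {P : Measure Ω} (W : Arms P)

/-- Mean increment of `X i` for an update at time `t`. -/
def pull (i : Bool) (t : ℕ) (ω : Ω) : ℝ := W.s i t ω * (W.mean i - W.X i t ω)

/-- Mean increment of the difference of the estimates at time `t`, if arm `i` is the preferred
one. -/
def drift (i : Bool) (t : ℕ) (ω : Ω) : ℝ := (1 - W.α) * W.pull i t ω - W.α * W.pull (!i) t ω

/-- The drift, in units of the step sizes, truncated at the levels `r` and `2 * r`. -/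
def push (i : Bool) (r : ℝ) (t : ℕ) (ω : Ω) : ℝ :=
  min (max (W.drift i t ω - r * W.A t ω) 0) (r * W.A t ω)

theorem bddMeas_pull (i t) : BddMeas (W.past t) (W.pull i t) :=
  (W.bddMeas_s i t).mul ((BddMeas.const _).sub (W.bddMeas_X i t))

theorem bddMeas_drift (i t) : BddMeas (W.past t) (W.drift i t) :=
  ((BddMeas.const _).mul (W.bddMeas_pull i t)).sub ((BddMeas.const _).mul (W.bddMeas_pull _ t))

theorem push_nonneg {r : ℝ} (hr : 0 < r) (i t ω) : 0 ≤ W.push i r t ω :=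
  le_min (le_max_right _ _) (mul_pos hr (W.A_pos t ω)).le

theorem push_le (i r t ω) : W.push i r t ω ≤ r * W.A t ω := min_le_right _ _

theorem lt_drift_of_push_pos {i r t ω} (h : 0 < W.push i r t ω) : r * W.A t ω < W.drift i t ω := by
  by_contra hc
  have : W.push i r t ω ≤ 0 := (min_le_left _ _).trans (max_le (by linarith) le_rfl)
  linarith

theorem bddMeas_push {r : ℝ} (hr : 0 < r) (i t) : BddMeas (W.past t) (W.push i r t) := by
  refine ⟨?_, r * (2 * W.a 0), fun ω => ?_⟩
  · have h1 := (W.bddMeas_drift i t).1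
    have h2 := (W.bddMeas_A t).1
    exact ((h1.sub (h2.const_mul r)).max measurable_const).min (h2.const_mul r)
  · rw [abs_of_nonneg (W.push_nonneg hr i t ω)]
    exact (W.push_le i r t ω).trans (mul_le_mul_of_nonneg_left (W.A_le t ω) hr.le)

theorem abs_pull_sub_le (i t n ω) : |W.pull i (t + n) ω - W.pull i t ω| ≤
    2 * W.B * (W.s i t ω - W.s i (t + n) ω) + 2 * W.B * n * W.s i t ω ^ 2 := by
  have hB := W.B_nonneg
  have hs := W.s_pos i t ω
  have h1 := W.s_anti i ω (Nat.le_add_right t n)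
  simp only at h1
  have e : W.pull i (t + n) ω - W.pull i t ω
      = (W.s i (t + n) ω - W.s i t ω) * (W.mean i - W.X i (t + n) ω)
        - W.s i t ω * (W.X i (t + n) ω - W.X i t ω) := by unfold pull; ring
  rw [e]
  refine (abs_sub _ _).trans (add_le_add ?_ ?_)
  · rw [abs_mul, abs_sub_comm, abs_of_nonneg (by linarith), mul_comm]
    exact mul_le_mul_of_nonneg_right (W.mean_sub_X_le i _ ω) (by linarith)
  · rw [abs_mul, abs_of_pos hs]
    calc W.s i t ω * |W.X i (t + n) ω - W.X i t ω|
        ≤ W.s i t ω * (2 * W.B * n * W.s i t ω) :=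
          mul_le_mul_of_nonneg_left (W.abs_X_sub_le i t n ω) hs.le
      _ = _ := by ring

theorem abs_drift_sub_le (i t n ω) :
    |W.drift i (t + n) ω - W.drift i t ω| ≤ 2 * W.B * (1 + n) * W.err n t ω := by
  have hα := W.α_pos; have hα2 := W.α_le
  have h1 := W.abs_pull_sub_le i t n ω
  have h2 := W.abs_pull_sub_le (!i) t n ω
  have h3 := W.frozen_err_le i t n ω
  have e : W.drift i (t + n) ω - W.drift i t ω = (1 - W.α) * (W.pull i (t + n) ω - W.pull i t ω)
      - W.α * (W.pull (!i) (t + n) ω - W.pull (!i) t ω) := by unfold drift; ring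
  rw [e]
  refine (abs_sub _ _).trans ?_
  rw [abs_mul, abs_mul, abs_of_pos hα, abs_of_pos (show 0 < 1 - W.α by linarith)]
  have h4 := abs_nonneg (W.pull i (t + n) ω - W.pull i t ω)
  have h5 := abs_nonneg (W.pull (!i) (t + n) ω - W.pull (!i) t ω)
  nlinarith

theorem abs_push_sub_le {r : ℝ} (hr : 0 < r) (i t n ω) :
    |W.push i r (t + n) ω - W.push i r t ω| ≤ (2 * W.B * (1 + n) + r) * W.err n t ω := by
  have h0 : 0 ≤ W.A t ω - W.A (t + n) ω := sub_nonneg.2 (W.A_anti ω (Nat.le_add_right t n))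
  have h1 : |r * W.A (t + n) ω - r * W.A t ω| ≤ r * W.err n t ω := by
    rw [← mul_sub, abs_mul, abs_of_pos hr, abs_sub_comm, abs_of_nonneg h0]
    refine mul_le_mul_of_nonneg_left ?_ hr.le
    unfold err; nlinarith [sq_nonneg (W.A t ω)]
  have hd := W.abs_drift_sub_le i t n ω
  have hd0 := (abs_nonneg _).trans hd
  have h2 : |max (W.drift i (t + n) ω - r * W.A (t + n) ω) 0
      - max (W.drift i t ω - r * W.A t ω) 0| ≤ (2 * W.B * (1 + n) + r) * W.err n t ω := by
    refine (abs_max_sub_max_le_abs _ _ _).trans ?_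
    have e : W.drift i (t + n) ω - r * W.A (t + n) ω - (W.drift i t ω - r * W.A t ω)
        = (W.drift i (t + n) ω - W.drift i t ω) - (r * W.A (t + n) ω - r * W.A t ω) := by ring
    rw [e]
    refine (abs_sub _ _).trans ?_
    linarith
  refine (abs_min_sub_min_le_max _ _ _ _).trans (max_le h2 ?_)
  linarith

/-- The mean effect of an update decided by a fresh randomization. -/
theorem abs_integral_update_sub_le [IsProbabilityMeasure P] (i : Bool) (t k n : ℕ) (hk : k ≤ n)
    {γ Y : Ω → ℝ} (hγ : BddMeas (⨆ k, W.rnd (t + k)) γ) (hγ0 : ∀ ω, 0 ≤ γ ω) (hγ1 : ∀ ω, γ ω ≤ 1)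
    (hY : BddMeas (W.past t) Y) (hY0 : ∀ ω, 0 ≤ Y ω) {r : ℝ} (hYr : ∀ ω, Y ω ≤ r) :
    |∫ ω, γ ω * (Y ω * (W.s i (t + k) ω * (W.R i (t + k) ω - W.X i (t + k) ω))) ∂P
      - (∫ ω, γ ω ∂P) * ∫ ω, Y ω * W.pull i t ω ∂P|
      ≤ (∫ ω, γ ω ∂P) * (W.mix k * ∫ ω, Y ω * W.A t ω ∂P)
        + r * (2 * W.B * (1 + n)) * ∫ ω, W.err n t ω ∂P := by
  have hle : ⨆ k, W.rnd (t + k) ≤ mΩ := iSup_le fun k => W.rnd_le' _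
  have hγ' := hγ.mono hle
  have hY' := hY.mono (W.past.le t)
  have hU : ∀ u, BddMeas mΩ fun ω => W.s i u ω * (W.R i (t + k) ω - W.X i u ω) := fun u =>
    ((W.bddMeas_s i u).mono (W.past.le _)).mul
      (((W.bddMeas_R i _).mono W.rew_le).sub ((W.bddMeas_X i u).mono (W.past.le _)))
  have hI : ∀ u, Integrable
      (fun ω => γ ω * (Y ω * (W.s i u ω * (W.R i (t + k) ω - W.X i u ω)))) P := fun u =>
    (hγ'.mul (hY'.mul (hU u))).integrable
  have h1 := W.abs_integral_frozen_sub_le i t k hγ hγ0 hY hY0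
  have h2 : |∫ ω, γ ω * (Y ω * (W.s i (t + k) ω * (W.R i (t + k) ω - W.X i (t + k) ω))) ∂P
      - ∫ ω, γ ω * (Y ω * (W.s i t ω * (W.R i (t + k) ω - W.X i t ω))) ∂P|
      ≤ r * (2 * W.B * (1 + n)) * ∫ ω, W.err n t ω ∂P := by
    rw [← integral_sub (hI _) (hI _), ← integral_const_mul]
    refine abs_integral_le_integral_abs.trans (integral_mono_ae ?_ ?_ (ae_of_all _ fun ω => ?_))
    · exact ((hI _).sub (hI _)).abs
    · exact ((W.bddMeas_err n t).integrable).const_mul _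
    · have h3 := W.abs_frozen_sub_le_err i t k n hk ω
      have h4 : 0 ≤ γ ω * Y ω := mul_nonneg (hγ0 ω) (hY0 ω)
      have h5 : γ ω * Y ω ≤ r := by
        have := mul_le_mul (hγ1 ω) (hYr ω) (hY0 ω) zero_le_one
        linarith
      beta_reduce
      rw [← mul_sub, ← mul_sub, ← mul_assoc, abs_mul, abs_of_nonneg h4, mul_assoc r]
      exact mul_le_mul h5 h3 (abs_nonneg _) (h4.trans h5)
  have h3 : ∫ ω, Y ω * W.s i t ω ∂P ≤ ∫ ω, Y ω * W.A t ω ∂P :=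
    integral_mono (hY'.mul ((W.bddMeas_s i t).mono (W.past.le _))).integrable
      (hY'.mul ((W.bddMeas_A t).mono (W.past.le _))).integrable
      fun ω => mul_le_mul_of_nonneg_left (W.s_le_A i t ω) (hY0 ω)
  have h4 := mul_le_mul_of_nonneg_left (mul_le_mul_of_nonneg_left h3 (W.mix_nonneg k))
    (integral_nonneg hγ0 : 0 ≤ ∫ ω, γ ω ∂P)
  have h5 := abs_sub_le
    (∫ ω, γ ω * (Y ω * (W.s i (t + k) ω * (W.R i (t + k) ω - W.X i (t + k) ω))) ∂P)
    (∫ ω, γ ω * (Y ω * (W.s i t ω * (W.R i (t + k) ω - W.X i t ω))) ∂P)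
    ((∫ ω, γ ω ∂P) * ∫ ω, Y ω * W.pull i t ω ∂P)
  unfold pull at h5 ⊢
  linarith

theorem sum_mix_le (n : ℕ) : ∑ k ∈ Finset.range n, W.mix k ≤ W.κ :=
  W.mix_summable.sum_le_tsum _ fun k _ => W.mix_nonneg k

end Arms

/-- The profile of the potential: `1` up to `K`, then exponentially decreasing. -/
def profile (l K u : ℝ) : ℝ := Real.exp (-(l * max (u - K) 0))

section profile

variable {l K : ℝ}

theorem profile_pos (u : ℝ) : 0 < profile l K u := Real.exp_pos _

theorem profile_le_one (hl : 0 ≤ l) (u : ℝ) : profile l K u ≤ 1 :=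
  Real.exp_le_one_iff.2 (neg_nonpos.2 (mul_nonneg hl (le_max_right _ _)))

theorem profile_eq_one {u : ℝ} (h : u ≤ K) : profile l K u = 1 := by
  unfold profile; rw [max_eq_right (by linarith)]; simp

theorem profile_anti (hl : 0 ≤ l) : Antitone (profile l K) := fun x y h =>
  Real.exp_le_exp.2 (neg_le_neg (mul_le_mul_of_nonneg_left (max_le_max (by linarith) le_rfl) hl))

theorem profile_sub_le (hl : 0 ≤ l) {u v : ℝ} (hu : K < u) (h : |l * (v - u)| ≤ 1) :
    profile l K v - profile l K u ≤ profile l K u * (-(l * (v - u)) + (l * (v - u)) ^ 2) := by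
  have h1 : profile l K v ≤ profile l K u * Real.exp (-(l * (v - u))) := by
    unfold profile
    rw [← Real.exp_add, Real.exp_le_exp, max_eq_left (by linarith : 0 ≤ u - K)]
    have := mul_le_mul_of_nonneg_left (le_max_left (v - K) 0) hl
    linarith
  have h2 := le_of_abs_le (Real.abs_exp_sub_one_sub_id_le (x := -(l * (v - u))) (by rwa [abs_neg]))
  have h3 := mul_le_mul_of_nonneg_left h2 (profile_pos (l := l) (K := K) u).le
  rw [neg_sq] at h3
  linarith

theorem le_one_sub_profile (hl : 0 ≤ l) {u L : ℝ} (hu : u - K ≤ L) (hL : 0 ≤ L) :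
    l / (1 + l * L) * (u - K) ≤ 1 - profile l K u := by
  rcases le_total (u - K) 0 with h | h
  · rw [profile_eq_one (by linarith), sub_self]
    exact mul_nonpos_of_nonneg_of_nonpos (by positivity) h
  · unfold profile
    rw [max_eq_left h]
    have h1 : 0 ≤ l * (u - K) := mul_nonneg hl h
    have h2 := Real.add_one_le_exp (l * (u - K))
    have h3 : Real.exp (-(l * (u - K))) ≤ (1 + l * (u - K))⁻¹ := by
      rw [Real.exp_neg]
      exact inv_anti₀ (by linarith) (by linarith)
    have h4 : l / (1 + l * L) * (u - K) ≤ l * (u - K) / (1 + l * (u - K)) := by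
      rw [div_mul_eq_mul_div]
      have := mul_le_mul_of_nonneg_left hu hl
      gcongr
    have h5 : l * (u - K) / (1 + l * (u - K)) = 1 - (1 + l * (u - K))⁻¹ := by
      field_simp; ring
    linarith

theorem continuous_profile : Continuous (profile l K) := by unfold profile; fun_prop

theorem BddMeas.profile_div {Ω : Type*} {m : MeasurableSpace Ω} {l : ℝ} (hl : 0 ≤ l) (K : ℝ)
    {x y : Ω → ℝ} (hx : Measurable[m] x) (hy : Measurable[m] y) :
    BddMeas m fun ω => profile l K (x ω / y ω) :=
  ⟨continuous_profile.measurable.comp (hx.div hy), 1, fun ω => by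
    rw [abs_of_pos (profile_pos _)]; exact profile_le_one hl _⟩

end profile

namespace Arms

variable {Ω : Type*} [mΩ : MeasurableSpace Ω] {P : Measure Ω} (W : Arms P)

/-- The potential that controls the number of ties at which the drift is large. -/
def pot (i : Bool) (r l K : ℝ) (t : ℕ) (ω : Ω) : ℝ :=
  W.push i r t ω * profile l K (W.D i t ω / W.A t ω)

theorem bddMeas_pot {r l : ℝ} (hr : 0 < r) (hl : 0 ≤ l) (i K t) :
    BddMeas (W.past t) (W.pot i r l K t) :=
  (W.bddMeas_push hr i t).mul (BddMeas.profile_div hl K (W.bddMeas_D i t).1 (W.bddMeas_A t).1)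

theorem pot_nonneg {r : ℝ} (hr : 0 < r) (i l K t ω) : 0 ≤ W.pot i r l K t ω :=
  mul_nonneg (W.push_nonneg hr i t ω) (profile_pos _).le

/-- Over a block, the potential essentially changes through the difference of the estimates. -/
theorem pot_add_le {r l K : ℝ} (hr : 0 < r) (hl : 0 ≤ l) (hK : 0 ≤ K) (i t n ω) :
    W.pot i r l K (t + n) ω ≤ W.push i r t ω * profile l K (W.D i (t + n) ω / W.A t ω)
      + (2 * W.B * (1 + n) + r) * W.err n t ω := by
  have h1 := le_of_abs_le (W.abs_push_sub_le hr i t n ω)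
  have h2 : profile l K (W.D i (t + n) ω / W.A (t + n) ω)
      ≤ profile l K (W.D i (t + n) ω / W.A t ω) := by
    rcases le_total (W.D i (t + n) ω) 0 with h | h
    · rw [profile_eq_one (u := W.D i (t + n) ω / W.A t ω)]
      · exact profile_le_one hl _
      · exact (div_nonpos_of_nonpos_of_nonneg h (W.A_pos _ _).le).trans hK
    · refine profile_anti hl ?_
      exact div_le_div_of_nonneg_left h (W.A_pos _ _) (W.A_anti ω (Nat.le_add_right t n))
  have h3 := profile_le_one (K := K) hl (W.D i (t + n) ω / W.A t ω)
  have h4 := profile_pos (l := l) (K := K) (W.D i (t + n) ω / W.A t ω)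
  have h5 := W.push_nonneg hr i t ω
  have h6 := W.push_nonneg hr i (t + n) ω
  have h7 : 0 ≤ (2 * W.B * (1 + n) + r) * W.err n t ω :=
    (abs_nonneg _).trans (W.abs_push_sub_le hr i t n ω)
  unfold pot
  calc _ ≤ W.push i r (t + n) ω * profile l K (W.D i (t + n) ω / W.A t ω) :=
        mul_le_mul_of_nonneg_left h2 h6
    _ ≤ (W.push i r t ω + (2 * W.B * (1 + n) + r) * W.err n t ω)
          * profile l K (W.D i (t + n) ω / W.A t ω) :=
        mul_le_mul_of_nonneg_right (by linarith) h4.le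
    _ ≤ _ := by nlinarith

end Arms

namespace Arms

variable {Ω : Type*} [mΩ : MeasurableSpace Ω] {P : Measure Ω} (W : Arms P)

theorem bddMeas_push_div {r : ℝ} (hr : 0 < r) (i t) :
    BddMeas (W.past t) fun ω => W.push i r t ω / W.A t ω := by
  refine ⟨(W.bddMeas_push hr i t).1.div (W.bddMeas_A t).1, r, fun ω => ?_⟩
  rw [abs_of_nonneg (div_nonneg (W.push_nonneg hr i t ω) (W.A_pos t ω).le),
    div_le_iff₀ (W.A_pos t ω)]
  exact W.push_le i r t ω

theorem push_div_le {i r t ω} : W.push i r t ω / W.A t ω ≤ r := by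
  rw [div_le_iff₀ (W.A_pos t ω)]
  exact W.push_le i r t ω

/-- A preferred arm with a sufficiently large lead stays preferred over a whole block. -/
theorem D_pos_of_lt {i : Bool} {t k n : ℕ} {ω : Ω} (hk : k ≤ n)
    (h : 2 * W.B * n * W.A t ω < W.D i t ω) : 0 < W.D i (t + k) ω := by
  have h1 := neg_le_of_abs_le (W.abs_D_sub_le i t k ω)
  have h2 : 2 * W.B * k * W.A t ω ≤ 2 * W.B * n * W.A t ω := by
    have hB := W.B_nonneg
    have hA := W.A_pos t ω
    have : (k : ℝ) ≤ n := by exact_mod_cast hk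
    gcongr
  linarith

theorem b_of_D_pos (hcls : ∀ i t ω, W.cls i t ω = SignType.sign (W.X i t ω - W.X (!i) t ω))
    {i : Bool} {t : ℕ} {ω : Ω} (h : 0 < W.D i t ω) :
    W.b i t ω = W.β i 1 t ω ∧ W.b (!i) t ω = W.β (!i) (-1) t ω := by
  have h1 : W.cls i t ω = 1 := by rw [hcls]; exact sign_pos h
  constructor
  · unfold b; rw [h1]
  · unfold b; rw [W.cls_not, h1]

set_option maxHeartbeats 800000 in
/-- Over a long block, the potential does not increase in mean. -/
theorem exists_block_bound [IsProbabilityMeasure P]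
    (hcls : ∀ i t ω, W.cls i t ω = SignType.sign (W.X i t ω - W.X (!i) t ω))
    (i : Bool) {r : ℝ} (hr : 0 < r) (J : ℕ) (hJ : W.κ + 1 ≤ J * r) {K l : ℝ} (hK : K = 2 * W.B * J)
    (hl : 0 < l) (hl1 : l * K ≤ 1) (hl2 : l * K ^ 2 ≤ 1) :
    ∃ C, ∀ t (q : Ω → ℝ), BddMeas (W.past t) q → (∀ ω, 0 ≤ q ω) → (∀ ω, q ω ≤ 1) →
      ∫ ω, q ω * (W.pot i r l K (t + J) ω - W.pot i r l K t ω) ∂P ≤ C * ∫ ω, W.err J t ω ∂P := by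
  classical
  set c1 : ℝ := 2 * W.B * (1 + J) + r with hc1
  set c2 : ℝ := r * (2 * W.B * (1 + J)) with hc2
  refine ⟨l * (J * (2 * c2)) + c1, fun t q hq hq0 hq1 => ?_⟩
  have hB := W.B_nonneg
  have hα := W.α_pos; have hα2 := W.α_le
  have hK0 : 0 ≤ K := by rw [hK]; positivity
  set g : Ω → ℝ := fun ω => profile l K (W.D i t ω / W.A t ω) with hg
  set I : Ω → ℝ := fun ω => if K * W.A t ω < W.D i t ω then (1 : ℝ) else 0 with hI
  set θ : Ω → ℝ := fun ω => W.push i r t ω / W.A t ω with hθ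
  set Y : Ω → ℝ := fun ω => q ω * (I ω * (θ ω * g ω)) with hY
  have hA := fun ω => W.A_pos t ω
  have hg0 : ∀ ω, 0 < g ω := fun ω => profile_pos _
  have hg1 : ∀ ω, g ω ≤ 1 := fun ω => profile_le_one hl.le _
  have hθ0 : ∀ ω, 0 ≤ θ ω := fun ω => div_nonneg (W.push_nonneg hr i t ω) (hA ω).le
  have hθr : ∀ ω, θ ω ≤ r := fun ω => W.push_div_le
  have hI0 : ∀ ω, 0 ≤ I ω := fun ω => by simp only [hI]; split_ifs <;> norm_num
  have hI1 : ∀ ω, I ω ≤ 1 := fun ω => by simp only [hI]; split_ifs <;> norm_num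
  have hYm : BddMeas (W.past t) Y :=
    hq.mul ((BddMeas.ite (measurableSet_lt ((W.bddMeas_A t).1.const_mul K)
      (W.bddMeas_D i t).1)).mul ((W.bddMeas_push_div hr i t).mul
        (BddMeas.profile_div hl.le K (W.bddMeas_D i t).1 (W.bddMeas_A t).1)))
  have hY0 : ∀ ω, 0 ≤ Y ω := fun ω =>
    mul_nonneg (hq0 ω) (mul_nonneg (hI0 ω) (mul_nonneg (hθ0 ω) (hg0 ω).le))
  have hYr : ∀ ω, Y ω ≤ r := fun ω => by
    calc Y ω ≤ 1 * (1 * (r * 1)) := by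
          have h1 := hg1 ω; have h2 := hθr ω; have h3 := hI1 ω; have h4 := hq1 ω
          have h5 := hg0 ω; have h6 := hθ0 ω; have h7 := hI0 ω; have h8 := hq0 ω
          simp only [hY]
          gcongr
      _ = r := by ring
  set Δ : Bool → ℕ → Ω → ℝ := fun l k ω =>
    W.s l (t + k) ω * (W.R l (t + k) ω - W.X l (t + k) ω) with hΔ
  have hYne : ∀ ω, Y ω ≠ 0 → K * W.A t ω < W.D i t ω ∧ 0 < W.push i r t ω := by
    intro ω h
    constructor
    · by_contra hc
      apply h
      simp only [hY, hI, if_neg hc, zero_mul, mul_zero]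
    · refine lt_of_le_of_ne (W.push_nonneg hr i t ω) fun hc => h ?_
      simp only [hY, hθ, ← hc, zero_div, zero_mul, mul_zero]
  -- where `Y` does not vanish, the lead of arm `i` lasts for the whole block, so that the fresh
  -- randomizations alone decide the choices
  have hS : ∀ ω, Y ω * (W.D i (t + J) ω - W.D i t ω) = ∑ k ∈ Finset.range J,
      (W.β i 1 (t + k) ω * (Y ω * Δ i k ω) - W.β (!i) (-1) (t + k) ω * (Y ω * Δ (!i) k ω)) := by
    intro ω
    by_cases h : Y ω = 0
    · simp [h]
    · have h1 := (hYne ω h).1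
      rw [W.D_add, Finset.mul_sum]
      refine Finset.sum_congr rfl fun k hk => ?_
      rw [hK] at h1
      obtain ⟨h2, h3⟩ := W.b_of_D_pos hcls (W.D_pos_of_lt (Finset.mem_range.1 hk).le h1)
      rw [h2, h3]
      ring
  -- a growing lead lowers the potential, apart from second order terms
  have hpt : ∀ ω, q ω * (W.pot i r l K (t + J) ω - W.pot i r l K t ω) ≤
      l ^ 2 * K ^ 2 * (Y ω * W.A t ω) + c1 * W.err J t ω
      - l * (Y ω * (W.D i (t + J) ω - W.D i t ω)) := by
    intro ω
    have h1 := W.pot_add_le hr hl.le hK0 i t J ω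
    have h2 : 0 ≤ c1 * W.err J t ω := (abs_nonneg _).trans (W.abs_push_sub_le hr i t J ω)
    have h3 : q ω * (W.pot i r l K (t + J) ω - W.pot i r l K t ω) ≤ q ω * (W.push i r t ω *
        (profile l K (W.D i (t + J) ω / W.A t ω) - g ω)) + c1 * W.err J t ω := by
      have h4 : W.pot i r l K (t + J) ω - W.pot i r l K t ω ≤ W.push i r t ω *
        (profile l K (W.D i (t + J) ω / W.A t ω) - g ω) + c1 * W.err J t ω := by
        unfold pot at h1 ⊢
        linarith
      have h5 := mul_le_mul_of_nonneg_left h4 (hq0 ω)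
      have h6 := mul_le_mul_of_nonneg_right (hq1 ω) h2
      linarith
    by_cases hc : K * W.A t ω < W.D i t ω
    · have hu : K < W.D i t ω / W.A t ω := by rwa [lt_div_iff₀ (hA ω)]
      have hd : |W.D i (t + J) ω - W.D i t ω| ≤ K * W.A t ω := by
        rw [hK]; exact W.abs_D_sub_le i t J ω
      have e : W.D i (t + J) ω / W.A t ω - W.D i t ω / W.A t ω
        = (W.D i (t + J) ω - W.D i t ω) / W.A t ω := by ring
      set d := (W.D i (t + J) ω - W.D i t ω) / W.A t ω with hdd
      have hd1 : |d| ≤ K := by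
        rw [hdd, abs_div, abs_of_pos (hA ω), div_le_iff₀ (hA ω)]; exact hd
      have h4 := profile_sub_le (K := K) hl.le hu (v := W.D i (t + J) ω / W.A t ω) (by
        rw [e, abs_mul, abs_of_pos hl]
        exact (mul_le_mul_of_nonneg_left hd1 hl.le).trans hl1)
      rw [e] at h4
      have h5 : (l * d) ^ 2 ≤ l ^ 2 * K ^ 2 := by
        rw [mul_pow]
        have : d ^ 2 ≤ K ^ 2 := sq_le_sq' (neg_le_of_abs_le hd1) (le_of_abs_le hd1)
        gcongr
      have h6 : profile l K (W.D i (t + J) ω / W.A t ω) - g ω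
          ≤ g ω * (-(l * d) + l ^ 2 * K ^ 2) :=
        h4.trans (mul_le_mul_of_nonneg_left (by linarith) (hg0 ω).le)
      have h7 : 0 ≤ q ω * W.push i r t ω := mul_nonneg (hq0 ω) (W.push_nonneg hr i t ω)
      have h8 := mul_le_mul_of_nonneg_left h6 h7
      have h9 : Y ω * W.A t ω = q ω * W.push i r t ω * g ω := by
        have := (hA ω).ne'
        simp only [hY, hI, hθ, if_pos hc]
        field_simp
      have h10 : W.D i (t + J) ω - W.D i t ω = d * W.A t ω := by
        rw [hdd, div_mul_cancel₀ _ (hA ω).ne']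
      rw [h10, show Y ω * (d * W.A t ω) = d * (Y ω * W.A t ω) by ring, h9]
      have e2 : q ω * W.push i r t ω * (g ω * (-(l * d) + l ^ 2 * K ^ 2)) =
        l ^ 2 * K ^ 2 * (q ω * W.push i r t ω * g ω) - l * (d * (q ω * W.push i r t ω * g ω)) := by
        ring
      rw [e2] at h8
      rw [mul_assoc] at h8
      linarith
    · have hu : W.D i t ω / W.A t ω ≤ K := by rw [div_le_iff₀ (hA ω)]; exact not_lt.1 hc
      have h4 : g ω = 1 := profile_eq_one hu
      have h5 : Y ω = 0 := by
        simp only [hY, hI, if_neg hc, zero_mul, mul_zero]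
      rw [h5]
      have h6 := profile_le_one (K := K) hl.le (W.D i (t + J) ω / W.A t ω)
      have h7 : q ω * (W.push i r t ω * (profile l K (W.D i (t + J) ω / W.A t ω) - g ω)) ≤ 0 :=
        mul_nonpos_of_nonneg_of_nonpos (hq0 ω)
          (mul_nonpos_of_nonneg_of_nonpos (W.push_nonneg hr i t ω) (by rw [h4]; linarith))
      simp only [zero_mul, mul_zero]
      linarith
  -- the mean of the linear term
  have hY' := hYm.mono (W.past.le t)
  have hA' : BddMeas mΩ (W.A t) := (W.bddMeas_A t).mono (W.past.le t)
  have hΔm : ∀ l k, BddMeas mΩ (Δ l k) := fun l k => ((W.bddMeas_s l _).mono (W.past.le _)).mul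
      (((W.bddMeas_R l _).mono W.rew_le).sub ((W.bddMeas_X l _).mono (W.past.le _)))
  have hi1 : ∀ l c k, Integrable (fun ω => W.β l c (t + k) ω * (Y ω * Δ l k ω)) P :=
    fun l c k => (((W.bddMeas_β l c _).mono (W.rnd_le' _)).mul (hY'.mul (hΔm l k))).integrable
  set a : ℝ := ∫ ω, Y ω * W.A t ω ∂P with ha
  set E : ℝ := ∫ ω, W.err J t ω ∂P with hE
  have ha0 : 0 ≤ a := integral_nonneg fun ω => mul_nonneg (hY0 ω) (hA ω).le
  have hE0 : 0 ≤ E := integral_nonneg fun ω => W.err_nonneg J t ω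
  have hip : ∀ l, Integrable (fun ω => Y ω * W.pull l t ω) P := fun l =>
    (hY'.mul ((W.bddMeas_pull l t).mono (W.past.le t))).integrable
  -- the mean growth of the lead: the drift is at least `r` times the step size
  have hdr : r * a ≤ (1 - W.α) * ∫ ω, Y ω * W.pull i t ω ∂P
      - W.α * ∫ ω, Y ω * W.pull (!i) t ω ∂P := by
    rw [ha, ← integral_const_mul, ← integral_const_mul, ← integral_const_mul,
      ← integral_sub ((hip i).const_mul _) ((hip (!i)).const_mul _)]
    refine integral_mono ((hY'.mul hA').integrable.const_mul r)
      (((hip i).const_mul _).sub ((hip (!i)).const_mul _)) fun ω => ?_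
    show r * (Y ω * W.A t ω) ≤ (1 - W.α) * (Y ω * W.pull i t ω) - W.α * (Y ω * W.pull (!i) t ω)
    have e : (1 - W.α) * (Y ω * W.pull i t ω) - W.α * (Y ω * W.pull (!i) t ω)
      = Y ω * W.drift i t ω := by unfold drift; ring
    rw [e]
    by_cases h : Y ω = 0
    · simp [h]
    · have := mul_le_mul_of_nonneg_left (W.lt_drift_of_push_pos (hYne ω h).2).le (hY0 ω)
      linarith
  have hterm : ∀ k ∈ Finset.range J, r * a - W.mix k * a - 2 * c2 * E ≤
      ∫ ω, (W.β i 1 (t + k) ω * (Y ω * Δ i k ω)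
        - W.β (!i) (-1) (t + k) ω * (Y ω * Δ (!i) k ω)) ∂P := by
    intro k hk
    have hk' := (Finset.mem_range.1 hk).le
    have h1 := neg_le_of_abs_le (W.abs_integral_update_sub_le i t k J hk'
      ((W.bddMeas_β i 1 (t + k)).mono (W.rnd_le_iSup t k)) (W.β_nonneg _ _ _) (W.β_le_one _ _ _)
      hYm hY0 hYr)
    have h2 := le_of_abs_le (W.abs_integral_update_sub_le (!i) t k J hk'
      ((W.bddMeas_β (!i) (-1) (t + k)).mono (W.rnd_le_iSup t k)) (W.β_nonneg _ _ _)
      (W.β_le_one _ _ _) hYm hY0 hYr)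
    have h3 : ∫ ω, W.β i 1 (t + k) ω ∂P = 1 - W.α := W.p_pos i (t + k)
    rw [h3] at h1
    rw [W.β_neg] at h2
    rw [integral_sub (hi1 i 1 k) (hi1 (!i) (-1) k)]
    simp only [hΔ]
    linarith
  have hmain : a - J * (2 * c2) * E ≤ ∫ ω, Y ω * (W.D i (t + J) ω - W.D i t ω) ∂P := by
    simp_rw [hS]
    have hint : ∀ k, Integrable (fun ω => W.β i 1 (t + k) ω * (Y ω * Δ i k ω)
        - W.β (!i) (-1) (t + k) ω * (Y ω * Δ (!i) k ω)) P := fun k =>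
      (hi1 i 1 k).sub (hi1 (!i) (-1) k)
    rw [integral_finsetSum _ fun k _ => hint k]
    refine le_trans ?_ (Finset.sum_le_sum hterm)
    rw [Finset.sum_sub_distrib, Finset.sum_sub_distrib, Finset.sum_const,
      Finset.sum_const, ← Finset.sum_mul, Finset.card_range, nsmul_eq_mul, nsmul_eq_mul]
    have h1 := mul_le_mul_of_nonneg_right (W.sum_mix_le J) ha0
    have h2 := mul_le_mul_of_nonneg_right hJ ha0
    linarith
  have hDm : BddMeas mΩ fun ω => Y ω * (W.D i (t + J) ω - W.D i t ω) :=
    hY'.mul (((W.bddMeas_D i _).mono (W.past.le _)).sub ((W.bddMeas_D i _).mono (W.past.le _)))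
  have hf1 : Integrable (fun ω => l ^ 2 * K ^ 2 * (Y ω * W.A t ω)) P :=
    (hY'.mul hA').integrable.const_mul _
  have hf2 : Integrable (fun ω => c1 * W.err J t ω) P := (W.bddMeas_err J t).integrable.const_mul _
  have hf3 : Integrable (fun ω => l * (Y ω * (W.D i (t + J) ω - W.D i t ω))) P :=
    hDm.integrable.const_mul _
  have hf4 : Integrable (fun ω => l ^ 2 * K ^ 2 * (Y ω * W.A t ω) + c1 * W.err J t ω) P :=
    hf1.add hf2
  have hpm : ∀ t, BddMeas mΩ (W.pot i r l K t) := fun t =>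
    (W.bddMeas_pot hr hl.le i K t).mono (W.past.le t)
  have hfin := integral_mono (((hq.mono (W.past.le t)).mul ((hpm (t + J)).sub (hpm t))).integrable
    (P := P)) (hf4.sub hf3) hpt
  beta_reduce at hfin
  have hsplit : ∫ ω, (l ^ 2 * K ^ 2 * (Y ω * W.A t ω) + c1 * W.err J t ω
      - l * (Y ω * (W.D i (t + J) ω - W.D i t ω))) ∂P = l ^ 2 * K ^ 2 * a + c1 * E
      - l * ∫ ω, Y ω * (W.D i (t + J) ω - W.D i t ω) ∂P := by
    rw [integral_sub hf4 hf3, integral_add hf1 hf2, integral_const_mul, integral_const_mul,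
      integral_const_mul]
  have h1 := mul_le_mul_of_nonneg_left hmain hl.le
  have h2 : l ^ 2 * K ^ 2 * a ≤ l * a := by
    have := mul_le_mul_of_nonneg_left hl2 (mul_nonneg hl.le ha0)
    nlinarith
  calc _ ≤ _ := hfin
    _ = _ := hsplit
    _ ≤ _ := by nlinarith

end Arms

namespace Arms

variable {Ω : Type*} [mΩ : MeasurableSpace Ω] {P : Measure Ω} (W : Arms P)

/-- The indicator of the event that arm `l` is forced at `n` consecutive times. -/
def forced (l : Bool) (n t : ℕ) (ω : Ω) : ℝ := ∏ k ∈ Finset.range n, W.β l (-1) (t + k) ω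

theorem bddMeas_forced (l n t) : BddMeas (⨆ k, W.rnd (t + k)) (W.forced l n t) :=
  BddMeas.prod _ (fun k => (W.bddMeas_β l (-1) (t + k)).mono (W.rnd_le_iSup t k)) n

theorem forced_nonneg (l n t ω) : 0 ≤ W.forced l n t ω :=
  Finset.prod_nonneg fun _ _ => W.β_nonneg _ _ _ _

theorem forced_le_one (l n t ω) : W.forced l n t ω ≤ 1 :=
  Finset.prod_le_one (fun _ _ => W.β_nonneg _ _ _ _) fun _ _ => W.β_le_one _ _ _ _

theorem b_of_forced {l n t ω} (h : W.forced l n t ω ≠ 0) {k : ℕ} (hk : k < n) :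
    W.b l (t + k) ω = 1 ∧ W.b (!l) (t + k) ω = 0 := by
  have h1 : W.β l (-1) (t + k) ω ≠ 0 := Finset.prod_ne_zero_iff.1 h k (Finset.mem_range.2 hk)
  have h2 := (W.β_val l (-1) (t + k) ω).resolve_left h1
  have h3 := W.β_neg_le_b l (t + k) ω
  have h4 := W.b_le_one l (t + k) ω
  have h5 : W.b l (t + k) ω = 1 := by linarith
  exact ⟨h5, by rw [W.b_not, h5, sub_self]⟩

set_option maxHeartbeats 800000 in
/-- At a tie with large drift, the forced choice of a suitable arm makes the potential decrease. -/
theorem exists_escape_bound [IsProbabilityMeasure P] (i l : Bool) (σ : ℝ)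
    (hσ : (l = i ∧ σ = 1) ∨ (l = !i ∧ σ = -1)) {r : ℝ} (hr : 0 < r) {K lam : ℝ}
    (hK : 2 * W.B ≤ K) (hlam : 0 < lam) (H : ℕ) (hH : W.κ + 2 * W.B + K + 1 ≤ H * r) :
    ∃ C c, 0 < c ∧ ∀ t (q : Ω → ℝ), BddMeas (W.past t) q → (∀ ω, 0 ≤ q ω) → (∀ ω, q ω ≤ 1) →
      (∀ ω, q ω ≠ 0 → |W.D i t ω| ≤ 2 * W.B * W.A t ω ∧ r * W.A t ω ≤ σ * W.pull l t ω) →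
      ∫ ω, q ω * (W.pot i r lam K (t + H) ω - W.pot i r lam K t ω) ∂P ≤
        C * ∫ ω, W.err H t ω ∂P - c * ∫ ω, q ω * W.push i r t ω ∂P := by
  have hB := W.B_nonneg
  have hα := W.α_pos
  set c1 : ℝ := 2 * W.B * (1 + H) + r with hc1
  set c2 : ℝ := r * (2 * W.B * (1 + H)) with hc2
  set L : ℝ := 2 * W.B * (H + 1) with hL
  have hL0 : 0 ≤ L := by positivity
  have hK0 : 0 ≤ K := by linarith
  set k3 : ℝ := lam / (1 + lam * L) with hk3
  have hk30 : 0 < k3 := by positivity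
  refine ⟨c1 + k3 * (H * c2), k3 * W.α ^ H, by positivity, fun t q hq hq0 hq1 hsupp => ?_⟩
  set θ : Ω → ℝ := fun ω => W.push i r t ω / W.A t ω with hθ
  set Y : Ω → ℝ := fun ω => q ω * θ ω with hY
  set F : Ω → ℝ := W.forced l H t with hF
  have hA := fun ω => W.A_pos t ω
  have hθ0 : ∀ ω, 0 ≤ θ ω := fun ω => div_nonneg (W.push_nonneg hr i t ω) (hA ω).le
  have hθr : ∀ ω, θ ω ≤ r := fun ω => W.push_div_le
  have hYm : BddMeas (W.past t) Y := hq.mul (W.bddMeas_push_div hr i t)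
  have hY0 : ∀ ω, 0 ≤ Y ω := fun ω => mul_nonneg (hq0 ω) (hθ0 ω)
  have hYr : ∀ ω, Y ω ≤ r := fun ω => by
    have := mul_le_mul (hq1 ω) (hθr ω) (hθ0 ω) zero_le_one
    simp only [hY]; linarith
  have hYA : ∀ ω, Y ω * W.A t ω = q ω * W.push i r t ω := fun ω => by
    simp only [hY, hθ]; rw [mul_assoc, div_mul_cancel₀ _ (hA ω).ne']
  have hF0 : ∀ ω, 0 ≤ F ω := W.forced_nonneg l H t
  have hF1 : ∀ ω, F ω ≤ 1 := W.forced_le_one l H t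
  have hFm : BddMeas (⨆ k, W.rnd (t + k)) F := W.bddMeas_forced l H t
  set Δ : ℕ → Ω → ℝ := fun k ω =>
    W.s l (t + k) ω * (W.R l (t + k) ω - W.X l (t + k) ω) with hΔ
  -- on the event that arm `l` is forced, only this arm is updated
  have hS : ∀ ω, F ω * (Y ω * (W.D i (t + H) ω - W.D i t ω)) =
      ∑ k ∈ Finset.range H, σ * (F ω * (Y ω * Δ k ω)) := by
    intro ω
    by_cases h : F ω = 0
    · simp [h]
    · rw [W.D_add, Finset.mul_sum, Finset.mul_sum]
      refine Finset.sum_congr rfl fun k hk => ?_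
      obtain ⟨h1, h2⟩ := W.b_of_forced h (Finset.mem_range.1 hk)
      rcases hσ with ⟨rfl, rfl⟩ | ⟨rfl, rfl⟩
      · rw [h1, h2]; ring
      · rw [Bool.not_not] at h2
        rw [h1, h2]; ring
  -- at a tie the potential is on its plateau, and it can only decrease
  have hpt : ∀ ω, q ω * (W.pot i r lam K (t + H) ω - W.pot i r lam K t ω) ≤
      c1 * W.err H t ω + k3 * (2 * W.B + K) * (F ω * (Y ω * W.A t ω))
      - k3 * (F ω * (Y ω * (W.D i (t + H) ω - W.D i t ω))) := by
    intro ω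
    have h2 : 0 ≤ c1 * W.err H t ω := (abs_nonneg _).trans (W.abs_push_sub_le hr i t H ω)
    by_cases hne : q ω = 0
    · simp only [hY, hne, zero_mul, mul_zero]; linarith
    obtain ⟨hnear, -⟩ := hsupp ω hne
    have h1 := W.pot_add_le hr hlam.le hK0 i t H ω
    set u := W.D i (t + H) ω / W.A t ω with hu
    have hpot : W.pot i r lam K t ω = W.push i r t ω := by
      unfold pot
      rw [profile_eq_one, mul_one]
      rw [div_le_iff₀ (hA ω)]
      exact (le_of_abs_le hnear).trans (mul_le_mul_of_nonneg_right hK (hA ω).le)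
    have huL : u - K ≤ L := by
      have h3 := le_of_abs_le (W.abs_D_sub_le i t H ω)
      have h4 := le_of_abs_le hnear
      have : u ≤ L := by
        rw [hu, div_le_iff₀ (hA ω), hL]; linarith
      linarith
    have h5 := le_one_sub_profile (K := K) hlam.le huL hL0
    have h6 : 0 ≤ 1 - profile lam K u := sub_nonneg.2 (profile_le_one hlam.le u)
    have h7 : 0 ≤ q ω * W.push i r t ω := mul_nonneg (hq0 ω) (W.push_nonneg hr i t ω)
    have h8 : q ω * W.push i r t ω * (F ω * (k3 * (u - K)))
        ≤ q ω * W.push i r t ω * (1 - profile lam K u) :=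
      mul_le_mul_of_nonneg_left ((mul_le_mul_of_nonneg_left h5 (hF0 ω)).trans
        (mul_le_of_le_one_left h6 (hF1 ω))) h7
    have h9 : q ω * (W.pot i r lam K (t + H) ω - W.pot i r lam K t ω)
        ≤ c1 * W.err H t ω - q ω * W.push i r t ω * (1 - profile lam K u) := by
      rw [hpot]
      have h10 := mul_le_mul_of_nonneg_left h1 (hq0 ω)
      have h11 := mul_le_of_le_one_left h2 (hq1 ω)
      linarith
    have h12 : W.D i (t + H) ω = u * W.A t ω := by rw [hu, div_mul_cancel₀ _ (hA ω).ne']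
    have h13 : q ω * W.push i r t ω * (F ω * (k3 * (u - K)))
        = k3 * (F ω * (Y ω * W.D i (t + H) ω)) - k3 * K * (F ω * (Y ω * W.A t ω)) := by
      rw [h12, show Y ω * (u * W.A t ω) = u * (Y ω * W.A t ω) by ring, hYA]; ring
    have h14 : -(k3 * (2 * W.B) * (F ω * (Y ω * W.A t ω))) ≤ k3 * (F ω * (Y ω * W.D i t ω)) := by
      have := mul_le_mul_of_nonneg_left (neg_le_of_abs_le hnear)
        (mul_nonneg hk30.le (mul_nonneg (hF0 ω) (hY0 ω)))
      linarith
    linarith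
  have hle : ⨆ k, W.rnd (t + k) ≤ mΩ := iSup_le fun k => W.rnd_le' _
  have hY' := hYm.mono (W.past.le t)
  have hF' := hFm.mono hle
  have hA' : BddMeas mΩ (W.A t) := (W.bddMeas_A t).mono (W.past.le t)
  have hΔm : ∀ k, BddMeas mΩ (Δ k) := fun k => ((W.bddMeas_s l _).mono (W.past.le _)).mul
      (((W.bddMeas_R l _).mono W.rew_le).sub ((W.bddMeas_X l _).mono (W.past.le _)))
  have hi1 : ∀ k, Integrable (fun ω => F ω * (Y ω * Δ k ω)) P :=
    fun k => (hF'.mul (hY'.mul (hΔm k))).integrable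
  have hi2 : ∀ k, Integrable (fun ω => σ * (F ω * (Y ω * Δ k ω))) P := fun k => (hi1 k).const_mul σ
  set a : ℝ := ∫ ω, Y ω * W.A t ω ∂P with ha
  set E : ℝ := ∫ ω, W.err H t ω ∂P with hE
  have ha0 : 0 ≤ a := integral_nonneg fun ω => mul_nonneg (hY0 ω) (hA ω).le
  have hE0 : 0 ≤ E := integral_nonneg fun ω => W.err_nonneg H t ω
  have hip : Integrable (fun ω => Y ω * W.pull l t ω) P :=
    (hY'.mul ((W.bddMeas_pull l t).mono (W.past.le t))).integrable
  have hFint : ∫ ω, F ω ∂P = W.α ^ H := W.integral_prod_β_neg l H t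
  have hp0 : 0 < W.α ^ H := by positivity
  have hdr : r * a ≤ σ * ∫ ω, Y ω * W.pull l t ω ∂P := by
    rw [ha, ← integral_const_mul, ← integral_const_mul]
    refine integral_mono ((hY'.mul hA').integrable.const_mul r) (hip.const_mul σ) fun ω => ?_
    show r * (Y ω * W.A t ω) ≤ σ * (Y ω * W.pull l t ω)
    by_cases h : q ω = 0
    · simp [hY, h]
    · have := mul_le_mul_of_nonneg_left (hsupp ω h).2 (hY0 ω)
      linarith
  have hσ1 : |σ| = 1 := by rcases hσ with ⟨-, rfl⟩ | ⟨-, rfl⟩ <;> simp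
  have hterm : ∀ k ∈ Finset.range H, W.α ^ H * (r * a) - W.mix k * (W.α ^ H * a) - c2 * E ≤
      ∫ ω, σ * (F ω * (Y ω * Δ k ω)) ∂P := by
    intro k hk
    have hk' := (Finset.mem_range.1 hk).le
    have h1 := W.abs_integral_update_sub_le l t k H hk' hFm hF0 hF1 hYm hY0 hYr
    rw [hFint] at h1
    rw [integral_const_mul]
    have h2 : |σ * (∫ ω, F ω * (Y ω * Δ k ω) ∂P
        - W.α ^ H * ∫ ω, Y ω * W.pull l t ω ∂P)| ≤ W.α ^ H * (W.mix k * a) + c2 * E := by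
      rw [abs_mul, hσ1, one_mul]; exact h1
    have h3 := neg_le_of_abs_le h2
    have h4 := mul_le_mul_of_nonneg_left hdr hp0.le
    rw [mul_sub] at h3
    linarith
  have hmain : W.α ^ H * ((2 * W.B + K + 1) * a) - H * c2 * E
      ≤ ∫ ω, F ω * (Y ω * (W.D i (t + H) ω - W.D i t ω)) ∂P := by
    simp_rw [hS]
    rw [integral_finsetSum _ fun k _ => hi2 k]
    refine le_trans ?_ (Finset.sum_le_sum hterm)
    rw [Finset.sum_sub_distrib, Finset.sum_sub_distrib, Finset.sum_const,
      Finset.sum_const, ← Finset.sum_mul, Finset.card_range, nsmul_eq_mul, nsmul_eq_mul]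
    have hpa : 0 ≤ W.α ^ H * a := mul_nonneg hp0.le ha0
    have h1 := mul_le_mul_of_nonneg_right (W.sum_mix_le H) hpa
    have h2 := mul_le_mul_of_nonneg_right hH hpa
    nlinarith
  have hDm : BddMeas mΩ fun ω => F ω * (Y ω * (W.D i (t + H) ω - W.D i t ω)) :=
    hF'.mul (hY'.mul
      (((W.bddMeas_D i _).mono (W.past.le _)).sub ((W.bddMeas_D i _).mono (W.past.le _))))
  have hf1 : Integrable (fun ω => c1 * W.err H t ω) P := (W.bddMeas_err H t).integrable.const_mul _
  have hf2 : Integrable (fun ω => k3 * (2 * W.B + K) * (F ω * (Y ω * W.A t ω))) P :=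
    (hF'.mul (hY'.mul hA')).integrable.const_mul _
  have hf3 : Integrable (fun ω => k3 * (F ω * (Y ω * (W.D i (t + H) ω - W.D i t ω)))) P :=
    hDm.integrable.const_mul _
  have hf4 : Integrable (fun ω => c1 * W.err H t ω
      + k3 * (2 * W.B + K) * (F ω * (Y ω * W.A t ω))) P := hf1.add hf2
  have hpm : ∀ t, BddMeas mΩ (W.pot i r lam K t) := fun t =>
    (W.bddMeas_pot hr hlam.le i K t).mono (W.past.le t)
  have hfin := integral_mono (((hq.mono (W.past.le t)).mul ((hpm (t + H)).sub (hpm t))).integrable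
    (P := P)) (hf4.sub hf3) hpt
  beta_reduce at hfin
  have hFY : ∫ ω, F ω * (Y ω * W.A t ω) ∂P = W.α ^ H * a := by
    rw [← hFint]
    exact W.integral_rnd_mul (t := t) hFm.1
      (((hYm.mul (W.bddMeas_A t)).mono le_sup_left).1)
  have hsplit : ∫ ω, (c1 * W.err H t ω + k3 * (2 * W.B + K) * (F ω * (Y ω * W.A t ω))
      - k3 * (F ω * (Y ω * (W.D i (t + H) ω - W.D i t ω)))) ∂P =
      c1 * E + k3 * (2 * W.B + K) * (W.α ^ H * a)
      - k3 * ∫ ω, F ω * (Y ω * (W.D i (t + H) ω - W.D i t ω)) ∂P := by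
    rw [integral_sub hf4 hf3, integral_add hf1 hf2, integral_const_mul, integral_const_mul,
      integral_const_mul, hFY]
  have h1 := mul_le_mul_of_nonneg_left hmain hk30.le
  have h2 : ∫ ω, q ω * W.push i r t ω ∂P = a := integral_congr_ae (ae_of_all _ fun ω =>
    (hYA ω).symm)
  rw [h2]
  calc _ ≤ _ := hfin
    _ = _ := hsplit
    _ ≤ _ := by nlinarith

theorem summable_sub_shift {x : ℕ → ℝ} (hx : ∀ t, 0 ≤ x t) {y z : ℕ → ℝ} (hy : ∀ t, 0 ≤ y t)
    (hz : Summable z) (H : ℕ) (h : ∀ t, x (t + H) + y t ≤ x t + z t) : Summable y := by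
  obtain ⟨K, hK⟩ : ∃ K, ∀ T, ∑ t ∈ Finset.range T, z t ≤ K := by
    obtain ⟨K, hK⟩ := (Conv.of_summable hz).exists_abs_le
    exact ⟨K, fun T => le_of_abs_le (hK T)⟩
  refine summable_of_sum_range_le (c := ∑ t ∈ Finset.range H, x t + K) hy fun T => ?_
  have h1 := Finset.sum_le_sum fun t (_ : t ∈ Finset.range T) => h t
  rw [Finset.sum_add_distrib, Finset.sum_add_distrib] at h1
  have h2 := Finset.sum_range_add x H T
  have h3 := Finset.sum_range_add x T H
  rw [Nat.add_comm H T, h3] at h2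
  have h4 : 0 ≤ ∑ t ∈ Finset.range H, x (T + t) := Finset.sum_nonneg fun t _ => hx _
  simp_rw [Nat.add_comm _ H] at h1
  linarith [hK T]

set_option maxHeartbeats 400000 in
/-- The times of a tie at which the drift of the preferred arm is large are rare. -/
theorem ae_summable_near [IsProbabilityMeasure P]
    (hcls : ∀ i t ω, W.cls i t ω = SignType.sign (W.X i t ω - W.X (!i) t ω))
    (i : Bool) {r : ℝ} (hr : 0 < r) : ∀ᵐ ω ∂P,
      Summable fun t => (if |W.D i t ω| ≤ 2 * W.B * W.A t ω then (1 : ℝ) else 0)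
        * W.push i r t ω := by
  classical
  have hB := W.B_nonneg
  have hκ := W.κ_nonneg
  have hα := W.α_pos; have hα2 := W.α_le
  -- in `J` steps the drift dominates the total mixing error; in `H` forced steps it moreover carries
  -- the difference of the estimates from a tie to the decreasing part of the profile
  obtain ⟨J, hJ⟩ := exists_nat_ge ((W.κ + 1) / r)
  rw [div_le_iff₀ hr] at hJ
  have hJ1 : 1 ≤ J := by
    by_contra hc
    have : J = 0 := by omega
    rw [this] at hJ; simp at hJ; linarith
  have hJ1' : (1 : ℝ) ≤ J := by exact_mod_cast hJ1
  set K : ℝ := 2 * W.B * J with hK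
  have hK0 : 0 ≤ K := by positivity
  have hKB : 2 * W.B ≤ K := by rw [hK]; exact le_mul_of_one_le_right (by linarith) hJ1'
  set lam : ℝ := 1 / (1 + K) ^ 2 with hlam
  have hlam0 : 0 < lam := by positivity
  have hl1 : lam * K ≤ 1 := by
    rw [hlam, one_div, inv_mul_le_iff₀ (by positivity)]; nlinarith
  have hl2 : lam * K ^ 2 ≤ 1 := by
    rw [hlam, one_div, inv_mul_le_iff₀ (by positivity)]; nlinarith
  obtain ⟨m, hm⟩ := exists_nat_ge ((W.κ + 2 * W.B + K + 1) / r)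
  rw [div_le_iff₀ hr] at hm
  set H : ℕ := m * J with hH
  have hH' : W.κ + 2 * W.B + K + 1 ≤ H * r := by
    refine hm.trans (mul_le_mul_of_nonneg_right ?_ hr.le)
    rw [hH]; push_cast
    exact le_mul_of_one_le_right (Nat.cast_nonneg m) hJ1'
  obtain ⟨C0, hC0⟩ := W.exists_block_bound hcls i hr J hJ hK hlam0 hl1 hl2
  obtain ⟨C1, c1, hc1, h1⟩ := W.exists_escape_bound i i 1 (Or.inl ⟨rfl, rfl⟩) hr hKB hlam0 H hH'
  obtain ⟨C2, c2, hc2, h2⟩ :=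
    W.exists_escape_bound i (!i) (-1) (Or.inr ⟨rfl, rfl⟩) hr hKB hlam0 H hH'
  set near : ℕ → Ω → ℝ := fun t ω => if |W.D i t ω| ≤ 2 * W.B * W.A t ω then (1 : ℝ) else 0
    with hnear
  have hAm := fun t => (W.bddMeas_A t).1
  have hnm : ∀ t, BddMeas (W.past t) (near t) := fun t => by
    refine BddMeas.ite (measurableSet_le ?_ ((hAm t).const_mul _))
    exact measurable_norm.comp (W.bddMeas_D i t).1
  -- the two cases: the preferred arm pulls up, or the other arm pulls down
  set q1 : ℕ → Ω → ℝ := fun t ω => near t ω *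
    (if r * W.A t ω < W.pull i t ω then (1 : ℝ) else 0) with hq1
  set q2 : ℕ → Ω → ℝ := fun t ω => near t ω *
    ((1 - if r * W.A t ω < W.pull i t ω then (1 : ℝ) else 0) *
      (if r * W.A t ω < -W.pull (!i) t ω then (1 : ℝ) else 0)) with hq2
  set q3 : ℕ → Ω → ℝ := fun t ω => 1 - q1 t ω - q2 t ω with hq3
  have hq1m : ∀ t, BddMeas (W.past t) (q1 t) := fun t =>
    (hnm t).mul (BddMeas.ite (measurableSet_lt ((hAm t).const_mul r) (W.bddMeas_pull i t).1))
  have hq2m : ∀ t, BddMeas (W.past t) (q2 t) := fun t =>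
    (hnm t).mul (((BddMeas.const 1).sub (BddMeas.ite (measurableSet_lt ((hAm t).const_mul r)
      (W.bddMeas_pull i t).1))).mul
      (BddMeas.ite (measurableSet_lt ((hAm t).const_mul r) (W.bddMeas_pull (!i) t).1.neg)))
  have hq3m : ∀ t, BddMeas (W.past t) (q3 t) := fun t =>
    ((BddMeas.const 1).sub (hq1m t)).sub (hq2m t)
  have hqv : ∀ t ω, (0 ≤ q1 t ω ∧ q1 t ω ≤ 1) ∧ (0 ≤ q2 t ω ∧ q2 t ω ≤ 1)
      ∧ (0 ≤ q3 t ω ∧ q3 t ω ≤ 1) := fun t ω => by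
    simp only [hq1, hq2, hq3, hnear]
    split_ifs <;> norm_num
  have hq1s : ∀ t ω, q1 t ω ≠ 0 → |W.D i t ω| ≤ 2 * W.B * W.A t ω ∧
      r * W.A t ω ≤ 1 * W.pull i t ω := fun t ω h => by
    simp only [hq1, hnear] at h
    split_ifs at h with h3 h4 <;> simp at h
    exact ⟨h3, by linarith⟩
  have hq2s : ∀ t ω, q2 t ω ≠ 0 → |W.D i t ω| ≤ 2 * W.B * W.A t ω ∧
      r * W.A t ω ≤ -1 * W.pull (!i) t ω := fun t ω h => by
    simp only [hq2, hnear] at h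
    split_ifs at h with h3 h4 h5 <;> simp at h
    exact ⟨h3, by linarith⟩
  have hpush : ∀ t ω, near t ω * W.push i r t ω
      = q1 t ω * W.push i r t ω + q2 t ω * W.push i r t ω := by
    intro t ω
    rcases (W.push_nonneg hr i t ω).eq_or_lt with h0 | h0
    · rw [← h0]; simp
    · have h3 := W.lt_drift_of_push_pos h0
      have hA := mul_pos hr (W.A_pos t ω)
      simp only [hq1, hq2]
      split_ifs with h4 h5 h5
      · ring
      · ring
      · ring
      · exfalso
        unfold drift at h3
        nlinarith
  set x : ℕ → ℝ := fun t => ∫ ω, W.pot i r lam K t ω ∂P with hx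
  set y : ℕ → ℝ := fun t => min c1 c2 * ∫ ω, near t ω * W.push i r t ω ∂P with hy
  set z : ℕ → ℝ := fun t => C1 * ∫ ω, W.err H t ω ∂P + C2 * ∫ ω, W.err H t ω ∂P
    + ∑ k ∈ Finset.range m, C0 * ∫ ω, W.err J (t + k * J) ω ∂P with hz
  have hpm : ∀ t, BddMeas mΩ (W.pot i r lam K t) := fun t =>
    (W.bddMeas_pot hr hlam0.le i K t).mono (W.past.le t)
  have hpushm : ∀ t, BddMeas mΩ (W.push i r t) := fun t => (W.bddMeas_push hr i t).mono (W.past.le t)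
  -- elsewhere the potential does not increase over the `m` blocks of length `J`
  have hchain : ∀ t, ∫ ω, q3 t ω * (W.pot i r lam K (t + H) ω - W.pot i r lam K t ω) ∂P ≤
      ∑ k ∈ Finset.range m, C0 * ∫ ω, W.err J (t + k * J) ω ∂P := by
    intro t
    have e : ∀ ω, q3 t ω * (W.pot i r lam K (t + H) ω - W.pot i r lam K t ω) =
        ∑ k ∈ Finset.range m, q3 t ω *
          (W.pot i r lam K (t + k * J + J) ω - W.pot i r lam K (t + k * J) ω) := fun ω => by
      rw [← Finset.mul_sum]
      have h3 := Finset.sum_range_sub (fun k => W.pot i r lam K (t + k * J) ω) m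
      simp only [zero_mul, add_zero] at h3
      rw [hH, ← h3]
      congr 1
      refine Finset.sum_congr rfl fun k _ => ?_
      rw [show t + (k + 1) * J = t + k * J + J by ring]
    simp_rw [e]
    rw [integral_finsetSum]
    · exact Finset.sum_le_sum fun k _ => hC0 (t + k * J) (q3 t)
        ((hq3m t).mono (W.past.mono (Nat.le_add_right _ _))) (fun ω => (hqv t ω).2.2.1)
        (fun ω => (hqv t ω).2.2.2)
    · exact fun k _ => (((hq3m t).mono (W.past.le t)).mul ((hpm _).sub (hpm _))).integrable
  -- the potential is nonnegative, so the total of its decreases is finite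
  have hsum : Summable y := by
    refine summable_sub_shift (x := x) (fun t => integral_nonneg fun ω => W.pot_nonneg hr _ _ _ _ _)
      (fun t => mul_nonneg (le_min hc1.le hc2.le) (integral_nonneg fun ω => mul_nonneg (by
        simp only [hnear]; split_ifs <;> norm_num) (W.push_nonneg hr i t ω)))
      (z := z) ?_ H fun t => ?_
    · refine (((W.summable_integral_err H).mul_left C1).add
        ((W.summable_integral_err H).mul_left C2)).add (summable_sum fun k _ => ?_)
      exact ((summable_nat_add_iff (k * J)).2 (W.summable_integral_err J)).mul_left C0
    · have e1 := h1 t (q1 t) (hq1m t) (fun ω => (hqv t ω).1.1) (fun ω => (hqv t ω).1.2) (hq1s t)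
      have e2 := h2 t (q2 t) (hq2m t) (fun ω => (hqv t ω).2.1.1) (fun ω => (hqv t ω).2.1.2)
        (hq2s t)
      have e3 := hchain t
      have hd : BddMeas mΩ fun ω => W.pot i r lam K (t + H) ω - W.pot i r lam K t ω :=
        (hpm _).sub (hpm _)
      have hi : ∀ q : Ω → ℝ, BddMeas (W.past t) q → Integrable (fun ω => q ω *
          (W.pot i r lam K (t + H) ω - W.pot i r lam K t ω)) P := fun q hq =>
        ((hq.mono (W.past.le t)).mul hd).integrable
      have hi2 : ∀ q : Ω → ℝ, BddMeas (W.past t) q → Integrable (fun ω => q ω *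
          W.push i r t ω) P := fun q hq => ((hq.mono (W.past.le t)).mul (hpushm t)).integrable
      have e4 : x (t + H) - x t
          = ∫ ω, q1 t ω * (W.pot i r lam K (t + H) ω - W.pot i r lam K t ω) ∂P
          + ∫ ω, q2 t ω * (W.pot i r lam K (t + H) ω - W.pot i r lam K t ω) ∂P
          + ∫ ω, q3 t ω * (W.pot i r lam K (t + H) ω - W.pot i r lam K t ω) ∂P := by
        have hi12 : Integrable (fun ω =>
            q1 t ω * (W.pot i r lam K (t + H) ω - W.pot i r lam K t ω)
            + q2 t ω * (W.pot i r lam K (t + H) ω - W.pot i r lam K t ω)) P :=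
          (hi _ (hq1m t)).add (hi _ (hq2m t))
        rw [← integral_add (hi _ (hq1m t)) (hi _ (hq2m t)),
          ← integral_add hi12 (hi _ (hq3m t))]
        simp only [hx]
        rw [← integral_sub (hpm _).integrable (hpm _).integrable]
        refine integral_congr_ae (ae_of_all _ fun ω => ?_)
        simp only [hq3]
        ring
      have e5 : ∫ ω, near t ω * W.push i r t ω ∂P
          = ∫ ω, q1 t ω * W.push i r t ω ∂P + ∫ ω, q2 t ω * W.push i r t ω ∂P := by
        rw [← integral_add (hi2 _ (hq1m t)) (hi2 _ (hq2m t))]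
        exact integral_congr_ae (ae_of_all _ fun ω => hpush t ω)
      have e6 : 0 ≤ ∫ ω, q1 t ω * W.push i r t ω ∂P := integral_nonneg fun ω =>
        mul_nonneg (hqv t ω).1.1 (W.push_nonneg hr i t ω)
      have e7 : 0 ≤ ∫ ω, q2 t ω * W.push i r t ω ∂P := integral_nonneg fun ω =>
        mul_nonneg (hqv t ω).2.1.1 (W.push_nonneg hr i t ω)
      have e8 := mul_le_mul_of_nonneg_right (min_le_left c1 c2) e6
      have e9 := mul_le_mul_of_nonneg_right (min_le_right c1 c2) e7
      simp only [hy, hz]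
      rw [e5, mul_add]
      linarith
  have hsum2 := (summable_mul_left_iff (lt_min hc1 hc2).ne').1 hsum
  have hnp : ∀ t, BddMeas mΩ fun ω => near t ω * W.push i r t ω := fun t =>
    ((hnm t).mono (W.past.le t)).mul (hpushm t)
  refine ae_summable_of_summable_integral (fun t ω => near t ω * W.push i r t ω)
    (fun t => (hnp t).1) (fun t ω => mul_nonneg (by
      simp only [hnear]; split_ifs <;> norm_num) (W.push_nonneg hr i t ω)) (fun t => ?_) hsum2
  obtain ⟨K, hK⟩ := (hnp t).2
  exact ⟨K, fun ω => le_of_abs_le (hK ω)⟩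

end Arms

/-! ### Smooth steps -/

/-- A smooth step from `0` below `l` to a positive constant above `r`. -/
def ramp (l r x : ℝ) : ℝ :=
  max (x - l) 0 ^ 2 - 2 * max (x - (l + r) / 2) 0 ^ 2 + max (x - r) 0 ^ 2

/-- The derivative of `ramp`. -/
def tent (l r x : ℝ) : ℝ :=
  2 * max (x - l) 0 - 2 * (2 * max (x - (l + r) / 2) 0) + 2 * max (x - r) 0

section ramp

variable {l r : ℝ}

theorem abs_ramp_sub_le (l r x y : ℝ) :
    |ramp l r y - ramp l r x - tent l r x * (y - x)| ≤ 8 * (y - x) ^ 2 := by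
  have h1 := abs_le.1 (abs_posPart_sq_le l x y)
  have h2 := abs_le.1 (abs_posPart_sq_le ((l + r) / 2) x y)
  have h3 := abs_le.1 (abs_posPart_sq_le r x y)
  have h4 := sq_nonneg (y - x)
  unfold ramp tent
  rw [abs_le]
  constructor <;> linarith [h1.1, h1.2, h2.1, h2.2, h3.1, h3.2]

theorem abs_tent_sub_le (l r x y : ℝ) : |tent l r x - tent l r y| ≤ 8 * |x - y| := by
  have h1 := abs_le.1 (abs_posPart_sub_le l x y)
  have h2 := abs_le.1 (abs_posPart_sub_le ((l + r) / 2) x y)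
  have h3 := abs_le.1 (abs_posPart_sub_le r x y)
  unfold tent
  rw [abs_le]
  constructor <;> linarith [h1.1, h1.2, h2.1, h2.2, h3.1, h3.2]

theorem ramp_of_le (h : l < r) {x : ℝ} (hx : x ≤ l) : ramp l r x = 0 := by
  unfold ramp
  rw [max_eq_right, max_eq_right, max_eq_right] <;> linarith

theorem ramp_of_ge (h : l < r) {x : ℝ} (hx : r ≤ x) : ramp l r x = (r - l) ^ 2 / 2 := by
  unfold ramp
  rw [max_eq_left, max_eq_left, max_eq_left] <;> linarith

theorem tent_of_le (h : l < r) {x : ℝ} (hx : x ≤ l) : tent l r x = 0 := by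
  unfold tent
  rw [max_eq_right, max_eq_right, max_eq_right] <;> linarith

theorem tent_of_ge (h : l < r) {x : ℝ} (hx : r ≤ x) : tent l r x = 0 := by
  unfold tent
  rw [max_eq_left, max_eq_left, max_eq_left] <;> linarith

theorem tent_nonneg (h : l < r) (x : ℝ) : 0 ≤ tent l r x := by
  rcases le_total x l with h1 | h1
  · rw [tent_of_le h h1]
  rcases le_total r x with h2 | h2
  · rw [tent_of_ge h h2]
  unfold tent
  rw [max_eq_left (by linarith : 0 ≤ x - l), max_eq_right (by linarith : x - r ≤ 0)]
  rcases le_total (x - (l + r) / 2) 0 with h3 | h3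
  · rw [max_eq_right h3]; linarith
  · rw [max_eq_left h3]; linarith

theorem tent_le (h : l < r) (x : ℝ) : tent l r x ≤ 2 * (r - l) := by
  rcases le_total x l with h1 | h1
  · rw [tent_of_le h h1]; linarith
  rcases le_total r x with h2 | h2
  · rw [tent_of_ge h h2]; linarith
  unfold tent
  rw [max_eq_left (by linarith : 0 ≤ x - l), max_eq_right (by linarith : x - r ≤ 0)]
  have := le_max_right (x - (l + r) / 2) 0
  linarith

theorem abs_ramp_le (h : l < r) (x : ℝ) : |ramp l r x| ≤ (r - l) ^ 2 := by
  rcases le_total x l with h1 | h1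
  · rw [ramp_of_le h h1, abs_zero]; positivity
  rcases le_total r x with h2 | h2
  · rw [ramp_of_ge h h2, abs_of_nonneg (by positivity)]; nlinarith [sq_nonneg (r - l)]
  unfold ramp
  rw [max_eq_left (by linarith : 0 ≤ x - l), max_eq_right (by linarith : x - r ≤ 0)]
  rcases le_total (x - (l + r) / 2) 0 with h3 | h3
  · rw [max_eq_right h3, abs_le]; constructor <;> nlinarith
  · rw [max_eq_left h3, abs_le]; constructor <;> nlinarith

theorem eventually_lt_of_conv_ramp (h : l < r) {x : ℕ → ℝ} (hc : Conv fun t => ramp l r (x t))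
    (hf : ∃ᶠ t in atTop, r ≤ x t) : ∀ᶠ t in atTop, l < x t := by
  obtain ⟨z, hz⟩ := hc
  have h0 : 0 < (r - l) ^ 2 / 2 := by have := sub_pos.2 h; positivity
  have h1 : z = (r - l) ^ 2 / 2 := by
    by_contra hne
    have h2 := hz.eventually_ne hne
    obtain ⟨t, h3, h4⟩ := (hf.and_eventually h2).exists
    exact h4 (ramp_of_ge h h3)
  filter_upwards [hz.eventually (lt_mem_nhds (h1 ▸ h0))] with t ht
  by_contra hle
  rw [ramp_of_le h (not_lt.1 hle)] at ht
  exact lt_irrefl _ ht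

theorem eventually_gt_of_conv_ramp (h : l < r) {x : ℕ → ℝ} (hc : Conv fun t => ramp l r (x t))
    (hf : ∃ᶠ t in atTop, x t ≤ l) : ∀ᶠ t in atTop, x t < r := by
  obtain ⟨z, hz⟩ := hc
  have h0 : 0 < (r - l) ^ 2 / 2 := by have := sub_pos.2 h; positivity
  have h1 : z = 0 := by
    by_contra hne
    have h2 := hz.eventually_ne hne
    obtain ⟨t, h3, h4⟩ := (hf.and_eventually h2).exists
    exact h4 (ramp_of_le h h3)
  filter_upwards [hz.eventually (gt_mem_nhds (h1 ▸ h0))] with t ht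
  by_contra hle
  rw [ramp_of_ge h (not_lt.1 hle)] at ht
  exact lt_irrefl _ ht

end ramp

theorem exists_sum_le_of_eventually_nonpos {x : ℕ → ℝ} (h : ∀ᶠ t in atTop, x t ≤ 0) :
    ∃ K, ∀ T, ∑ t ∈ Finset.range T, x t ≤ K := by
  obtain ⟨T0, hT0⟩ := eventually_atTop.1 h
  refine ⟨∑ t ∈ Finset.range T0, max (x t) 0, fun T => ?_⟩
  rcases le_total T T0 with hT | hT
  · calc ∑ t ∈ Finset.range T, x t ≤ ∑ t ∈ Finset.range T, max (x t) 0 :=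
          Finset.sum_le_sum fun t _ => le_max_left _ _
      _ ≤ _ := Finset.sum_le_sum_of_subset_of_nonneg (by rwa [Finset.range_subset_range])
          fun t _ _ => le_max_right _ _
  · induction T, hT using Nat.le_induction with
    | base => exact Finset.sum_le_sum fun t _ => le_max_left _ _
    | succ T hT ih => rw [Finset.sum_range_succ]; linarith [hT0 T hT]

namespace Arms

variable {Ω : Type*} [mΩ : MeasurableSpace Ω] {P : Measure Ω} (W : Arms P)

/-! ### Limits of the estimates, if changes of the class are rare -/

/-- The step size at a change of the class, weighted by the influence of the class. -/
def jump (i : Bool) (t : ℕ) (ω : Ω) : ℝ := (1 - 2 * W.α) * W.chg i t ω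

theorem jump_nonneg (i t ω) : 0 ≤ W.jump i t ω :=
  mul_nonneg (by linarith [W.α_le]) (W.chg_nonneg i t ω)

theorem jump_le (i t ω) : W.jump i t ω ≤ W.s i t ω := by
  have h1 := W.chg_le i t ω
  have h2 := W.chg_nonneg i t ω
  have h3 := W.α_pos
  unfold jump; nlinarith

/-- The evolution of a function of an estimate, with error terms that are summable if the changes
of the class are. -/
theorem ae_identity [IsProbabilityMeasure P] (i : Bool) {f ψ : ℝ → ℝ} {K : ℝ}
    (hK : 0 ≤ K) (hf : ∀ x y, |f y - f x - ψ x * (y - x)| ≤ K * (y - x) ^ 2)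
    (hψ : ∀ x y, |ψ x - ψ y| ≤ K * |x - y|) (hψm : Measurable ψ) :
    ∀ᵐ ω ∂P, (Summable fun t => |ψ (W.X i t ω)| * W.jump i t ω) → ∃ n : ℕ → ℝ,
      (Conv fun T => ∑ t ∈ Finset.range T, n t) ∧
      ∀ t, f (W.X i (t + 1) ω) = f (W.X i t ω) + (n t - ψ (W.X i t ω) *
          (W.b i t ω * (W.s i t ω * (W.X i t ω - W.mean i)))) := by
  filter_upwards [W.ae_smooth_identity i hK hf hψ hψm] with ω hω hs
  obtain ⟨z, v, hz, hv, hid⟩ := hω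
  have hvs : Summable v := by
    refine Summable.of_norm_bounded (hs.mul_left (6 * W.κ)) fun t => (hv t).trans (le_of_eq ?_)
    unfold jump; ring
  refine ⟨fun t => (z (t + 1) - z t) + v t, ?_, fun t => ?_⟩
  · have h1 : (fun T => ∑ t ∈ Finset.range T, ((z (t + 1) - z t) + v t))
        = fun T => (z T - z 0) + ∑ t ∈ Finset.range T, v t := by
      funext T
      rw [Finset.sum_add_distrib, Finset.sum_range_sub]
    rw [h1]
    exact (hz.sub (Conv.const _)).add (Conv.of_summable hvs)
  · rw [hid (t + 1), hid t, Finset.sum_range_succ, Finset.sum_range_succ]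
    ring

theorem ae_tendsto_zero_of_lyapunov [IsProbabilityMeasure P] (i : Bool) {f ψ : ℝ → ℝ} {K : ℝ}
    (hK : 0 ≤ K) (hf : ∀ x y, |f y - f x - ψ x * (y - x)| ≤ K * (y - x) ^ 2)
    (hψ : ∀ x y, |ψ x - ψ y| ≤ K * |x - y|) (hψm : Measurable ψ) (hf0 : ∀ x, 0 ≤ f x)
    (hdr : ∀ x, 2 * f x ≤ ψ x * (x - W.mean i)) :
    ∀ᵐ ω ∂P, (Summable fun t => |ψ (W.X i t ω)| * W.jump i t ω) →
      Tendsto (fun t => f (W.X i t ω)) atTop (𝓝 0) := by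
  filter_upwards [W.ae_identity i hK hf hψ hψm, W.ae_tendsto_sum_b_s i] with ω hω hbs hs
  obtain ⟨n, hn, hstep⟩ := hω hs
  have hbs0 : ∀ t, 0 ≤ W.b i t ω * W.s i t ω := fun t =>
    mul_nonneg (W.b_nonneg i t ω) (W.s_pos i t ω).le
  refine tendsto_zero_of_drift (q := fun t => f (W.X i t ω))
    (a := fun t => 2 * (W.b i t ω * W.s i t ω)) (fun t => hf0 _)
    (fun t => mul_nonneg zero_le_two (hbs0 t)) (fun h => ?_) (fun t => ?_) hn
    fun t => (hstep t).le
  · have h1 := (summable_mul_left_iff (two_ne_zero (α := ℝ))).1 h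
    exact not_tendsto_atTop_of_tendsto_nhds h1.hasSum.tendsto_sum_nat hbs
  · have := mul_le_mul_of_nonneg_left (hdr (W.X i t ω)) (hbs0 t)
    linarith

theorem tendsto_zero_of_sq {x : ℕ → ℝ} (h0 : ∀ t, 0 ≤ x t)
    (h : Tendsto (fun t => x t ^ 2) atTop (𝓝 0)) : Tendsto x atTop (𝓝 0) := by
  have h2 := (Real.continuous_sqrt.tendsto _).comp h
  simp only [Real.sqrt_zero] at h2
  exact h2.congr fun t => Real.sqrt_sq (h0 t)

/-- An estimate does not stay above a level that is at least its mean, if changes of the class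
above the level are rare. -/
theorem ae_above [IsProbabilityMeasure P] (i : Bool) {l : ℝ} (hl : W.mean i ≤ l) : ∀ᵐ ω ∂P,
    (Summable fun t => if l < W.X i t ω then W.jump i t ω else 0) →
      Tendsto (fun t => max (W.X i t ω - l) 0) atTop (𝓝 0) := by
  filter_upwards [W.ae_tendsto_zero_of_lyapunov i (f := fun x => max (x - l) 0 ^ 2)
    (ψ := fun x => 2 * max (x - l) 0) (K := 2) zero_le_two
    (fun x y => (abs_posPart_sq_le l x y).trans (by nlinarith [sq_nonneg (y - x)]))
    (fun x y => abs_posPart_sub_le l x y) (by fun_prop) (fun x => sq_nonneg _)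
    (fun x => by
      have h0 := le_max_right (x - l) 0
      rcases le_total (x - l) 0 with h | h
      · simp [max_eq_right h]
      · rw [max_eq_left h]; nlinarith)] with ω hω hs
  refine tendsto_zero_of_sq (fun t => le_max_right _ _) (hω ?_)
  refine Summable.of_nonneg_of_le (fun t => mul_nonneg (abs_nonneg _) (W.jump_nonneg i t ω))
    (fun t => ?_) (hs.mul_left (2 * (W.B + |l|)))
  split_ifs with h
  · refine mul_le_mul_of_nonneg_right ?_ (W.jump_nonneg i t ω)
    have h4 := le_of_abs_le (W.X_le i t ω)
    have h5 := neg_abs_le l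
    rw [max_eq_left (by linarith), abs_of_nonneg (by linarith)]
    linarith
  · rw [max_eq_right (by linarith)]; simp

theorem ae_below [IsProbabilityMeasure P] (i : Bool) {l : ℝ} (hl : l ≤ W.mean i) : ∀ᵐ ω ∂P,
    (Summable fun t => if W.X i t ω < l then W.jump i t ω else 0) →
      Tendsto (fun t => max (l - W.X i t ω) 0) atTop (𝓝 0) := by
  have e : ∀ x, -x - -l = l - x := fun x => by ring
  filter_upwards [W.ae_tendsto_zero_of_lyapunov i (f := fun x => max (l - x) 0 ^ 2)
    (ψ := fun x => -(2 * max (l - x) 0)) (K := 2) zero_le_two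
    (fun x y => by
      have := abs_posPart_sq_le (-l) (-x) (-y)
      rw [e, e] at this
      have e2 : max (l - y) 0 ^ 2 - max (l - x) 0 ^ 2 - -(2 * max (l - x) 0) * (y - x) =
        max (l - y) 0 ^ 2 - max (l - x) 0 ^ 2 - 2 * max (l - x) 0 * (-y - -x) := by ring
      rw [e2]
      refine this.trans ?_
      nlinarith [sq_nonneg (y - x)])
    (fun x y => by
      have := abs_posPart_sub_le (-l) (-y) (-x)
      rw [e, e] at this
      have e2 : -(2 * max (l - x) 0) - -(2 * max (l - y) 0)
        = 2 * max (l - y) 0 - 2 * max (l - x) 0 := by ring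
      rw [e2]
      refine this.trans (le_of_eq ?_)
      congr 2; ring) (by fun_prop) (fun x => sq_nonneg _)
    (fun x => by
      rcases le_total (l - x) 0 with h | h
      · simp [max_eq_right h]
      · rw [max_eq_left h]; nlinarith)] with ω hω hs
  refine tendsto_zero_of_sq (fun t => le_max_right _ _) (hω ?_)
  refine Summable.of_nonneg_of_le (fun t => mul_nonneg (abs_nonneg _) (W.jump_nonneg i t ω))
    (fun t => ?_) (hs.mul_left (2 * (W.B + |l|)))
  split_ifs with h
  · refine mul_le_mul_of_nonneg_right ?_ (W.jump_nonneg i t ω)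
    have h4 := neg_le_of_abs_le (W.X_le i t ω)
    have h5 := le_abs_self l
    rw [max_eq_left (by linarith), abs_neg, abs_of_nonneg (by linarith)]
    linarith
  · rw [max_eq_right (by linarith)]; simp

/-- If changes of the class are rare, then an estimate converges to the mean. -/
theorem ae_tendsto_of_summable_jump [IsProbabilityMeasure P] (i : Bool) : ∀ᵐ ω ∂P,
    (Summable fun t => W.jump i t ω) →
      Tendsto (fun t => W.X i t ω) atTop (𝓝 (W.mean i)) := by
  filter_upwards [W.ae_above i le_rfl, W.ae_below i le_rfl] with ω h1 h2 hs
  have hs' : ∀ p : ℕ → Prop, [DecidablePred p] → Summable fun t => if p t then W.jump i t ω else 0 :=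
    fun p _ => Summable.of_nonneg_of_le (fun t => by
      split_ifs
      · exact W.jump_nonneg i t ω
      · exact le_rfl) (fun t => by
      split_ifs
      · exact le_rfl
      · exact W.jump_nonneg i t ω) hs
  have h3 := (h1 (hs' _)).sub (h2 (hs' _))
  rw [sub_zero] at h3
  have h4 := h3.add_const (W.mean i)
  rw [zero_add] at h4
  refine h4.congr fun t => ?_
  rcases le_total (W.X i t ω) (W.mean i) with h | h
  · rw [max_eq_right (by linarith : W.X i t ω - W.mean i ≤ 0), max_eq_left (by linarith)]; ring
  · rw [max_eq_left (by linarith : 0 ≤ W.X i t ω - W.mean i), max_eq_right (by linarith)]; ring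

/-- An estimate does not cross an interval on one side of its mean infinitely often, if changes of
the class in this interval are rare. -/
theorem ae_conv_ramp [IsProbabilityMeasure P] (i : Bool) {l r : ℝ} (hlr : l < r)
    (h : r ≤ W.mean i ∨ W.mean i ≤ l) : ∀ᵐ ω ∂P,
    (Summable fun t => if l < W.X i t ω ∧ W.X i t ω < r then W.jump i t ω else 0) →
      Conv fun t => ramp l r (W.X i t ω) := by
  filter_upwards [W.ae_identity i (f := ramp l r) (ψ := tent l r) (K := 8) (by norm_num)
    (abs_ramp_sub_le l r) (abs_tent_sub_le l r) (by unfold tent; fun_prop)] with ω hω hs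
  have hs' : Summable fun t => |tent l r (W.X i t ω)| * W.jump i t ω := by
    refine Summable.of_nonneg_of_le (fun t => mul_nonneg (abs_nonneg _) (W.jump_nonneg i t ω))
      (fun t => ?_) (hs.mul_left (2 * (r - l)))
    split_ifs with h
    · refine mul_le_mul_of_nonneg_right ?_ (W.jump_nonneg i t ω)
      rw [abs_of_nonneg (tent_nonneg hlr _)]
      exact tent_le hlr _
    · have : tent l r (W.X i t ω) = 0 := by
        by_cases h1 : l < W.X i t ω
        · exact tent_of_ge hlr (not_lt.1 fun h2 => h ⟨h1, h2⟩)
        · exact tent_of_le hlr (not_lt.1 h1)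
      rw [this]; simp
  obtain ⟨n, hn, hstep⟩ := hω hs'
  set y : ℕ → ℝ := fun T => ramp l r (W.X i T ω) - ∑ t ∈ Finset.range T, n t with hy
  have hw : ∀ t, 0 ≤ tent l r (W.X i t ω) * (W.b i t ω * W.s i t ω) := fun t =>
    mul_nonneg (tent_nonneg hlr _) (mul_nonneg (W.b_nonneg i t ω) (W.s_pos i t ω).le)
  obtain ⟨K, hK⟩ := hn.exists_abs_le
  have hyb : ∀ T, |y T| ≤ (r - l) ^ 2 + K := fun T =>
    (abs_sub _ _).trans (add_le_add (abs_ramp_le hlr _) (hK T))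
  have hstep' : ∀ t, y (t + 1) = y t - tent l r (W.X i t ω) *
      (W.b i t ω * W.s i t ω) * (W.X i t ω - W.mean i) := fun t => by
    simp only [hy, Finset.sum_range_succ]
    rw [hstep]; ring
  have hyc : Conv y := by
    rcases h with h | h
    · have hm : Monotone y := monotone_nat_of_le_succ fun t => by
        rw [hstep']
        by_cases hx : W.X i t ω ≤ r
        · have := mul_nonneg (hw t) (show 0 ≤ W.mean i - W.X i t ω by linarith)
          linarith
        · rw [tent_of_ge hlr (not_le.1 hx).le]; simp
      refine ⟨_, tendsto_atTop_ciSup hm ⟨(r - l) ^ 2 + K, ?_⟩⟩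
      rintro _ ⟨T, rfl⟩
      exact le_of_abs_le (hyb T)
    · have hm : Antitone y := antitone_nat_of_succ_le fun t => by
        rw [hstep']
        by_cases hx : l ≤ W.X i t ω
        · have := mul_nonneg (hw t) (show 0 ≤ W.X i t ω - W.mean i by linarith)
          linarith
        · rw [tent_of_le hlr (not_le.1 hx).le]; simp
      refine ⟨_, tendsto_atTop_ciInf hm ⟨-((r - l) ^ 2 + K), ?_⟩⟩
      rintro _ ⟨T, rfl⟩
      exact neg_le_of_abs_le (hyb T)
  refine (hyc.add hn).imp fun z hz => hz.congr fun T => ?_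
  simp only [hy]; ring

/-- An estimate is not trapped at a distance from its mean, if the changes of the class are rare
apart from those at times when the step size of the arm is relatively small. -/
theorem ae_frequently_of_summable [IsProbabilityMeasure P] (i : Bool) {σ c k : ℝ} (hσ : |σ| = 1)
    (hc : 0 < c) (hk : 0 < k) (hkc : 12 * W.κ * k ≤ W.α ^ 3 * c) : ∀ᵐ ω ∂P,
    (Summable fun t => if k * W.s (!i) t ω < W.s i t ω then W.jump i t ω else 0) →
      ∃ᶠ t in atTop, σ * (W.mean i - W.X i t ω) < c := by
  filter_upwards [W.ae_smooth_identity i (f := fun x => x) (ψ := fun _ => 1) (K := 0) le_rfl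
    (fun x y => by simp) (fun x y => by simp) measurable_const, W.ae_rates i,
    W.ae_sum_s_le (!i) i] with ω hω hrate hsum hs
  by_contra hf
  rw [not_frequently] at hf
  obtain ⟨z, v, hz, hv, hid⟩ := hω
  have hα := W.α_pos
  have hκ := W.κ_nonneg
  obtain ⟨K1, hK1⟩ := hz.exists_abs_le
  obtain ⟨K2, hK2⟩ := hrate.1
  obtain ⟨K3, hK3⟩ := hsum
  obtain ⟨K4, hK4⟩ := (Conv.of_summable (hs.mul_left (6 * W.κ))).exists_abs_le
  -- from some time on, the estimate is pulled to one side with strength at least `c`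
  obtain ⟨K5, hK5⟩ : ∃ K5, ∀ T, ∑ t ∈ Finset.range T, (c * (W.b i t ω * W.s i t ω)
      - σ * (W.b i t ω * (W.s i t ω * (W.mean i - W.X i t ω)))) ≤ K5 := by
    refine exists_sum_le_of_eventually_nonpos ?_
    filter_upwards [hf] with t ht
    have := mul_le_mul_of_nonneg_left (not_lt.1 ht)
      (mul_nonneg (W.b_nonneg i t ω) (W.s_pos i t ω).le)
    linarith
  -- changes of the class with a relatively small step size of arm `i` are paid by the step sizes of
  -- the other arm
  have hvT : ∀ T, |∑ t ∈ Finset.range T, v t| ≤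
      K4 + 6 * W.κ * k * ∑ t ∈ Finset.range T, W.s (!i) t ω := by
    intro T
    have h1 : ∀ t, |v t| ≤ 6 * W.κ * (if k * W.s (!i) t ω < W.s i t ω then W.jump i t ω else 0)
        + 6 * W.κ * k * W.s (!i) t ω := by
      intro t
      have h2 : |v t| ≤ 6 * W.κ * W.jump i t ω := by
        refine (hv t).trans (le_of_eq ?_)
        rw [abs_one]; unfold jump; ring
      refine h2.trans ?_
      have h3 := W.s_pos (!i) t ω
      split_ifs with h
      · have : 0 ≤ 6 * W.κ * k * W.s (!i) t ω := by positivity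
        linarith
      · have h4 : W.jump i t ω ≤ k * W.s (!i) t ω := (W.jump_le i t ω).trans (not_lt.1 h)
        have := mul_le_mul_of_nonneg_left h4 (show 0 ≤ 6 * W.κ by positivity)
        linarith
    refine (Finset.abs_sum_le_sum_abs _ _).trans ((Finset.sum_le_sum fun t _ => h1 t).trans ?_)
    rw [Finset.sum_add_distrib, ← Finset.mul_sum (a := 6 * W.κ * k)]
    linarith [le_of_abs_le (hK4 T)]
  -- the estimate would grow at least in proportion to the sum of the step sizes
  have hgrow : ∀ T, W.α * c / 2 * ∑ t ∈ Finset.range T, W.a t ≤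
      W.B + K1 + K4 + K5 + c * K2 + W.α * c / 2 * |K3| := by
    intro T
    set Si := ∑ t ∈ Finset.range T, W.s i t ω with hSi
    set Sj := ∑ t ∈ Finset.range T, W.s (!i) t ω with hSj
    have h1 : W.X i T ω = ∑ t ∈ Finset.range T, 1 *
        (W.b i t ω * (W.s i t ω * (W.mean i - W.X i t ω))) + z T + ∑ t ∈ Finset.range T, v t := hid T
    have h2 := hK5 T
    rw [Finset.sum_sub_distrib, ← Finset.mul_sum, ← Finset.mul_sum] at h2
    have h3 : σ * W.X i T ω ≤ W.B := by
      refine (le_abs_self _).trans ?_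
      rw [abs_mul, hσ, one_mul]; exact W.X_le i T ω
    have h4 : -K1 ≤ σ * z T := by
      refine neg_le_of_abs_le ?_
      rw [abs_mul, hσ, one_mul]; exact hK1 T
    have h5 : -(K4 + 6 * W.κ * k * Sj) ≤ σ * ∑ t ∈ Finset.range T, v t := by
      refine neg_le_of_abs_le ?_
      rw [abs_mul, hσ, one_mul]; exact hvT T
    simp only [one_mul] at h1
    have h6 : σ * W.X i T ω = σ * ∑ t ∈ Finset.range T,
        (W.b i t ω * (W.s i t ω * (W.mean i - W.X i t ω))) + σ * z T
        + σ * ∑ t ∈ Finset.range T, v t := by rw [h1]; ring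
    have h7 := mul_le_mul_of_nonneg_left (hK2 T) hc.le
    have h8 : 6 * W.κ * k * Sj ≤ W.α * c / 2 * (Si + |K3|) := by
      have h9 := hK3 T
      have hSj0 : 0 ≤ Sj := Finset.sum_nonneg fun t _ => (W.s_pos (!i) t ω).le
      have h10 := mul_le_mul_of_nonneg_right hkc hSj0
      have h11 := mul_le_mul_of_nonneg_left (h9.trans (add_le_add le_rfl (le_abs_self K3)))
        (show 0 ≤ W.α * c / 2 by positivity)
      nlinarith
    have h12 : ∑ t ∈ Finset.range T, W.a t ≤ Si := Finset.sum_le_sum fun t _ =>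
      W.a_anti (W.N_le i t ω)
    have h13 := mul_le_mul_of_nonneg_left h12 (show 0 ≤ W.α * c / 2 by positivity)
    nlinarith
  have h1 := W.tendsto_sum_a.const_mul_atTop (show 0 < W.α * c / 2 by positivity)
  obtain ⟨T, hT⟩ := (h1.eventually (eventually_gt_atTop
    (W.B + K1 + K4 + K5 + c * K2 + W.α * c / 2 * |K3|))).exists
  linarith [hgrow T]

end Arms

namespace Arms

variable {Ω : Type*} [mΩ : MeasurableSpace Ω] {P : Measure Ω} (W : Arms P)

/-! ### Consistency of the estimates under greedy choices -/

theorem ae_tendsto_A [IsProbabilityMeasure P] :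
    ∀ᵐ ω ∂P, Tendsto (fun t => W.A t ω) atTop (𝓝 0) := by
  filter_upwards [ae_all_iff.2 W.ae_summable_s_sq] with ω h
  have := (W.tendsto_s_zero_of_summable (h true)).add (W.tendsto_s_zero_of_summable (h false))
  rwa [add_zero] at this

/-- The class changes only near a tie. -/
theorem abs_D_le_of_cls_ne
    (hcls : ∀ i t ω, W.cls i t ω = SignType.sign (W.X i t ω - W.X (!i) t ω))
    {i : Bool} {t : ℕ} {ω : Ω} (h : W.cls i (t + 1) ω ≠ W.cls i t ω) :
    |W.D i t ω| ≤ 2 * W.B * W.A t ω := by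
  by_contra hc
  rw [not_le] at hc
  have h1 := abs_le.1 (W.abs_D_sub_le i t 1 ω)
  simp only [Nat.cast_one, mul_one] at h1
  apply h
  rw [hcls, hcls]
  change SignType.sign (W.D i (t + 1) ω) = SignType.sign (W.D i t ω)
  rcases lt_abs.1 hc with h2 | h2
  · have hB := mul_nonneg (mul_nonneg zero_le_two W.B_nonneg) (W.A_pos t ω).le
    rw [sign_pos (by linarith), sign_pos (by linarith)]
  · have hB := mul_nonneg (mul_nonneg zero_le_two W.B_nonneg) (W.A_pos t ω).le
    rw [sign_neg (by linarith), sign_neg (by linarith)]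

open Classical in
/-- The sum of the step sizes at the changes of the class at which one of the arms would have a
large drift is finite. -/
theorem ae_summable_unstable [IsProbabilityMeasure P]
    (hcls : ∀ i t ω, W.cls i t ω = SignType.sign (W.X i t ω - W.X (!i) t ω)) :
    ∀ᵐ ω ∂P, ∀ r : ℝ, 0 < r → Summable fun t =>
      if W.cls true (t + 1) ω ≠ W.cls true t ω ∧ ∃ i, r * W.A t ω ≤ W.drift i t ω
      then W.A t ω else 0 := by
  have h1 : ∀ᵐ ω ∂P, ∀ (i : Bool) (n : ℕ), Summable fun t =>
      (if |W.D i t ω| ≤ 2 * W.B * W.A t ω then (1 : ℝ) else 0)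
        * W.push i (1 / ((n : ℝ) + 1)) t ω :=
    ae_all_iff.2 fun i => ae_all_iff.2 fun n =>
      W.ae_summable_near hcls i Nat.one_div_pos_of_nat
  filter_upwards [h1] with ω h r hr
  obtain ⟨n, hn⟩ := exists_nat_one_div_lt (half_pos hr)
  set ρ : ℝ := 1 / ((n : ℝ) + 1) with hρ
  have hρ0 : 0 < ρ := Nat.one_div_pos_of_nat
  set y : Bool → ℕ → ℝ := fun i t =>
    (if |W.D i t ω| ≤ 2 * W.B * W.A t ω then (1 : ℝ) else 0) * W.push i ρ t ω with hy
  have hys : ∀ i, Summable (y i) := fun i => h i n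
  have hpos : ∀ i t, 0 ≤ y i t := fun i t =>
    mul_nonneg (by split_ifs <;> norm_num) (W.push_nonneg hρ0 i t ω)
  refine Summable.of_nonneg_of_le (fun t => ?_) (fun t => ?_)
    (((hys true).add (hys false)).mul_left ρ⁻¹)
  · split_ifs
    · exact (W.A_pos t ω).le
    · exact le_rfl
  · rw [← div_eq_inv_mul, le_div_iff₀' hρ0]
    by_cases hc : W.cls true (t + 1) ω ≠ W.cls true t ω ∧ ∃ i, r * W.A t ω ≤ W.drift i t ω
    · rw [if_pos hc]
      obtain ⟨hne, i, hi⟩ := hc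
      have hA := W.A_pos t ω
      have hne' : W.cls i (t + 1) ω ≠ W.cls i t ω := by
        cases i
        · intro h2
          have e : ∀ u, W.cls true u ω = -W.cls false u ω := fun u => W.cls_not false u ω
          apply hne; rw [e, e, h2]
        · exact hne
      have hnear := W.abs_D_le_of_cls_ne hcls hne'
      have hpush : W.push i ρ t ω = ρ * W.A t ω := by
        refine min_eq_right (le_trans ?_ (le_max_left _ _))
        nlinarith
      have h2 : y i t = ρ * W.A t ω := by
        simp only [hy]; rw [if_pos hnear, one_mul, hpush]
      rw [← h2]
      cases i
      · exact le_add_of_nonneg_left (hpos true t)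
      · exact le_add_of_nonneg_right (hpos false t)
    · rw [if_neg hc, mul_zero]
      exact add_nonneg (hpos true t) (hpos false t)

/-- Changes of the class are rare if they occur only when one of the arms has a large drift. -/
theorem summable_jump_of_drift {ω : Ω} (i : Bool)
    (h : ∀ r : ℝ, 0 < r → Summable fun t =>
      open Classical in if W.cls true (t + 1) ω ≠ W.cls true t ω ∧ ∃ i, r * W.A t ω ≤ W.drift i t ω
      then W.A t ω else 0) (p : ℕ → Prop) [DecidablePred p] {r : ℝ} (hr : 0 < r)
    (hp : ∀ᶠ t in atTop, W.cls i (t + 1) ω ≠ W.cls i t ω → W.α < 1 / 2 → p t →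
      ∃ l, r * W.A t ω ≤ W.drift l t ω) :
    Summable fun t => if p t then W.jump i t ω else 0 := by
  classical
  refine Summable.of_norm_bounded_eventually_nat (h r hr) ?_
  filter_upwards [hp] with t ht
  have hA := W.A_pos t ω
  have h0 : 0 ≤ if W.cls true (t + 1) ω ≠ W.cls true t ω ∧ ∃ i, r * W.A t ω ≤ W.drift i t ω
      then W.A t ω else 0 := by
    split_ifs
    · exact hA.le
    · exact le_rfl
  by_cases hpt : p t
  swap
  · simp only [if_neg hpt, norm_zero]; exact h0
  rw [if_pos hpt, Real.norm_of_nonneg (W.jump_nonneg i t ω)]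
  by_cases hne : W.cls i (t + 1) ω = W.cls i t ω
  · simp only [jump, chg, if_pos hne, mul_zero]; exact h0
  rcases W.α_le.eq_or_lt with hα | hα
  · have : W.jump i t ω = 0 := by unfold jump; rw [hα]; ring
    rw [this]; exact h0
  have hne' : W.cls true (t + 1) ω ≠ W.cls true t ω := by
    cases i
    · intro h2
      have e : ∀ u, W.cls false u ω = -W.cls true u ω := fun u => W.cls_not true u ω
      apply hne; rw [e, e, h2]
    · exact hne
  rw [if_pos ⟨hne', ht hne hα hpt⟩]
  exact (W.jump_le i t ω).trans (W.s_le_A i t ω)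

theorem eventually_abs_D_le {ω : Ω} (hA : Tendsto (fun t => W.A t ω) atTop (𝓝 0))
    (hcls : ∀ i t ω, W.cls i t ω = SignType.sign (W.X i t ω - W.X (!i) t ω)) (i : Bool) {η : ℝ}
    (hη : 0 < η) : ∀ᶠ t in atTop, W.cls i (t + 1) ω ≠ W.cls i t ω → |W.D i t ω| ≤ η := by
  have h := hA.const_mul (2 * W.B)
  rw [mul_zero] at h
  filter_upwards [h.eventually (gt_mem_nhds hη)] with t ht hne
  exact (W.abs_D_le_of_cls_ne hcls hne).trans ht.le

theorem drift_eq (i t ω) : W.drift i t ω = (1 - W.α) * (W.s i t ω * (W.mean i - W.X i t ω))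
    - W.α * (W.s (!i) t ω * (W.mean (!i) - W.X (!i) t ω)) := rfl

/-- If both arms have the same mean, the estimates converge to it. -/
theorem ae_tendsto_of_mean_eq [IsProbabilityMeasure P]
    (hcls : ∀ i t ω, W.cls i t ω = SignType.sign (W.X i t ω - W.X (!i) t ω))
    (i : Bool) (hm : W.mean (!i) = W.mean i) :
    ∀ᵐ ω ∂P, Tendsto (fun t => W.X i t ω) atTop (𝓝 (W.mean i)) := by
  have hm' : ∀ l, W.mean l ≤ W.mean i := fun l => by
    rcases Bool.eq_or_eq_not l i with rfl | rfl
    · exact le_rfl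
    · exact hm.le
  have hb : ∀ᵐ ω ∂P, ∀ n : ℕ, (Summable fun t => if W.X i t ω < W.mean i - 1 / ((n : ℝ) + 1)
      then W.jump i t ω else 0) →
      Tendsto (fun t => max (W.mean i - 1 / ((n : ℝ) + 1) - W.X i t ω) 0) atTop (𝓝 0) :=
    ae_all_iff.2 fun n => W.ae_below i
      (by linarith [Nat.one_div_pos_of_nat (α := ℝ) (n := n)])
  filter_upwards [W.ae_tendsto_excess hcls hm', W.ae_summable_unstable hcls, W.ae_tendsto_A, hb]
    with ω hex hun hA hb
  rw [tendsto_order]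
  constructor
  · intro c hc
    obtain ⟨n, hn⟩ := exists_nat_one_div_lt (half_pos (sub_pos.2 hc))
    set δ : ℝ := 1 / ((n : ℝ) + 1) with hδ
    have hδ0 : 0 < δ := Nat.one_div_pos_of_nat
    rcases W.α_le.eq_or_lt with hα | hα
    · have h1 := hb n (W.summable_jump_of_drift i hun _ one_pos
        (Eventually.of_forall fun t _ h => absurd h (by rw [hα]; exact lt_irrefl _)))
      filter_upwards [h1.eventually (gt_mem_nhds hδ0)] with t ht
      have := le_max_left (W.mean i - δ - W.X i t ω) 0
      linarith
    · have h1 := hb n (W.summable_jump_of_drift i hun _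
        (r := (1 - 2 * W.α) * δ / 4) (by
          have : 0 < 1 - 2 * W.α := by linarith
          positivity) ?_)
      · filter_upwards [h1.eventually (gt_mem_nhds hδ0)] with t ht
        have := le_max_left (W.mean i - δ - W.X i t ω) 0
        linarith
      · filter_upwards [W.eventually_abs_D_le hA hcls i (half_pos hδ0)] with t ht hne _ hp
        have h2 := abs_le.1 (ht hne)
        unfold D at h2
        have hsi := W.s_pos i t ω
        have hsj := W.s_pos (!i) t ω
        have hAe := W.A_eq i t ω
        -- the two drifts have a positive sum
        have h3 : (1 - 2 * W.α) * δ / 2 * W.A t ω ≤ W.drift i t ω + W.drift (!i) t ω := by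
          rw [W.drift_eq, W.drift_eq, Bool.not_not, hm, hAe]
          have h4 : W.s i t ω * (δ / 2) ≤ W.s i t ω * (W.mean i - W.X i t ω) :=
            mul_le_mul_of_nonneg_left (by linarith) hsi.le
          have h5 : W.s (!i) t ω * (δ / 2) ≤ W.s (!i) t ω * (W.mean i - W.X (!i) t ω) :=
            mul_le_mul_of_nonneg_left (by linarith) hsj.le
          have h6 := mul_le_mul_of_nonneg_left (add_le_add h4 h5)
            (show 0 ≤ 1 - 2 * W.α by linarith)
          linarith
        by_contra hno
        push Not at hno
        linarith [hno i, hno (!i)]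
  · intro c hc
    filter_upwards [(hex i).eventually (gt_mem_nhds (sub_pos.2 hc))] with t ht
    have := le_max_left (W.X i t ω - W.mean i) 0
    linarith

theorem s_ge_of_ratio {i : Bool} {k : ℝ} (hk : 0 < k) {t : ℕ} {ω : Ω}
    (h : k * W.s (!i) t ω < W.s i t ω) : k / (1 + k) * W.A t ω ≤ W.s i t ω := by
  rw [W.A_eq i, div_mul_eq_mul_div, div_le_iff₀ (by linarith)]
  linarith

set_option maxHeartbeats 800000 in
/-- If the mean of arm `i` is the larger one, both estimates converge to the means. -/
theorem ae_tendsto_of_mean_lt [IsProbabilityMeasure P]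
    (hcls : ∀ i t ω, W.cls i t ω = SignType.sign (W.X i t ω - W.X (!i) t ω))
    (i : Bool) (hm : W.mean (!i) < W.mean i) :
    ∀ᵐ ω ∂P, Tendsto (fun t => W.X i t ω) atTop (𝓝 (W.mean i)) ∧
      Tendsto (fun t => W.X (!i) t ω) atTop (𝓝 (W.mean (!i))) := by
  have hm' : ∀ l, W.mean l ≤ W.mean i := fun l => by
    rcases Bool.eq_or_eq_not l i with rfl | rfl
    · exact le_rfl
    · exact hm.le
  have hα := W.α_pos; have hα2 := W.α_le
  have hκ := W.κ_nonneg
  set j := !i with hj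
  have hji : (!j) = i := Bool.not_not i
  set Γ := W.mean i - W.mean j with hΓ
  have hΓ0 : 0 < Γ := sub_pos.2 hm
  -- times when the step size of one arm is less than `k` times that of the other cannot trap it
  obtain ⟨k, hk, hkc⟩ : ∃ k : ℝ, 0 < k ∧ 12 * W.κ * k ≤ W.α ^ 3 * (Γ / 2) := by
    refine ⟨W.α ^ 3 * (Γ / 2) / (12 * W.κ + 1), by positivity, ?_⟩
    rw [mul_div_assoc', div_le_iff₀ (by positivity)]
    have : 0 < W.α ^ 3 * (Γ / 2) := by positivity
    nlinarith
  have hb : ∀ᵐ ω ∂P, ∀ n : ℕ, (Summable fun t => if W.X i t ω < W.mean i - 1 / ((n : ℝ) + 1)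
      then W.jump i t ω else 0) →
      Tendsto (fun t => max (W.mean i - 1 / ((n : ℝ) + 1) - W.X i t ω) 0) atTop (𝓝 0) :=
    ae_all_iff.2 fun n => W.ae_below i
      (by linarith [Nat.one_div_pos_of_nat (α := ℝ) (n := n)])
  filter_upwards [W.ae_tendsto_excess hcls hm', W.ae_summable_unstable hcls, W.ae_tendsto_A, hb,
    W.ae_frequently_of_summable i (σ := 1) abs_one (half_pos hΓ0) hk hkc,
    W.ae_frequently_of_summable j (σ := -1) (by simp) (half_pos hΓ0) hk hkc,
    W.ae_conv_ramp i (l := W.mean j + Γ / 4) (r := W.mean j + Γ / 2) (by linarith)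
      (Or.inl (by linarith)),
    W.ae_conv_ramp j (l := W.mean j + Γ / 2) (r := W.mean j + 3 * Γ / 4) (by linarith)
      (Or.inr (by linarith)),
    W.ae_tendsto_of_summable_jump j]
    with ω hex hun hA hb hfi hfj hri hrj htj
  have hsi := fun t => W.s_pos i t ω
  have hsj := fun t => W.s_pos j t ω
  have hAe : ∀ t, W.A t ω = W.s i t ω + W.s j t ω := fun t => W.A_eq i t ω
  have hdr : ∀ t, W.drift i t ω = (1 - W.α) * (W.s i t ω * (W.mean i - W.X i t ω))
    - W.α * (W.s j t ω * (W.mean j - W.X j t ω)) := fun t => rfl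
  have hclose := fun {η : ℝ} (hη : 0 < η) => W.eventually_abs_D_le hA hcls i hη
  have hclose' : ∀ {η : ℝ}, 0 < η → ∀ᶠ t in atTop, W.cls i (t + 1) ω ≠ W.cls i t ω →
      W.X i t ω - W.X j t ω ≤ η ∧ W.X j t ω - W.X i t ω ≤ η := fun {η} hη => by
    filter_upwards [hclose hη] with t ht hne
    have := abs_le.1 (ht hne)
    unfold D at this
    rw [← hj] at this
    constructor <;> linarith [this.1, this.2]
  have hnej : ∀ t, W.cls j (t + 1) ω ≠ W.cls j t ω → W.cls i (t + 1) ω ≠ W.cls i t ω := by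
    intro t h h2
    apply h
    rw [hj, W.cls_not, W.cls_not, h2]
  -- the estimate of the better arm is not trapped near the mean of the other one
  have hnot_trapped : ∃ᶠ t in atTop, W.mean j + Γ / 2 ≤ W.X i t ω := by
    by_contra hno
    rw [not_frequently] at hno
    set δ : ℝ := k * Γ / 8 with hδ
    have hδ0 : 0 < δ := by positivity
    obtain ⟨r, hr0, hr1, hr2⟩ : ∃ r : ℝ, 0 < r ∧
        (W.α < 1 / 2 → r ≤ (1 - 2 * W.α) * δ / 4) ∧ r ≤ Γ / 8 * (k / (1 + k)) := by
      rcases hα2.eq_or_lt with h | h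
      · exact ⟨Γ / 8 * (k / (1 + k)), by positivity, fun h2 => absurd h2 (by rw [h]; exact lt_irrefl _),
          le_rfl⟩
      · have : 0 < 1 - 2 * W.α := by linarith
        exact ⟨min ((1 - 2 * W.α) * δ / 4) (Γ / 8 * (k / (1 + k))), by positivity,
          fun _ => min_le_left _ _, min_le_right _ _⟩
    have hfr := hfi (W.summable_jump_of_drift i hun _ hr0 ?_)
    · obtain ⟨t, h1, h2⟩ := (hfr.and_eventually hno).exists
      apply h2
      linarith
    · filter_upwards [hclose' (half_pos hδ0), hno] with t ht hx hne hα3 hp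
      obtain ⟨h1, h2⟩ := ht hne
      have hA := (W.A_pos t ω).le
      rcases le_total δ (W.mean j - W.X i t ω) with hQ | hQ
      · -- both pulls are positive, and so is the sum of the two drifts
        have h3 : W.s i t ω * (δ / 2) ≤ W.s i t ω * (W.mean i - W.X i t ω) :=
          mul_le_mul_of_nonneg_left (by linarith) (hsi t).le
        have h4 : W.s j t ω * (δ / 2) ≤ W.s j t ω * (W.mean j - W.X j t ω) :=
          mul_le_mul_of_nonneg_left (by linarith) (hsj t).le
        have h5 : (1 - 2 * W.α) * δ / 2 * W.A t ω ≤ W.drift i t ω + W.drift j t ω := by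
          rw [W.drift_eq j, hdr, hji, hAe]
          have h6 := mul_le_mul_of_nonneg_left (add_le_add h3 h4)
            (show 0 ≤ 1 - 2 * W.α by linarith)
          linarith
        have h6 := mul_le_mul_of_nonneg_right (hr1 hα3) hA
        by_contra hcon
        push Not at hcon
        linarith [hcon i, hcon j]
      · refine ⟨i, ?_⟩
        have h3 := W.s_ge_of_ratio hk hp
        have h4 : W.s i t ω * (Γ / 2) ≤ W.s i t ω * (W.mean i - W.X i t ω) :=
          mul_le_mul_of_nonneg_left (by linarith) (hsi t).le
        have h5 : W.s j t ω * (W.mean j - W.X j t ω) ≤ W.s j t ω * (2 * δ) :=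
          mul_le_mul_of_nonneg_left (by linarith) (hsj t).le
        have h6 : W.s j t ω * (2 * δ) ≤ W.s i t ω * (Γ / 4) := by
          have := mul_le_mul_of_nonneg_left hp.le (show 0 ≤ Γ / 4 by positivity)
          rw [hδ]; linarith
        have h7 : 0 ≤ W.s i t ω * (Γ / 4) := mul_nonneg (hsi t).le (by positivity)
        have h8 := mul_le_mul_of_nonneg_right hr2 hA
        have h9 := mul_le_mul_of_nonneg_left h3 (show 0 ≤ Γ / 8 by positivity)
        rw [hdr]
        nlinarith
  -- above that mean, every change of the class occurs at a large drift of the better arm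
  have habove : ∀ᶠ t in atTop, W.mean j + Γ / 4 < W.X i t ω := by
    refine eventually_lt_of_conv_ramp (by linarith) (hri ?_) hnot_trapped
    refine W.summable_jump_of_drift i hun _ (r := W.α * (Γ / 8)) (by positivity) ?_
    filter_upwards [hclose' (show 0 < Γ / 8 by positivity)] with t ht hne _ hp
    refine ⟨i, ?_⟩
    obtain ⟨h1, h2⟩ := ht hne
    have h3 : W.s i t ω * (Γ / 8) ≤ W.s i t ω * (W.mean i - W.X i t ω) :=
      mul_le_mul_of_nonneg_left (by linarith [hp.2]) (hsi t).le
    have h4 : W.s j t ω * (Γ / 8) ≤ W.s j t ω * (W.X j t ω - W.mean j) :=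
      mul_le_mul_of_nonneg_left (by linarith [hp.1]) (hsj t).le
    have h5 : 0 ≤ W.s i t ω * (Γ / 8) := mul_nonneg (hsi t).le (by positivity)
    rw [hdr, hAe]
    nlinarith
  have hlim_i : Tendsto (fun t => W.X i t ω) atTop (𝓝 (W.mean i)) := by
    rw [tendsto_order]
    constructor
    · intro c hc
      obtain ⟨n, hn⟩ := exists_nat_one_div_lt (half_pos (sub_pos.2 hc))
      set δ : ℝ := 1 / ((n : ℝ) + 1) with hδ
      have hδ0 : 0 < δ := Nat.one_div_pos_of_nat
      have h1 := hb n (W.summable_jump_of_drift i hun _ (r := W.α * min δ (Γ / 8))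
        (mul_pos hα (lt_min hδ0 (by positivity))) ?_)
      · filter_upwards [h1.eventually (gt_mem_nhds hδ0)] with t ht
        have := le_max_left (W.mean i - δ - W.X i t ω) 0
        linarith
      · filter_upwards [hclose' (show 0 < Γ / 8 by positivity), habove] with t ht hx hne _ hp
        refine ⟨i, ?_⟩
        obtain ⟨h1, h2⟩ := ht hne
        set m := min δ (Γ / 8) with hmdef
        have hm0 : 0 < m := lt_min hδ0 (by positivity)
        have hm1 : m ≤ δ := min_le_left _ _
        have hm2 : m ≤ Γ / 8 := min_le_right _ _
        have h3 : W.s i t ω * m ≤ W.s i t ω * (W.mean i - W.X i t ω) :=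
          mul_le_mul_of_nonneg_left (by linarith) (hsi t).le
        have h4 : W.s j t ω * m ≤ W.s j t ω * (W.X j t ω - W.mean j) :=
          mul_le_mul_of_nonneg_left (by linarith) (hsj t).le
        have h5 : 0 ≤ W.s i t ω * m := mul_nonneg (hsi t).le hm0.le
        rw [hdr, hAe]
        nlinarith
    · intro c hc
      filter_upwards [(hex i).eventually (gt_mem_nhds (sub_pos.2 hc))] with t ht
      have := le_max_left (W.X i t ω - W.mean i) 0
      linarith
  refine ⟨hlim_i, ?_⟩
  have hXi : ∀ {η : ℝ}, 0 < η → ∀ᶠ t in atTop, |W.X i t ω - W.mean i| < η := fun {η} hη => by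
    have := (tendsto_iff_norm_sub_tendsto_zero.1 hlim_i).eventually (gt_mem_nhds hη)
    exact this
  -- a change of the class now needs an estimate of the other arm near the larger mean, from which it
  -- is pulled down
  have hdescends : ∃ᶠ t in atTop, W.X j t ω ≤ W.mean j + Γ / 2 := by
    have hδ0 : 0 < min (W.α * k * Γ / 4) (Γ / 4) := by positivity
    have hfr := hfj (W.summable_jump_of_drift j hun _
      (r := W.α * (Γ / 4) * (k / (1 + k))) (by positivity) ?_)
    · refine hfr.mono fun t ht => ?_
      linarith
    · filter_upwards [hclose' (show 0 < Γ / 4 by positivity), hXi hδ0] with t ht hx hne _ hp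
      refine ⟨i, ?_⟩
      obtain ⟨h1, h2⟩ := ht (hnej t hne)
      have h3 := W.s_ge_of_ratio hk hp
      rw [hji] at hp
      have hx' := abs_lt.1 hx
      have h4 := min_le_left (W.α * k * Γ / 4) (Γ / 4)
      have h5 := min_le_right (W.α * k * Γ / 4) (Γ / 4)
      have h6 : W.s j t ω * (Γ / 2) ≤ W.s j t ω * (W.X j t ω - W.mean j) :=
        mul_le_mul_of_nonneg_left (by linarith [hx'.1]) (hsj t).le
      have h7 : -(W.s i t ω * (W.α * k * Γ / 4)) ≤ W.s i t ω * (W.mean i - W.X i t ω) := by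
        rw [← mul_neg]
        exact mul_le_mul_of_nonneg_left (by linarith [hx'.2]) (hsi t).le
      have h8 : W.s i t ω * (W.α * k * Γ / 4) ≤ W.α * (Γ / 4) * W.s j t ω := by
        have := mul_le_mul_of_nonneg_left hp.le (show 0 ≤ W.α * (Γ / 4) by positivity)
        linarith
      have h9 : 0 ≤ W.s i t ω * (W.α * k * Γ / 4) := mul_nonneg (hsi t).le (by positivity)
      have h10 := mul_le_mul_of_nonneg_left h3 (show 0 ≤ W.α * (Γ / 4) by positivity)
      rw [hdr]
      nlinarith
  have hbelow : ∀ᶠ t in atTop, W.X j t ω < W.mean j + 3 * Γ / 4 := by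
    refine eventually_gt_of_conv_ramp (by linarith) (hrj ?_) hdescends
    refine W.summable_jump_of_drift j hun _ one_pos ?_
    filter_upwards [hclose' (show 0 < Γ / 8 by positivity), hXi (show 0 < Γ / 8 by positivity)]
      with t ht hx hne _ hp
    exfalso
    obtain ⟨h1, h2⟩ := ht (hnej t hne)
    have hx' := abs_lt.1 hx
    linarith [hx'.1, hp.2]
  -- eventually the better arm is preferred
  have hjump : Summable fun t => W.jump j t ω := by
    have h1 := W.summable_jump_of_drift j hun (fun _ => True) one_pos ?_
    · simpa using h1
    · filter_upwards [hclose' (show 0 < Γ / 8 by positivity), hXi (show 0 < Γ / 8 by positivity),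
        hbelow] with t ht hx hy hne _ _
      exfalso
      obtain ⟨h1, h2⟩ := ht (hnej t hne)
      have hx' := abs_lt.1 hx
      linarith [hx'.1]
  exact htj hjump

/-- The estimates of the two arms converge to their means, if the preferred arm is the one with the
larger estimate. -/
theorem ae_tendsto_mean [IsProbabilityMeasure P]
    (hcls : ∀ i t ω, W.cls i t ω = SignType.sign (W.X i t ω - W.X (!i) t ω)) :
    ∀ᵐ ω ∂P, ∀ i, Tendsto (fun t => W.X i t ω) atTop (𝓝 (W.mean i)) := by
  rcases lt_trichotomy (W.mean false) (W.mean true) with h | h | h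
  · filter_upwards [W.ae_tendsto_of_mean_lt hcls true h] with ω hω i
    cases i
    · exact hω.2
    · exact hω.1
  · filter_upwards [W.ae_tendsto_of_mean_eq hcls true h, W.ae_tendsto_of_mean_eq hcls false h.symm]
      with ω h1 h2 i
    cases i
    · exact h2
    · exact h1
  · filter_upwards [W.ae_tendsto_of_mean_lt hcls false h] with ω hω i
    cases i
    · exact hω.1
    · exact hω.2

end Arms

/-! ### Uniformly ergodic kernels mix geometrically -/

/-- Measures that are uniformly close on sets are close on bounded functions. -/
theorem abs_integral_sub_le_of_sets {E : Type*} [MeasurableSpace E] {μ ν : Measure E}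
    [IsFiniteMeasure μ] [IsFiniteMeasure ν] {δ M : ℝ} (hM : 0 ≤ M)
    (h : ∀ B, MeasurableSet B → |μ.real B - ν.real B| ≤ δ) {f : E → ℝ} (hf : Measurable f)
    (h0 : ∀ x, 0 ≤ f x) (h1 : ∀ x, f x ≤ M) : |∫ x, f x ∂μ - ∫ x, f x ∂ν| ≤ δ * M := by
  have hb : ∀ x, |f x| ≤ M := fun x => by rw [abs_of_nonneg (h0 x)]; exact h1 x
  have key : ∀ (ρ : Measure E) [IsFiniteMeasure ρ],
      ∫ x, f x ∂ρ = ∫ t in Set.Ioc 0 M, ρ.real {a | t ≤ f a} := fun ρ _ =>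
    (integrable_of_abs_le hf hb).integral_eq_integral_Ioc_meas_le (ae_of_all _ h0) (ae_of_all _ h1)
  have hint : ∀ (ρ : Measure E) [IsFiniteMeasure ρ],
      IntegrableOn (fun t => ρ.real {a | t ≤ f a}) (Set.Ioc 0 M) := fun ρ _ => by
    refine Measure.integrableOn_of_bounded (M := ρ.real Set.univ) measure_Ioc_lt_top.ne ?_ ?_
    · have : Antitone fun t => ρ.real {a | t ≤ f a} := fun s t hst =>
        measureReal_mono fun a (ha : t ≤ f a) => hst.trans ha
      exact this.measurable.aestronglyMeasurable
    · refine ae_of_all _ fun t => ?_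
      rw [Real.norm_of_nonneg measureReal_nonneg]
      exact measureReal_mono (Set.subset_univ _)
  rw [key μ, key ν, ← integral_sub (hint μ) (hint ν)]
  refine (norm_setIntegral_le_of_norm_le_const (μ := volume) (s := Set.Ioc 0 M)
    (f := fun t => μ.real {a | t ≤ f a} - ν.real {a | t ≤ f a}) (C := δ)
    measure_Ioc_lt_top fun t _ => ?_).trans ?_
  · exact h _ (hf measurableSet_Ici)
  · simp [hM]

section Mixing

variable {E : Type*} [MeasurableSpace E] (κ : Kernel E E) [IsMarkovKernel κ]

instance isMarkovKernel_pow (m : ℕ) : IsMarkovKernel (κ ^ m) := by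
  induction m with
  | zero => rw [pow_zero]; exact inferInstanceAs (IsMarkovKernel Kernel.id)
  | succ m ih => rw [pow_succ]; exact inferInstanceAs (IsMarkovKernel ((κ ^ m) ∘ₖ κ))

theorem measurable_kernel_real (η : Kernel E E) {B : Set E} (hB : MeasurableSet B) :
    Measurable fun x => (η x).real B := (η.measurable_coe hB).ennreal_toReal

theorem kernel_pow_add_real (m k : ℕ) (x : E) {B : Set E} (hB : MeasurableSet B) :
    ((κ ^ (m + k)) x).real B = ∫ z, ((κ ^ m) z).real B ∂((κ ^ k) x) := by
  rw [add_comm, measureReal_def, Kernel.pow_add_apply_eq_lintegral κ k m x hB]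
  exact (integral_toReal ((κ ^ m).measurable_coe hB).aemeasurable
    (ae_of_all _ fun z => measure_lt_top _ _)).symm

/-- The `m`-step transition probabilities differ by at most `δ`. -/
def Oscillates (m : ℕ) (δ : ℝ) : Prop :=
  ∀ x y B, MeasurableSet B → |((κ ^ m) x).real B - ((κ ^ m) y).real B| ≤ δ

variable {κ}

/-- The oscillation is submultiplicative, up to a factor `2`. -/
theorem Oscillates.add {m k : ℕ} {δ ε : ℝ} (h1 : Oscillates κ m δ) (h2 : Oscillates κ k ε) :
    Oscillates κ (m + k) (ε * (2 * δ)) := by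
  intro x y B hB
  have hδ : 0 ≤ δ := (abs_nonneg _).trans (h1 x y B hB)
  set f : E → ℝ := fun z => ((κ ^ m) z).real B - ((κ ^ m) x).real B + δ with hf
  have hfm : Measurable f := ((measurable_kernel_real (κ ^ m) hB).sub_const _).add_const _
  have hi : ∀ w, ∫ z, f z ∂((κ ^ k) w) = ((κ ^ (m + k)) w).real B - ((κ ^ m) x).real B + δ := by
    intro w
    have hi1 : Integrable (fun z => ((κ ^ m) z).real B) ((κ ^ k) w) :=
      integrable_of_abs_le (K := 1) (measurable_kernel_real (κ ^ m) hB) fun z => by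
        rw [abs_of_nonneg measureReal_nonneg]; exact measureReal_le_one
    have e : f = fun z => ((κ ^ m) z).real B + (δ - ((κ ^ m) x).real B) := by
      funext z; simp only [hf]; ring
    rw [e, integral_add hi1 (integrable_const _), kernel_pow_add_real κ m k w hB]
    simp; ring
  have h3 := abs_integral_sub_le_of_sets (M := 2 * δ) (by linarith)
    (fun B hB => h2 x y B hB) hfm
    (fun z => by have := neg_le_of_abs_le (h1 z x B hB); simp only [hf]; linarith)
    (fun z => by have := le_of_abs_le (h1 z x B hB); simp only [hf]; linarith)
  rw [hi, hi] at h3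
  have e : ((κ ^ (m + k)) x).real B - ((κ ^ m) x).real B + δ
      - (((κ ^ (m + k)) y).real B - ((κ ^ m) x).real B + δ)
      = ((κ ^ (m + k)) x).real B - ((κ ^ (m + k)) y).real B := by ring
  rwa [e] at h3

theorem summable_half_pow_div {N : ℕ} (hN : 0 < N) : Summable fun m : ℕ => (1 / 2 : ℝ) ^ (m / N) := by
  have hN' : (0 : ℝ) < N := by exact_mod_cast hN
  set r : ℝ := (1 / 2 : ℝ) ^ (1 / (N : ℝ)) with hr
  have hr0 : 0 ≤ r := by positivity
  have hrN : r ^ N = 1 / 2 := by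
    rw [hr, ← Real.rpow_natCast, ← Real.rpow_mul (by norm_num), one_div_mul_cancel hN'.ne',
      Real.rpow_one]
  have hr1 : r < 1 := Real.rpow_lt_one (by norm_num) (by norm_num) (by positivity)
  refine Summable.of_nonneg_of_le (fun m => by positivity) (fun m => ?_)
    ((summable_geometric_of_lt_one hr0 hr1).mul_left 2)
  have h1 : r ^ (N * (m / N) + N) ≤ r ^ m :=
    pow_le_pow_of_le_one hr0 hr1.le (by
      have := Nat.div_add_mod m N; have := Nat.mod_lt m hN; omega)
  rw [pow_add, pow_mul, hrN] at h1
  linarith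

/-- The rate of convergence of a uniformly ergodic kernel is geometric; in particular summable. -/
theorem exists_mixing_rate {π : Measure E} [IsProbabilityMeasure π]
    (h : UniformlyErgodic κ π) : ∃ γ : ℕ → ℝ, (∀ m, 0 ≤ γ m) ∧ Antitone γ ∧ Summable γ ∧
      ∀ m x B, MeasurableSet B → |((κ ^ m) x).real B - π.real B| ≤ γ m := by
  obtain ⟨N0, hN0⟩ := h (1 / 8) (by norm_num)
  set N := N0 + 1 with hN
  -- with oscillation at most `1 / 4` in `N` steps, every further `N` steps halve the oscillation
  have hosc : Oscillates κ N (1 / 4) := fun x y B hB => by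
    have h1 := abs_le.1 (hN0 N (Nat.le_succ _) x B hB)
    have h2 := abs_le.1 (hN0 N (Nat.le_succ _) y B hB)
    rw [abs_le]
    constructor <;> linarith [h1.1, h1.2, h2.1, h2.2]
  have hosc1 : ∀ m, Oscillates κ m 1 := fun m x y B _ => by
    have h1 : ((κ ^ m) x).real B ≤ 1 := measureReal_le_one
    have h2 : ((κ ^ m) y).real B ≤ 1 := measureReal_le_one
    have h3 : 0 ≤ ((κ ^ m) x).real B := measureReal_nonneg
    have h4 : 0 ≤ ((κ ^ m) y).real B := measureReal_nonneg
    rw [abs_le]; constructor <;> linarith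
  have hall : ∀ m, Oscillates κ m ((1 / 2) ^ (m / N)) := by
    intro m
    induction m using Nat.strong_induction_on with
    | _ m ih =>
      rcases lt_or_ge m N with hm | hm
      · rw [Nat.div_eq_of_lt hm, pow_zero]; exact hosc1 m
      · have h1 := (ih (m - N) (by omega)).add hosc
        rw [Nat.sub_add_cancel hm] at h1
        have h2 : m / N = (m - N) / N + 1 := Nat.div_eq_sub_div (by omega) hm
        rw [h2, pow_succ]
        intro x y B hB
        exact (h1 x y B hB).trans (le_of_eq (by ring))
  refine ⟨fun m => (1 / 2) ^ (m / N), fun m => by positivity, fun m k hmk =>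
    pow_le_pow_of_le_one (by norm_num) (by norm_num) (Nat.div_le_div_right hmk),
    summable_half_pow_div (by omega), fun m x B hB => ?_⟩
  refine le_of_forall_pos_le_add fun δ hδ => ?_
  obtain ⟨K, hK⟩ := h δ hδ
  have h1 := hK (m + K) (Nat.le_add_left _ _) x B hB
  -- compare with the chain that starts `K` steps earlier
  have h2 : |((κ ^ (m + K)) x).real B - ((κ ^ m) x).real B| ≤ (1 / 2) ^ (m / N) := by
    rw [kernel_pow_add_real κ m K x hB]
    have hi1 : Integrable (fun z => ((κ ^ m) z).real B) ((κ ^ K) x) :=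
      integrable_of_abs_le (K := 1) (measurable_kernel_real (κ ^ m) hB) fun z => by
        rw [abs_of_nonneg measureReal_nonneg]; exact measureReal_le_one
    have e : ∫ z, ((κ ^ m) z).real B ∂((κ ^ K) x) - ((κ ^ m) x).real B
        = ∫ z, (((κ ^ m) z).real B - ((κ ^ m) x).real B) ∂((κ ^ K) x) := by
      rw [integral_sub hi1 (integrable_const _)]; simp
    rw [e]
    refine (norm_integral_le_of_norm_le_const
      (f := fun z => ((κ ^ m) z).real B - ((κ ^ m) x).real B) (C := (1 / 2) ^ (m / N))
      (ae_of_all _ fun z => hall m z x B hB)).trans ?_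
    simp
  have h3 := abs_sub_le (((κ ^ m) x).real B) (((κ ^ (m + K)) x).real B) (π.real B)
  rw [abs_sub_comm] at h2
  linarith

end Mixing

/-! ### The fading gains, given the past -/

section Conditioning

variable {Ω : Type*} {m m₁ : MeasurableSpace Ω} [mΩ : MeasurableSpace Ω] {P : Measure Ω}

theorem sup_eq_generateFrom_inter {Ω : Type*} (m₁ m₂ : MeasurableSpace Ω) :
    m₁ ⊔ m₂ = MeasurableSpace.generateFrom
      {s | ∃ A B, MeasurableSet[m₁] A ∧ MeasurableSet[m₂] B ∧ s = A ∩ B} := by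
  refine le_antisymm (sup_le (fun A hA => ?_) fun B hB => ?_)
    (MeasurableSpace.generateFrom_le ?_)
  · exact MeasurableSpace.measurableSet_generateFrom
      ⟨A, Set.univ, hA, MeasurableSet.univ, by simp⟩
  · exact MeasurableSpace.measurableSet_generateFrom
      ⟨Set.univ, B, MeasurableSet.univ, hB, by simp⟩
  · rintro _ ⟨A, B, hA, hB, rfl⟩
    exact MeasurableSet.inter ((le_sup_left : m₁ ≤ m₁ ⊔ m₂) _ hA)
      ((le_sup_right : m₂ ≤ m₁ ⊔ m₂) _ hB)

theorem isPiSystem_inter {Ω : Type*} (m₁ m₂ : MeasurableSpace Ω) :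
    IsPiSystem {s | ∃ A B, MeasurableSet[m₁] A ∧ MeasurableSet[m₂] B ∧ s = A ∩ B} := by
  rintro _ ⟨A, B, hA, hB, rfl⟩ _ ⟨A', B', hA', hB', rfl⟩ _
  exact ⟨A ∩ A', B ∩ B', MeasurableSet.inter hA hA', MeasurableSet.inter hB hB',
    Set.inter_inter_inter_comm _ _ _ _⟩

/-- Independence of three σ-algebras, regrouped. -/
theorem indep_sup_right [IsProbabilityMeasure P] {m₂ m₃ : MeasurableSpace Ω} (h₁ : m₁ ≤ mΩ)
    (h₂ : m₂ ≤ mΩ) (h₃ : m₃ ≤ mΩ) (h₁₂ : Indep m₁ m₂ P) (h : Indep (m₁ ⊔ m₂) m₃ P) :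
    Indep m₁ (m₂ ⊔ m₃) P := by
  refine IndepSets.indep h₁ (sup_le h₂ h₃) (@MeasurableSpace.isPiSystem_measurableSet Ω m₁)
    (isPiSystem_inter m₂ m₃) (@MeasurableSpace.generateFrom_measurableSet Ω m₁).symm
    (sup_eq_generateFrom_inter m₂ m₃) ?_
  rw [IndepSets_iff]
  rintro A _ hA ⟨B, C, hB, hC, rfl⟩
  have hA' : MeasurableSet[m₁ ⊔ m₂] A := (le_sup_left : m₁ ≤ m₁ ⊔ m₂) _ hA
  have hB' : MeasurableSet[m₁ ⊔ m₂] B := (le_sup_right : m₂ ≤ m₁ ⊔ m₂) _ hB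
  rw [Indep_iff] at h₁₂ h
  rw [← Set.inter_assoc, h _ C (hA'.inter hB') hC, h₁₂ A B hA hB, h B C hB' hC, mul_assoc]

/-- An identity of integrals over the sets of a σ-algebra extends to additional independent
information. -/
theorem setIntegral_eq_zero_of_indep [IsProbabilityMeasure P] {m₂ m₃ : MeasurableSpace Ω}
    (h₁ : m₁ ≤ mΩ) (h₂₃ : m₂ ≤ m₃) (h₃ : m₃ ≤ mΩ) (hind : Indep m₁ m₃ P) {f : Ω → ℝ}
    (hf : BddMeas m₃ f) (h0 : ∀ S, MeasurableSet[m₂] S → ∫ ω in S, f ω ∂P = 0) :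
    ∀ S, MeasurableSet[m₁ ⊔ m₂] S → ∫ ω in S, f ω ∂P = 0 := by
  have hle : m₁ ⊔ m₂ ≤ mΩ := sup_le h₁ (h₂₃.trans h₃)
  have hfi : Integrable f P := (hf.mono h₃).integrable
  have htot : ∫ ω, f ω ∂P = 0 := by
    have := h0 Set.univ MeasurableSet.univ
    rwa [setIntegral_univ] at this
  intro S hS
  induction S, hS using MeasurableSpace.induction_on_inter
    (sup_eq_generateFrom_inter m₁ m₂) (isPiSystem_inter m₁ m₂) with
  | empty => simp
  | basic t ht =>
    obtain ⟨A, B, hA, hB, rfl⟩ := ht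
    have hB' : MeasurableSet[m₃] B := h₂₃ _ hB
    have e : ∀ ω, (A ∩ B).indicator f ω
        = A.indicator (fun _ => (1 : ℝ)) ω * B.indicator f ω := fun ω => by
      by_cases h1 : ω ∈ A <;> by_cases h2 : ω ∈ B <;> simp [h1, h2]
    rw [← integral_indicator ((h₁ _ hA).inter (h₃ _ hB'))]
    simp_rw [e]
    rw [integral_mul_of_indep h₁ h₃ hind (measurable_const.indicator hA) (hf.1.indicator hB'),
      integral_indicator (h₃ _ hB'), h0 B hB, mul_zero]
  | compl t ht ih =>
    have := integral_add_compl (hle _ ht) hfi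
    rw [ih, htot, zero_add] at this
    exact this
  | iUnion g hd hg ih =>
    rw [integral_iUnion (fun i => hle _ (hg i)) hd hfi.integrableOn]
    simp [ih]

/-- A bound of the conditional expectation from bounds of the integrals over sets. -/
theorem ae_abs_condExp_sub_le [IsProbabilityMeasure P] {m : MeasurableSpace Ω} (hm : m ≤ mΩ)
    {f : Ω → ℝ} (hf : Integrable f P) {c β : ℝ}
    (h : ∀ S, MeasurableSet[m] S → |∫ ω in S, f ω ∂P - c * P.real S| ≤ β * P.real S) :
    ∀ᵐ ω ∂P, |(P[f | m]) ω - c| ≤ β := by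
  have hsm : StronglyMeasurable[m] (P[f | m]) := stronglyMeasurable_condExp
  have hi : Integrable (P[f | m]) (P.trim hm) := integrable_condExp.trim hm hsm
  have hS : ∀ S, MeasurableSet[m] S → ∫ ω in S, (P[f | m]) ω ∂(P.trim hm) = ∫ ω in S, f ω ∂P :=
    fun S hS => by rw [← setIntegral_trim hm hsm hS, setIntegral_condExp hm hf hS]
  have hc : ∀ (d : ℝ) S, MeasurableSet[m] S → ∫ _ in S, d ∂(P.trim hm) = d * P.real S :=
    fun d S hS => by
      rw [setIntegral_const, smul_eq_mul, mul_comm, measureReal_def, trim_measurableSet_eq hm hS]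
      rfl
  have h1 : P[f | m] ≤ᵐ[P.trim hm] fun _ => c + β :=
    ae_le_of_forall_setIntegral_le hi (integrable_const _) fun S hmS _ => by
      rw [hS S hmS, hc _ S hmS]; linarith [le_of_abs_le (h S hmS)]
  have h2 : (fun _ => c - β) ≤ᵐ[P.trim hm] P[f | m] :=
    ae_le_of_forall_setIntegral_le (integrable_const _) hi fun S hmS _ => by
      rw [hS S hmS, hc _ S hmS]; linarith [neg_le_of_abs_le (h S hmS)]
  filter_upwards [ae_le_of_ae_le_trim h1, ae_le_of_ae_le_trim h2] with ω h3 h4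
  rw [abs_le]; constructor <;> linarith

variable {E : Type*} [mE : MeasurableSpace E] {κ : Kernel E E} [IsMarkovKernel κ] {G : ℕ → Ω → E}

/-- The Markov property, for the laws on events of the past, with independent randomizations. -/
theorem map_restrict_succ [IsProbabilityMeasure P] (hG : ∀ τ, Measurable (G τ))
    (hmk : ∀ τ (B : Set E), MeasurableSet B →
      P[(G (τ + 1) ⁻¹' B).indicator (fun _ => (1 : ℝ)) |
        ⨆ i : Fin (τ + 1), MeasurableSpace.comap (G i) mE] =ᵐ[P] fun ω => (κ (G τ ω)).real B)
    (h₁ : m₁ ≤ mΩ) (hind : Indep m₁ (⨆ τ, MeasurableSpace.comap (G τ) mE) P) (τ : ℕ) (S : Set Ω)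
    (hS : MeasurableSet[m₁ ⊔ ⨆ i : Fin (τ + 1), MeasurableSpace.comap (G i) mE] S) :
    (P.restrict S).map (G (τ + 1)) = κ ∘ₘ ((P.restrict S).map (G τ)) := by
  have h3 : ⨆ τ, MeasurableSpace.comap (G τ) mE ≤ mΩ := iSup_le fun τ => (hG τ).comap_le
  have h23 : ⨆ i : Fin (τ + 1), MeasurableSpace.comap (G i) mE
      ≤ ⨆ τ, MeasurableSpace.comap (G τ) mE :=
    iSup_le fun i => le_iSup (fun τ => MeasurableSpace.comap (G τ) mE) (i : ℕ)
  have hGm : ∀ τ, Measurable[⨆ τ, MeasurableSpace.comap (G τ) mE] (G τ) := fun τ =>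
    (comap_measurable (G τ)).mono (le_iSup (fun τ => MeasurableSpace.comap (G τ) mE) τ) le_rfl
  refine Measure.ext fun B hB => ?_
  have hf1 : BddMeas (⨆ τ, MeasurableSpace.comap (G τ) mE)
      ((G (τ + 1) ⁻¹' B).indicator (fun _ => (1 : ℝ))) :=
    ⟨measurable_const.indicator (hGm (τ + 1) hB), 1, fun ω => by
      unfold Set.indicator; split_ifs <;> simp⟩
  have hf2 : BddMeas (⨆ τ, MeasurableSpace.comap (G τ) mE) (fun ω => (κ (G τ ω)).real B) :=
    ⟨(measurable_kernel_real κ hB).comp (hGm τ), 1, fun ω => by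
      rw [abs_of_nonneg measureReal_nonneg]; exact measureReal_le_one⟩
  have hi1 := (hf1.mono h3).integrable (P := P)
  have hi2 := (hf2.mono h3).integrable (P := P)
  have h0 := setIntegral_eq_zero_of_indep h₁ h23 h3 hind (hf1.sub hf2) (fun S hS => by
    rw [integral_sub hi1.integrableOn hi2.integrableOn, sub_eq_zero,
      ← setIntegral_condExp (h23.trans h3) hi1 hS]
    refine setIntegral_congr_ae ((h23.trans h3) _ hS) ?_
    filter_upwards [hmk τ B hB] with ω hω _ using hω) S hS
  rw [integral_sub hi1.integrableOn hi2.integrableOn, sub_eq_zero] at h0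
  rw [Measure.map_apply (hG _) hB, Measure.bind_apply hB κ.measurable.aemeasurable,
    lintegral_map (κ.measurable_coe hB) (hG τ)]
  have e1 : ∫ ω in S, (G (τ + 1) ⁻¹' B).indicator (fun _ => (1 : ℝ)) ω ∂P
      = (P.restrict S).real (G (τ + 1) ⁻¹' B) := by
    rw [integral_indicator (hG _ hB)]; simp
  have e2 : ∫ ω in S, (κ (G τ ω)).real B ∂P = (∫⁻ ω in S, κ (G τ ω) B ∂P).toReal :=
    integral_toReal ((κ.measurable_coe hB).comp (hG τ)).aemeasurable
      (ae_of_all _ fun ω => measure_lt_top _ _)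
  rw [e1, e2, measureReal_def] at h0
  refine (ENNReal.toReal_eq_toReal_iff' (measure_ne_top _ _) ?_).1 h0
  refine ne_of_lt (lt_of_le_of_lt (lintegral_mono fun ω => prob_le_one) ?_)
  simp [measure_lt_top]

theorem map_restrict_add [IsProbabilityMeasure P] (hG : ∀ τ, Measurable (G τ))
    (hmk : ∀ τ (B : Set E), MeasurableSet B →
      P[(G (τ + 1) ⁻¹' B).indicator (fun _ => (1 : ℝ)) |
        ⨆ i : Fin (τ + 1), MeasurableSpace.comap (G i) mE] =ᵐ[P] fun ω => (κ (G τ ω)).real B)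
    (h₁ : m₁ ≤ mΩ) (hind : Indep m₁ (⨆ τ, MeasurableSpace.comap (G τ) mE) P) (τ : ℕ) (S : Set Ω)
    (hS : MeasurableSet[m₁ ⊔ ⨆ i : Fin (τ + 1), MeasurableSpace.comap (G i) mE] S) (m : ℕ) :
    (P.restrict S).map (G (τ + m)) = (κ ^ m) ∘ₘ ((P.restrict S).map (G τ)) := by
  induction m with
  | zero =>
    rw [pow_zero]
    exact (Measure.id_comp (μ := (P.restrict S).map (G τ))).symm
  | succ m ih =>
    have hle : m₁ ⊔ ⨆ i : Fin (τ + 1), MeasurableSpace.comap (G i) mE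
        ≤ m₁ ⊔ ⨆ i : Fin (τ + m + 1), MeasurableSpace.comap (G i) mE :=
      sup_le_sup le_rfl (iSup_le fun i => le_iSup_of_le
        (⟨i, by omega⟩ : Fin (τ + m + 1)) le_rfl)
    rw [← add_assoc, map_restrict_succ hG hmk h₁ hind (τ + m) S (hle _ hS), ih, Measure.comp_assoc,
      pow_succ']
    rfl

/-- Given the past and the randomizations, a function of a later fading gain has nearly its
stationary mean. -/
theorem ae_abs_condExp_gain_sub_le [IsProbabilityMeasure P] (hG : ∀ τ, Measurable (G τ))
    (hmk : ∀ τ (B : Set E), MeasurableSet B →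
      P[(G (τ + 1) ⁻¹' B).indicator (fun _ => (1 : ℝ)) |
        ⨆ i : Fin (τ + 1), MeasurableSpace.comap (G i) mE] =ᵐ[P] fun ω => (κ (G τ ω)).real B)
    (h₁ : m₁ ≤ mΩ) (hind : Indep m₁ (⨆ τ, MeasurableSpace.comap (G τ) mE) P)
    {π : Measure E} [IsProbabilityMeasure π] {γ : ℕ → ℝ} (hγa : Antitone γ)
    (hγ : ∀ m x B, MeasurableSet B → |((κ ^ m) x).real B - π.real B| ≤ γ m)
    {h : E → ℝ} (hh : Measurable h) {C : ℝ} (h0 : ∀ x, 0 ≤ h x) (hC : ∀ x, h x ≤ C)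
    (n τ : ℕ) (hnτ : n ≤ τ)
    (hm : m ≤ m₁ ⊔ ⨆ i : Fin n, MeasurableSpace.comap (G i) mE) :
    ∀ᵐ ω ∂P, |(P[fun ω => h (G τ ω) | m]) ω - ∫ x, h x ∂π| ≤ γ (τ - n) * C := by
  have hle : m ≤ m₁ ⊔ ⨆ i : Fin (n - 1 + 1), MeasurableSpace.comap (G i) mE :=
    hm.trans (sup_le_sup le_rfl (iSup_le fun i => le_iSup_of_le
      (⟨i, by omega⟩ : Fin (n - 1 + 1)) le_rfl))
  have hmΩ : m ≤ mΩ := hle.trans (sup_le h₁ (iSup_le fun i => (hG i).comap_le))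
  have hb : ∀ x, |h x| ≤ C := fun x => by rw [abs_of_nonneg (h0 x)]; exact hC x
  refine ae_abs_condExp_sub_le hmΩ
    (integrable_of_abs_le (K := C) (hh.comp (hG τ)) fun ω => hb _) fun S hS => ?_
  have hS' : MeasurableSet[mΩ] S := hmΩ _ hS
  have h1 := map_restrict_add hG hmk h₁ hind (n - 1) S (hle _ hS) (τ - (n - 1))
  rw [show n - 1 + (τ - (n - 1)) = τ by omega] at h1
  set p := P.real S with hp
  have hp0 : 0 ≤ p := measureReal_nonneg
  set ν := (P.restrict S).map (G τ) with hν
  have h2 : ∀ B, MeasurableSet B → |ν.real B - ((P S) • π).real B| ≤ γ (τ - n) * p := by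
    intro B hB
    have e1 : ν.real B = ∫ ω in S, ((κ ^ (τ - (n - 1))) (G (n - 1) ω)).real B ∂P := by
      rw [h1, measureReal_def, Measure.bind_apply hB (Kernel.measurable _).aemeasurable,
        lintegral_map (Kernel.measurable_coe _ hB) (hG _)]
      exact (integral_toReal (((κ ^ (τ - (n - 1))).measurable_coe hB).comp (hG _)).aemeasurable
        (ae_of_all _ fun ω => measure_lt_top _ _)).symm
    have e2 : ((P S) • π).real B = ∫ _ in S, π.real B ∂P := by
      rw [setIntegral_const, smul_eq_mul, measureReal_def, Measure.smul_apply, smul_eq_mul,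
        ENNReal.toReal_mul]
      rfl
    have hi : Integrable (fun ω => ((κ ^ (τ - (n - 1))) (G (n - 1) ω)).real B) (P.restrict S) :=
      integrable_of_abs_le (K := 1) ((measurable_kernel_real _ hB).comp (hG _)) fun ω => by
        rw [abs_of_nonneg measureReal_nonneg]; exact measureReal_le_one
    rw [e1, e2, ← integral_sub hi (integrable_const _)]
    refine (norm_setIntegral_le_of_norm_le_const
      (f := fun ω => ((κ ^ (τ - (n - 1))) (G (n - 1) ω)).real B - π.real B) (C := γ (τ - n))
      (measure_lt_top _ _) fun ω _ => ?_)
    exact (hγ _ _ B hB).trans (hγa (by omega))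
  have hfin : IsFiniteMeasure ((P S) • π) := Measure.smul_finite _ (measure_ne_top _ _)
  have hC0 : 0 ≤ C := by
    obtain ⟨ω⟩ := nonempty_of_isProbabilityMeasure P
    exact (h0 (G 0 ω)).trans (hC _)
  have h3 := abs_integral_sub_le_of_sets (μ := ν) (ν := (P S) • π) hC0 h2 hh h0 hC
  rw [hν, integral_map (hG τ).aemeasurable hh.aestronglyMeasurable, integral_smul_measure] at h3
  rw [show γ (τ - n) * C * p = γ (τ - n) * p * C by ring, mul_comm (∫ x, h x ∂π)]
  exact h3

end Conditioning

namespace Cell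

variable {n : ℕ} {L : Type*} (M : Cell n L)

/-! ### The state chain forgets its initial state -/

/-- The users who stay, one slot later. -/
def age (s : State n) : State n := (s.filter (fun u => 1 < u.2)).map (fun u => (u.1, u.2 - 1))

/-- The users who enter. -/
def entering (b : Fin n → ℕ) : State n := ∑ k, Multiset.replicate (b k) (k, M.len k)

theorem next_eq (s : State n) (b : Fin n → ℕ) : M.next s b = age s + M.entering b := rfl

theorem age_add (s s' : State n) : age (s + s') = age s + age s' := by
  simp [age, Multiset.filter_add]

theorem next_add (s s' : State n) (b : Fin n → ℕ) : M.next (s + s') b = age s + M.next s' b := by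
  rw [next_eq, next_eq, age_add, add_assoc]

theorem isState_zero : M.IsState 0 := fun u hu => absurd hu (Multiset.notMem_zero u)

theorem mem_age {s : State n} {u : Fin n × ℕ} (h : u ∈ age s) :
    ∃ v ∈ s, 1 < v.2 ∧ u = (v.1, v.2 - 1) := by
  simp only [age, Multiset.mem_map, Multiset.mem_filter] at h
  obtain ⟨v, ⟨hv, h1⟩, rfl⟩ := h
  exact ⟨v, hv, h1, rfl⟩

theorem isState_next {s : State n} (hs : M.IsState s) (b : Fin n → ℕ) : M.IsState (M.next s b) := by
  intro u hu
  rw [next_eq, Multiset.mem_add] at hu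
  rcases hu with hu | hu
  · obtain ⟨v, hv, h1, rfl⟩ := mem_age hu
    have := hs v hv
    simp only
    omega
  · rw [entering, Multiset.mem_sum] at hu
    obtain ⟨k, -, hk⟩ := hu
    rw [Multiset.eq_of_mem_replicate hk]
    exact ⟨M.len_pos k, le_rfl⟩

/-- After this number of slots, all users who were in the cell have left. -/
def horizon : ℕ := 1 + ∑ k, M.len k

theorem horizon_pos : 0 < M.horizon := by unfold horizon; omega

theorem len_le_horizon (k : Fin n) : M.len k ≤ M.horizon := by
  have := Finset.single_le_sum (f := M.len) (fun k _ => Nat.zero_le _) (Finset.mem_univ k)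
  unfold horizon; omega

theorem iterate_age_eq_zero (k : ℕ) : ∀ {s : State n}, (∀ u ∈ s, 1 ≤ u.2 ∧ u.2 ≤ k) →
    age^[k] s = 0 := by
  induction k with
  | zero =>
    intro s h
    refine Multiset.eq_zero_of_forall_notMem fun u hu => ?_
    have := h u hu
    omega
  | succ k ih =>
    intro s h
    rw [Function.iterate_succ_apply]
    refine ih fun u hu => ?_
    obtain ⟨v, hv, h1, rfl⟩ := mem_age hu
    have := h v hv
    simp only
    omega

theorem iterate_age_of_isState {s : State n} (hs : M.IsState s) {τ : ℕ} (hτ : M.horizon ≤ τ) :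
    age^[τ] s = 0 :=
  iterate_age_eq_zero τ fun u hu =>
    ⟨(hs u hu).1, ((hs u hu).2.trans (M.len_le_horizon u.1)).trans hτ⟩

/-! #### Laws -/

/-- Law of the next state. -/
def trans (s : State n) : PMF (State n) := M.arrivalLaw.map (M.next s)

theorem stateLaw_succ (s : State n) (τ : ℕ) :
    M.stateLaw s (τ + 1) = (M.stateLaw s τ).bind M.trans := rfl

theorem stateLaw_succ' (s : State n) (τ : ℕ) :
    M.stateLaw s (τ + 1) = (M.trans s).bind fun s' => M.stateLaw s' τ := by
  induction τ with
  | zero =>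
    rw [stateLaw_succ]
    simp only [stateLaw, PMF.pure_bind]
    exact (PMF.bind_pure _).symm
  | succ τ ih =>
    rw [stateLaw_succ, ih, PMF.bind_bind]
    rfl

theorem stateLaw_eq_map (s : State n) (τ : ℕ) :
    M.stateLaw s τ = (M.stateLaw 0 τ).map (age^[τ] s + ·) := by
  induction τ with
  | zero => simp [stateLaw, PMF.pure_map]
  | succ τ ih =>
    rw [stateLaw_succ, ih, PMF.bind_map, stateLaw_succ, PMF.map_bind]
    congr 1
    funext s'
    simp only [Function.comp, trans]
    rw [PMF.map_comp]
    congr 1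
    funext b
    simp only [Function.comp]
    rw [next_add, Function.iterate_succ_apply']

theorem stateLaw_eq_zero {s : State n} (hs : M.IsState s) {τ : ℕ} (hτ : M.horizon ≤ τ) :
    M.stateLaw s τ = M.stateLaw 0 τ := by
  rw [stateLaw_eq_map, M.iterate_age_of_isState hs hτ]
  simp only [zero_add]
  exact PMF.map_id _

/-- The stationary law of the state. -/
def limitLaw : PMF (State n) := M.stateLaw 0 M.horizon

theorem stateLaw_zero_eq {τ : ℕ} (hτ : M.horizon ≤ τ) : M.stateLaw 0 τ = M.limitLaw := by
  induction τ, hτ using Nat.le_induction with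
  | base => rfl
  | succ τ hτ ih =>
    rw [stateLaw_succ', ← ih]
    have : (M.trans 0).bind (fun s' => M.stateLaw s' τ)
        = (M.trans 0).bind (fun _ => M.stateLaw 0 τ) := by
      rw [trans, PMF.bind_map, PMF.bind_map]
      congr 1
      funext b
      exact M.stateLaw_eq_zero (M.isState_next M.isState_zero b) hτ
    rw [this, PMF.bind_const]

theorem stateLaw_eq {s : State n} (hs : M.IsState s) {τ : ℕ} (hτ : M.horizon ≤ τ) :
    M.stateLaw s τ = M.limitLaw := by
  rw [M.stateLaw_eq_zero hs hτ, M.stateLaw_zero_eq hτ]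

theorem finite_support_stateLaw (s : State n) (τ : ℕ) : (M.stateLaw s τ).support.Finite := by
  induction τ with
  | zero => simp [stateLaw]
  | succ τ ih =>
    rw [stateLaw_succ, PMF.support_bind]
    refine ih.biUnion fun s' _ => ?_
    rw [trans, PMF.support_map]
    exact M.arrivalLaw_finite.image _

theorem isState_of_mem_support {s s' : State n} (hs : M.IsState s) {τ : ℕ}
    (h : s' ∈ (M.stateLaw s τ).support) : M.IsState s' := by
  induction τ generalizing s' with
  | zero => simp only [stateLaw, PMF.support_pure, Set.mem_singleton_iff] at h; rwa [h]
  | succ τ ih =>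
    rw [stateLaw_succ, PMF.mem_support_bind_iff] at h
    obtain ⟨s'', h1, h2⟩ := h
    rw [trans, PMF.mem_support_map_iff] at h2
    obtain ⟨b, -, rfl⟩ := h2
    exact M.isState_next (ih h1) b

theorem exists_mem_support_of_reflTransGen {s s' : State n} (h : Relation.ReflTransGen M.Step s s')
    {τ : ℕ} (hs : s ∈ (M.stateLaw 0 τ).support) : ∃ k, s' ∈ (M.stateLaw 0 (τ + k)).support := by
  induction h with
  | refl => exact ⟨0, hs⟩
  | tail _ hst ih =>
    obtain ⟨k, hk⟩ := ih
    obtain ⟨b, hb, rfl⟩ := hst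
    refine ⟨k + 1, ?_⟩
    rw [← add_assoc, stateLaw_succ, PMF.mem_support_bind_iff]
    refine ⟨_, hk, ?_⟩
    rw [trans, PMF.mem_support_map_iff]
    exact ⟨b, hb, rfl⟩

/-- Recurrent states have positive probability under the stationary law. -/
theorem mem_support_limitLaw {s : State n} (hs : s ∈ M.states) : s ∈ M.limitLaw.support := by
  obtain ⟨s₀, h0⟩ := M.limitLaw.support_nonempty
  obtain ⟨k, hk⟩ := M.exists_mem_support_of_reflTransGen
    (hs.2 s₀ (M.isState_of_mem_support M.isState_zero h0)) h0
  rwa [M.stateLaw_zero_eq (Nat.le_add_right _ _)] at hk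

/-! #### Paths -/

section Paths

variable {Ω : Type*}

theorem stateAt_add (s₀ : State n) (A : ℕ → Ω → Fin n → ℕ) (τ k : ℕ) (ω : Ω) :
    M.stateAt s₀ A (τ + k) ω =
      M.stateAt (M.stateAt s₀ A τ ω) (fun j => A (τ + j)) k ω := by
  induction k with
  | zero => rfl
  | succ k ih => rw [← add_assoc]; simp only [stateAt]; rw [ih]

theorem stateAt_eq_add (s₀ : State n) (A : ℕ → Ω → Fin n → ℕ) (τ : ℕ) (ω : Ω) :
    M.stateAt s₀ A τ ω = age^[τ] s₀ + M.stateAt 0 A τ ω := by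
  induction τ with
  | zero => simp [stateAt]
  | succ τ ih => simp only [stateAt]; rw [ih, next_add, Function.iterate_succ_apply']

theorem isState_stateAt {s₀ : State n} (hs : M.IsState s₀) (A : ℕ → Ω → Fin n → ℕ) (τ : ℕ)
    (ω : Ω) : M.IsState (M.stateAt s₀ A τ ω) := by
  induction τ with
  | zero => exact hs
  | succ τ ih => exact M.isState_next ih _

/-- The state depends only on the arrivals in the last slots. -/
theorem stateAt_add_horizon {s₀ : State n} (hs : M.IsState s₀) (A : ℕ → Ω → Fin n → ℕ) (τ : ℕ)
    (ω : Ω) : M.stateAt s₀ A (τ + M.horizon) ω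
      = M.stateAt 0 (fun j => A (τ + j)) M.horizon ω := by
  rw [stateAt_add, stateAt_eq_add, M.iterate_age_of_isState (M.isState_stateAt hs A τ ω) le_rfl,
    zero_add]

theorem stateAt_congr (s₀ : State n) {Ω' : Type*} {A : ℕ → Ω → Fin n → ℕ} {A' : ℕ → Ω' → Fin n → ℕ}
    {ω : Ω} {ω' : Ω'} {τ : ℕ} (h : ∀ j < τ, A j ω = A' j ω') :
    M.stateAt s₀ A τ ω = M.stateAt s₀ A' τ ω' := by
  induction τ with
  | zero => rfl
  | succ τ ih =>
    simp only [stateAt]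
    rw [ih fun j hj => h j (by omega), h τ (by omega)]

end Paths

end Cell

namespace Cell

/-! ### The law of the state, and recurrence -/

/-- Every set of states is measurable. -/
instance (n : ℕ) : MeasurableSpace (State n) := ⊤

instance (n : ℕ) : DiscreteMeasurableSpace (State n) := ⟨fun _ => trivial⟩

variable {n : ℕ} {L : Type*} (M : Cell n L) {Ω : Type*} [mΩ : MeasurableSpace Ω] {P : Measure Ω}
  {A : ℕ → Ω → Fin n → ℕ}

theorem measurable_stateAt (s₀ : State n) (hA : ∀ τ, Measurable (A τ)) (τ : ℕ) :
    Measurable (M.stateAt s₀ A τ) := by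
  induction τ with
  | zero => exact measurable_const
  | succ τ ih =>
    exact (measurable_of_countable (fun x : State n × (Fin n → ℕ) => M.next x.1 x.2)).comp
      (ih.prodMk (hA τ))

/-- The state in slot `τ`, as a function of the arrivals at a set of times that contains all slots
before `τ`. -/
def stateOf (s₀ : State n) (S : Finset ℕ) (off τ : ℕ) (x : S → Fin n → ℕ) : State n :=
  M.stateAt s₀ (fun j (x : S → Fin n → ℕ) => if h : off + j ∈ S then x ⟨off + j, h⟩ else 0) τ x

theorem measurable_stateOf (s₀ : State n) (S : Finset ℕ) (off τ : ℕ) :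
    Measurable (M.stateOf s₀ S off τ) :=
  M.measurable_stateAt s₀ (fun j => by
    by_cases h : off + j ∈ S
    · simp only [h, dite_true]; exact measurable_pi_apply _
    · simp only [h, dite_false]; exact measurable_const) τ

theorem stateOf_eq {Ω : Type*} {A : ℕ → Ω → Fin n → ℕ} (s₀ : State n) (S : Finset ℕ) (off τ : ℕ) (h : ∀ j < τ, off + j ∈ S) (ω : Ω) :
    M.stateOf s₀ S off τ (fun i => A i ω) = M.stateAt s₀ (fun j => A (off + j)) τ ω :=
  M.stateAt_congr s₀ fun j hj => by simp [h j hj]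

theorem indepFun_stateAt [IsProbabilityMeasure P] (s₀ : State n) (hA : ∀ τ, Measurable (A τ))
    (hind : iIndepFun A P) (τ : ℕ) : IndepFun (M.stateAt s₀ A τ) (A τ) P := by
  have h1 := hind.indepFun_finset (Finset.range τ) {τ} (by simp) hA
  have h2 := h1.comp (M.measurable_stateOf s₀ (Finset.range τ) 0 τ)
    (measurable_pi_apply (⟨τ, Finset.mem_singleton_self τ⟩ : ({τ} : Finset ℕ)))
  have e1 : M.stateOf s₀ (Finset.range τ) 0 τ ∘ (fun ω (i : Finset.range τ) => A i ω)
      = M.stateAt s₀ A τ := by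
    funext ω
    have := M.stateOf_eq (A := A) s₀ (Finset.range τ) 0 τ (fun j hj => by simpa using hj) ω
    simpa using this
  rw [e1] at h2
  exact h2

/-- The law of the state. -/
theorem map_stateAt [IsProbabilityMeasure P] (s₀ : State n) (hA : ∀ τ, Measurable (A τ))
    (hlaw : ∀ τ, P.map (A τ) = M.arrivalLaw.toMeasure) (hind : iIndepFun A P) (τ : ℕ) :
    P.map (M.stateAt s₀ A τ) = (M.stateLaw s₀ τ).toMeasure := by
  induction τ with
  | zero =>
    have : M.stateAt s₀ A 0 = fun _ => s₀ := rfl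
    rw [this, Measure.map_const, measure_univ, one_smul]
    simp only [stateLaw]
    exact (PMF.toMeasure_pure s₀).symm
  | succ τ ih =>
    have hnm : Measurable (fun x : State n × (Fin n → ℕ) => M.next x.1 x.2) :=
      measurable_of_countable _
    have hX := M.measurable_stateAt s₀ hA τ
    have h1 := (indepFun_iff_map_prod_eq_prod_map_map hX.aemeasurable (hA τ).aemeasurable).1
      (M.indepFun_stateAt s₀ hA hind τ)
    have h2 : P.map (M.stateAt s₀ A (τ + 1))
        = (P.map fun ω => (M.stateAt s₀ A τ ω, A τ ω)).map (fun x => M.next x.1 x.2) := by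
      rw [Measure.map_map hnm (hX.prodMk (hA τ))]; rfl
    rw [h2, h1, ih, hlaw]
    refine Measure.ext fun B hB => ?_
    rw [Measure.map_apply hnm hB, Measure.prod_apply (hnm hB), lintegral_countable',
      stateLaw_succ, PMF.toMeasure_bind_apply _ _ _ hB]
    refine tsum_congr fun s => ?_
    rw [PMF.toMeasure_apply_singleton _ _ (measurableSet_singleton _), mul_comm, trans,
      PMF.toMeasure_map_apply _ _ _ (measurable_of_countable _) hB]
    rfl

theorem measure_stateAt_eq [IsProbabilityMeasure P] (s₀ : State n) (hA : ∀ τ, Measurable (A τ))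
    (hlaw : ∀ τ, P.map (A τ) = M.arrivalLaw.toMeasure) (hind : iIndepFun A P) (τ : ℕ)
    (s : State n) : P {ω | M.stateAt s₀ A τ ω = s} = M.stateLaw s₀ τ s := by
  rw [← PMF.toMeasure_apply_singleton _ s (measurableSet_singleton s),
    ← M.map_stateAt s₀ hA hlaw hind τ,
    Measure.map_apply (M.measurable_stateAt s₀ hA τ) (measurableSet_singleton s)]
  rfl

/-- A state of positive probability is visited infinitely often. -/
theorem ae_frequently_stateAt [IsProbabilityMeasure P] {s₀ : State n} (hs₀ : M.IsState s₀)
    (hA : ∀ τ, Measurable (A τ))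
    (hlaw : ∀ τ, P.map (A τ) = M.arrivalLaw.toMeasure) (hind : iIndepFun A P) {s : State n}
    (hs : s ∈ M.limitLaw.support) : ∀ᵐ ω ∂P, ∃ᶠ τ in atTop, M.stateAt s₀ A τ ω = s := by
  set T := M.horizon with hT
  have hT0 := M.horizon_pos
  set p : ENNReal := M.limitLaw s with hp
  have hp0 : p ≠ 0 := hs
  -- no visit at the ends of `k` blocks
  set V : ℕ → ℕ → Set Ω := fun m k => {ω | ∀ j < k, M.stateAt s₀ A ((m + j) * T + T) ω ≠ s} with hV
  have hVP : ∀ m k, P (V m k) = (1 - p) ^ k := by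
    intro m k
    induction k with
    | zero => simp [hV]
    | succ k ih =>
      set t := (m + k) * T with ht
      set S1 := Finset.range t with hS1
      set S2 := Finset.Ico t (t + T) with hS2
      have hdis : Disjoint S1 S2 := by
        rw [Finset.disjoint_left]; intro a h1 h2
        simp only [hS1, hS2, Finset.mem_range, Finset.mem_Ico] at h1 h2
        omega
      have h1 := hind.indepFun_finset S1 S2 hdis hA
      have hm1 : MeasurableSet {x : S1 → Fin n → ℕ |
          ∀ j < k, M.stateOf s₀ S1 0 ((m + j) * T + T) x ≠ s} := by
        have e : {x : S1 → Fin n → ℕ | ∀ j < k, M.stateOf s₀ S1 0 ((m + j) * T + T) x ≠ s}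
            = ⋂ j : ℕ, ⋂ _ : j < k, (M.stateOf s₀ S1 0 ((m + j) * T + T)) ⁻¹' {s}ᶜ := by
          ext x; simp
        rw [e]
        exact MeasurableSet.iInter fun j => MeasurableSet.iInter fun _ =>
          M.measurable_stateOf s₀ S1 0 _ (measurableSet_singleton s).compl
      have hm2 : MeasurableSet ((M.stateOf 0 S2 t T) ⁻¹' {s}ᶜ) :=
        M.measurable_stateOf 0 S2 t T (measurableSet_singleton s).compl
      have h2 := h1.measure_inter_preimage_eq_mul _ _ hm1 hm2
      have e1 : (fun ω (i : S1) => A i ω) ⁻¹'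
          {x : S1 → Fin n → ℕ | ∀ j < k, M.stateOf s₀ S1 0 ((m + j) * T + T) x ≠ s} = V m k := by
        ext ω
        simp only [Set.mem_preimage, Set.mem_ofPred_eq, hV]
        refine forall₂_congr fun j hj => ?_
        rw [M.stateOf_eq s₀ S1 0 _ (fun i hi => ?_) ω]
        · simp
        · simp only [hS1, Finset.mem_range, ht]
          have : (m + j) * T + T = (m + (j + 1)) * T := by ring
          have h3 : (m + (j + 1)) * T ≤ (m + k) * T := Nat.mul_le_mul_right _ (by omega)
          omega
      have e2 : (fun ω (i : S2) => A i ω) ⁻¹' ((M.stateOf 0 S2 t T) ⁻¹' {s}ᶜ)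
          = {ω | M.stateAt 0 (fun j => A (t + j)) T ω = s}ᶜ := by
        ext ω
        simp only [Set.mem_preimage, Set.mem_compl_iff, Set.mem_singleton_iff, Set.mem_ofPred_eq]
        rw [M.stateOf_eq 0 S2 t T (fun i hi => by
          simp only [hS2, Finset.mem_Ico]; omega) ω]
      have hlaw2 : P {ω | M.stateAt 0 (fun j => A (t + j)) T ω = s} = p :=
        M.measure_stateAt_eq 0 (fun τ => hA _) (fun τ => hlaw _)
          (hind.precomp (g := fun j => t + j) fun a b h => by simpa using h) T s
      have hmeas : MeasurableSet {ω | M.stateAt 0 (fun j => A (t + j)) T ω = s} :=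
        M.measurable_stateAt 0 (fun j => hA (t + j)) T (measurableSet_singleton s)
      rw [e1, e2, ih, measure_compl hmeas (measure_ne_top _ _), measure_univ, hlaw2] at h2
      rw [pow_succ, ← h2]
      congr 1
      ext ω
      simp only [hV, Set.mem_ofPred_eq, Set.mem_inter_iff, Set.mem_compl_iff, Nat.forall_lt_succ_right]
      rw [← ht, M.stateAt_add_horizon hs₀ A t ω]
  have hnull : ∀ m, P {ω | ∀ j, M.stateAt s₀ A ((m + j) * T + T) ω ≠ s} = 0 := by
    intro m
    have h1 : ∀ k, P {ω | ∀ j, M.stateAt s₀ A ((m + j) * T + T) ω ≠ s} ≤ (1 - p) ^ k := fun k => by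
      rw [← hVP m k]
      exact measure_mono fun ω h j _ => h j
    have h2 : Tendsto (fun k => (1 - p) ^ k) atTop (𝓝 0) :=
      ENNReal.tendsto_pow_atTop_nhds_zero_of_lt_one
        (ENNReal.sub_lt_self ENNReal.one_ne_top one_ne_zero hp0)
    exact le_antisymm (ge_of_tendsto' h2 h1) bot_le
  have hae : ∀ᵐ ω ∂P, ∀ m, ∃ j, M.stateAt s₀ A ((m + j) * T + T) ω = s := by
    refine ae_all_iff.2 fun m => ?_
    rw [ae_iff]
    simpa using hnull m
  filter_upwards [hae] with ω hω
  rw [frequently_atTop]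
  intro a
  obtain ⟨j, hj⟩ := hω a
  refine ⟨(a + j) * T + T, ?_, hj⟩
  nlinarith

end Cell

/-! ### The algorithm, seen in the visits to one state -/

/-- A sequence that changes only at the times of a set is determined by its values at these
times. -/
theorem eq_nth_count {β : Type*} {p : ℕ → Prop} [DecidablePred p] (hp : {t | p t}.Infinite)
    {f : ℕ → β} (hf : ∀ t, ¬ p t → f (t + 1) = f t) (t : ℕ) :
    f t = f (Nat.nth p (Nat.count p t)) := by
  have h1 : t ≤ Nat.nth p (Nat.count p t) := Nat.le_nth_count hp t
  have h2 : ∀ d, t + d ≤ Nat.nth p (Nat.count p t) → f (t + d) = f t := by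
    intro d
    induction d with
    | zero => simp
    | succ d ih =>
      intro hd
      rw [← ih (by omega), ← add_assoc]
      refine hf _ fun hpd => ?_
      have h3 := Nat.nth_count hpd
      have h4 : Nat.nth p (Nat.count p t) ≤ Nat.nth p (Nat.count p (t + d)) :=
        (Nat.nth_strictMono hp).monotone (Nat.count_monotone p (Nat.le_add_right t d))
      omega
  obtain ⟨d, hd⟩ := Nat.exists_eq_add_of_le h1
  rw [hd]; exact (h2 d hd.symm.le).symm

theorem apply_nth_succ {β : Type*} {p : ℕ → Prop} [DecidablePred p] (hp : {t | p t}.Infinite)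
    {f : ℕ → β} (hf : ∀ t, ¬ p t → f (t + 1) = f t) (j : ℕ) :
    f (Nat.nth p (j + 1)) = f (Nat.nth p j + 1) := by
  rw [eq_nth_count hp hf (Nat.nth p j + 1), Nat.count_succ, Nat.count_nth_of_infinite hp,
    if_pos (Nat.nth_mem_of_infinite hp j)]

theorem tendsto_of_tendsto_nth {p : ℕ → Prop} [DecidablePred p] (hp : {t | p t}.Infinite)
    {f : ℕ → ℝ} (hf : ∀ t, ¬ p t → f (t + 1) = f t) {l : ℝ}
    (h : Tendsto (fun j => f (Nat.nth p j)) atTop (𝓝 l)) : Tendsto f atTop (𝓝 l) := by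
  have h1 : Tendsto (fun t => Nat.count p t) atTop atTop :=
    tendsto_atTop_mono' _ (Eventually.of_forall fun t => le_rfl)
      (tendsto_atTop_atTop.2 fun b => ⟨Nat.nth p b, fun t ht => by
        have := Nat.count_monotone p ht
        rwa [Nat.count_nth_of_infinite hp] at this⟩)
  exact (h.comp h1).congr fun t => (eq_nth_count hp hf t).symm

namespace Cell

variable {n : ℕ} {L : Type*} (M : Cell n L)

/-! #### Measurability of the memory -/

section Measurability

variable {Ω : Type*} [mΩ : MeasurableSpace Ω] {S : Setup n} {ξ ε : ℝ}

theorem measurable_decision {tie : ℕ → State n → ℝ → Bool} (htie : ∀ τ s, Measurable (tie τ s))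
    (τ : ℕ) (s : State n) {m : Ω → Memory n} (h1 : Measurable fun ω => (m ω).mobile s)
    (h0 : Measurable fun ω => (m ω).static s) {u : Ω → ℝ} (hu : Measurable u) :
    Measurable fun ω => decision ε ξ tie τ (m ω) s (u ω) := by
  unfold decision
  have h : Measurable fun ω => (m ω).mobile s - ξ * (m ω).static s :=
    h1.sub (h0.const_mul ξ)
  refine Measurable.ite (measurableSet_lt hu measurable_const) measurable_const ?_
  refine Measurable.ite (measurableSet_lt hu measurable_const) measurable_const ?_
  refine Measurable.ite (measurableSet_lt measurable_const h) measurable_const ?_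
  exact Measurable.ite (measurableSet_lt h measurable_const) measurable_const ((htie τ s).comp hu)

variable {A : ℕ → Ω → Fin n → ℕ} {U : ℕ → Ω → ℝ} {G : ℕ → Ω → L → M.gainSet}

/-- The memory depends measurably on the inputs of the earlier slots. -/
theorem measurable_memory (htie : ∀ τ s, Measurable (S.tie τ s)) (hA : ∀ i, Measurable (A i))
    (τ : ℕ) (hU : ∀ i < τ, Measurable (U i)) (hG : ∀ i < τ, Measurable (G i)) (s : State n) :
    (Measurable fun ω => (M.memory S ξ ε A U G τ ω).mobile s) ∧
    (Measurable fun ω => (M.memory S ξ ε A U G τ ω).static s) ∧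
    (Measurable fun ω => (M.memory S ξ ε A U G τ ω).countMobile s) ∧
    (Measurable fun ω => (M.memory S ξ ε A U G τ ω).countStatic s) := by
  induction τ with
  | zero => exact ⟨measurable_const, measurable_const, measurable_const, measurable_const⟩
  | succ τ ih =>
    obtain ⟨h1, h0, hc1, hc0⟩ := ih (fun i hi => hU i (by omega)) (fun i hi => hG i (by omega))
    have hd := measurable_decision (ξ := ξ) (ε := ε) htie τ s h1 h0 (hU τ (by omega))
    have hst := M.measurable_stateAt S.s₀ hA τ
    have he : ∀ (b : Bool) (ω : Ω), (M.stateAt S.s₀ A τ ω = s ∧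
        decision ε ξ S.tie τ (M.memory S ξ ε A U G τ ω) (M.stateAt S.s₀ A τ ω) (U τ ω) = b) ↔
        (M.stateAt S.s₀ A τ ω = s ∧
          decision ε ξ S.tie τ (M.memory S ξ ε A U G τ ω) s (U τ ω) = b) := fun b ω =>
      and_congr_right fun h => by rw [h]
    have hm : ∀ b : Bool, MeasurableSet {ω | M.stateAt S.s₀ A τ ω = s ∧
        decision ε ξ S.tie τ (M.memory S ξ ε A U G τ ω) (M.stateAt S.s₀ A τ ω) (U τ ω) = b} := by
      intro b
      simp only [he]
      exact (hst (measurableSet_singleton s)).inter (hd (measurableSet_singleton b))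
    have ha1 : Measurable fun ω => S.a ((M.memory S ξ ε A U G τ ω).countMobile s + 1) :=
      (measurable_of_countable fun k : ℕ => S.a (k + 1)).comp hc1
    have ha0 : Measurable fun ω => S.a ((M.memory S ξ ε A U G τ ω).countStatic s + 1) :=
      (measurable_of_countable fun k : ℕ => S.a (k + 1)).comp hc0
    have hr1 := (M.rateMobile_measurable s).comp (hG τ (by omega))
    have hr0 := (M.rateStatic_measurable s).comp (hG τ (by omega))
    refine ⟨?_, ?_, ?_, ?_⟩
    · exact Measurable.ite (hm true) (h1.add (ha1.mul (hr1.sub h1))) h1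
    · exact Measurable.ite (hm false) (h0.add (ha0.mul (hr0.sub h0))) h0
    · exact hc1.add (Measurable.ite (hm true) measurable_const measurable_const)
    · exact hc0.add (Measurable.ite (hm false) measurable_const measurable_const)

end Measurability

/-! #### The direction of a decision -/

/-- The decision in a state, if the sign of the estimated advantage of the mobile users is `c`. -/
def direction (ε : ℝ) (tie : ℝ → Bool) (c : SignType) (u : ℝ) : Bool :=
  if u < ε / 2 then false
  else if u < ε then true
  else if c = 1 then true
  else if c = -1 then false
  else tie u

theorem decision_eq (ε ξ : ℝ) (tie : ℕ → State n → ℝ → Bool) (τ : ℕ) (m : Memory n) (s : State n)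
    (u : ℝ) : decision ε ξ tie τ m s u
      = direction ε (tie τ s) (SignType.sign (m.mobile s - ξ * m.static s)) u := by
  unfold decision direction
  simp only [sign_eq_one_iff, sign_eq_neg_one_iff]

theorem direction_mono (ε : ℝ) (tie : ℝ → Bool) (u : ℝ) :
    Monotone fun c => direction ε tie c u := by
  intro c c' h
  unfold direction
  cases tie u <;> revert h <;> revert c c' <;> simp only [] <;> split_ifs <;> simp <;> decide

theorem measurable_direction (ε : ℝ) {tie : ℝ → Bool} (htie : Measurable tie) (c : SignType) :
    Measurable (direction ε tie c) := by
  unfold direction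
  refine Measurable.ite measurableSet_Iio measurable_const ?_
  refine Measurable.ite measurableSet_Iio measurable_const ?_
  refine Measurable.ite (MeasurableSet.const _) measurable_const ?_
  exact Measurable.ite (MeasurableSet.const _) measurable_const htie

/-- Indicator of the choice of an arm (`true`: mobile users), if the sign of the advantage of this
arm is `c`. -/
def choice (ε : ℝ) (tie : ℝ → Bool) : Bool → SignType → ℝ → ℝ
  | true, c, u => if direction ε tie c u then 1 else 0
  | false, c, u => if direction ε tie (-c) u then 0 else 1

theorem choice_val (ε : ℝ) (tie : ℝ → Bool) (i c u) :
    choice ε tie i c u = 0 ∨ choice ε tie i c u = 1 := by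
  cases i <;> unfold choice <;> simp only [] <;> split_ifs <;> simp

theorem choice_mono (ε : ℝ) (tie : ℝ → Bool) (i u) : Monotone fun c => choice ε tie i c u := by
  intro c c' h
  cases i
  · have h' : -c' ≤ -c := by revert h; revert c c'; decide
    have : direction ε tie (-c') u ≤ direction ε tie (-c) u := direction_mono ε tie u h'
    simp only [choice]
    revert this
    cases direction ε tie (-c) u <;> cases direction ε tie (-c') u <;> simp
  · have : direction ε tie c u ≤ direction ε tie c' u := direction_mono ε tie u h
    simp only [choice]
    revert this
    cases direction ε tie c u <;> cases direction ε tie c' u <;> simp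

theorem choice_not (ε : ℝ) (tie : ℝ → Bool) (i c u) :
    choice ε tie (!i) (-c) u = 1 - choice ε tie i c u := by
  cases i <;> simp only [choice, Bool.not_true, Bool.not_false, neg_neg] <;> split_ifs <;> simp

theorem measurable_choice (ε : ℝ) {tie : ℝ → Bool} (htie : Measurable tie) (i c) :
    Measurable (choice ε tie i c) := by
  cases i <;> unfold choice <;> simp only []
  · exact Measurable.ite (measurable_direction ε htie _ (measurableSet_singleton true))
      measurable_const measurable_const
  · exact Measurable.ite (measurable_direction ε htie _ (measurableSet_singleton true))
      measurable_const measurable_const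

/-- Against the present advantage, an arm is chosen only if it is forced. -/
theorem integral_choice {ε : ℝ} (h0 : 0 < ε) (h1 : ε ≤ 1) (tie : ℝ → Bool) (i : Bool) :
    ∫ u in Set.Icc (0 : ℝ) 1, choice ε tie i (-1) u = ε / 2 := by
  have e : ∀ I : Set ℝ, MeasurableSet I → I ⊆ Set.Icc (0 : ℝ) 1 →
      ∫ u in Set.Icc (0 : ℝ) 1, I.indicator (fun _ => (1 : ℝ)) u = volume.real I := by
    intro I hI hs
    rw [integral_indicator hI, Measure.restrict_restrict hI, Set.inter_eq_left.2 hs]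
    simp
  cases i
  · rw [← show volume.real (Set.Ico (0 : ℝ) (ε / 2)) = ε / 2 by
      rw [Real.volume_real_Ico_of_le (by linarith)]; ring,
      ← e _ measurableSet_Ico (fun x hx => ⟨hx.1, by linarith [hx.2]⟩)]
    refine setIntegral_congr_fun measurableSet_Icc fun u hu => ?_
    simp only [choice, direction, Set.indicator, Set.mem_Ico, hu.1, true_and, neg_neg]
    split_ifs <;> simp_all
  · rw [← show volume.real (Set.Ico (ε / 2) ε) = ε / 2 by
      rw [Real.volume_real_Ico_of_le (by linarith)]; ring,
      ← e _ measurableSet_Ico (fun x hx => ⟨by linarith [hx.1], by linarith [hx.2]⟩)]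
    refine setIntegral_congr_fun measurableSet_Icc fun u hu => ?_
    simp only [choice, direction, Set.indicator, Set.mem_Ico]
    have : (-1 : SignType) ≠ 1 := by decide
    simp only [this, if_false]
    split_ifs <;> (simp_all; try linarith)

end Cell

namespace Cell

/-! #### The estimates in one state as two arms, for fixed arrivals -/

section Fixed

variable {n : ℕ} {L : Type*} (M : Cell n L)

/-- The sequence of states for given arrivals `p`. -/
def path (s₀ : State n) (p : ℕ → Fin n → ℕ) (τ : ℕ) : State n :=
  M.stateAt s₀ (fun τ (_ : Unit) => p τ) τ ()

/-- The time of the `j`-th visit to the state `s`. -/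
def visit (s₀ : State n) (p : ℕ → Fin n → ℕ) (s : State n) (j : ℕ) : ℕ :=
  Nat.nth (fun τ => M.path s₀ p τ = s) j

variable {Ω : Type*}

theorem stateAt_fixed (s₀ : State n) (p : ℕ → Fin n → ℕ) (τ : ℕ) (ω : Ω) :
    M.stateAt s₀ (fun τ _ => p τ) τ ω = M.path s₀ p τ :=
  M.stateAt_congr s₀ fun _ _ => rfl

variable {M} {S : Setup n} {ξ ε : ℝ} {p : ℕ → Fin n → ℕ} {s : State n}

variable {U : ℕ → Ω → ℝ} {G : ℕ → Ω → L → M.gainSet}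

section Memory

variable (ω : Ω) (τ : ℕ)

theorem mobile_of_ne (h : M.path S.s₀ p τ ≠ s) :
    (M.memory S ξ ε (fun τ _ => p τ) U G (τ + 1) ω).mobile s
      = (M.memory S ξ ε (fun τ _ => p τ) U G τ ω).mobile s := by
  simp [memory, update, stateAt_fixed, h]

theorem static_of_ne (h : M.path S.s₀ p τ ≠ s) :
    (M.memory S ξ ε (fun τ _ => p τ) U G (τ + 1) ω).static s
      = (M.memory S ξ ε (fun τ _ => p τ) U G τ ω).static s := by
  simp [memory, update, stateAt_fixed, h]

theorem countMobile_of_ne (h : M.path S.s₀ p τ ≠ s) :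
    (M.memory S ξ ε (fun τ _ => p τ) U G (τ + 1) ω).countMobile s
      = (M.memory S ξ ε (fun τ _ => p τ) U G τ ω).countMobile s := by
  simp [memory, update, stateAt_fixed, h]

theorem countStatic_of_ne (h : M.path S.s₀ p τ ≠ s) :
    (M.memory S ξ ε (fun τ _ => p τ) U G (τ + 1) ω).countStatic s
      = (M.memory S ξ ε (fun τ _ => p τ) U G τ ω).countStatic s := by
  simp [memory, update, stateAt_fixed, h]

end Memory

/-- The reward of an arm: the rate of the mobile users, or `ζ` times the rate of the static
users. -/
def armRate (M : Cell n L) (ζ : ℝ) (s : State n) : Bool → (L → M.gainSet) → ℝ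
  | true, g => M.rateMobile s g
  | false, g => ζ * M.rateStatic s g

theorem measurable_armRate (M : Cell n L) (ζ : ℝ) (s : State n) (i : Bool) :
    Measurable (M.armRate ζ s i) := by
  cases i
  · exact (M.rateStatic_measurable s).const_mul ζ
  · exact M.rateMobile_measurable s

theorem armRate_nonneg (M : Cell n L) {ζ : ℝ} (hζ : 0 ≤ ζ) (s : State n) (i : Bool) (g) :
    0 ≤ M.armRate ζ s i g := by
  cases i
  · exact mul_nonneg hζ (M.rateStatic_nonneg s g)
  · exact M.rateMobile_nonneg s g

theorem exists_armRate_le (M : Cell n L) {ζ : ℝ} (hζ : 0 ≤ ζ) (s : State n) :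
    ∃ C, ∀ i g, M.armRate ζ s i g ≤ C := by
  obtain ⟨C₁, h1⟩ := M.rateMobile_bounded s
  obtain ⟨C₀, h0⟩ := M.rateStatic_bounded s
  refine ⟨max C₁ (ζ * C₀), fun i g => ?_⟩
  cases i
  · exact (mul_le_mul_of_nonneg_left (h0 g) hζ).trans (le_max_right _ _)
  · exact (h1 g).trans (le_max_left _ _)

/-- The estimate of the reward of an arm that is kept in the memory. -/
def armEstimate (ζ : ℝ) (s : State n) : Bool → Memory n → ℝ
  | true, m => m.mobile s
  | false, m => ζ * m.static s

/-- The number of updates of an arm that is kept in the memory. -/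
def armCount (s : State n) : Bool → Memory n → ℕ
  | true, m => m.countMobile s
  | false, m => m.countStatic s

/-- The sign of the estimated advantage of an arm. -/
def armClass (ξ : ℝ) (s : State n) : Bool → Memory n → SignType
  | true, m => SignType.sign (m.mobile s - ξ * m.static s)
  | false, m => -SignType.sign (m.mobile s - ξ * m.static s)

theorem armEstimate_of_ne (ζ : ℝ) (i : Bool) (ω : Ω) (τ : ℕ) (h : M.path S.s₀ p τ ≠ s) :
    armEstimate ζ s i (M.memory S ξ ε (fun τ _ => p τ) U G (τ + 1) ω)
      = armEstimate ζ s i (M.memory S ξ ε (fun τ _ => p τ) U G τ ω) := by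
  cases i
  · simp only [armEstimate]; rw [static_of_ne ω τ h]
  · exact mobile_of_ne ω τ h

theorem armCount_of_ne (i : Bool) (ω : Ω) (τ : ℕ) (h : M.path S.s₀ p τ ≠ s) :
    armCount s i (M.memory S ξ ε (fun τ _ => p τ) U G (τ + 1) ω)
      = armCount s i (M.memory S ξ ε (fun τ _ => p τ) U G τ ω) := by
  cases i
  · exact countStatic_of_ne ω τ h
  · exact countMobile_of_ne ω τ h

theorem armEstimate_step (ζ : ℝ) (i : Bool) (ω : Ω) (τ : ℕ) (h : M.path S.s₀ p τ = s) :
    armEstimate ζ s i (M.memory S ξ ε (fun τ _ => p τ) U G (τ + 1) ω)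
      = armEstimate ζ s i (M.memory S ξ ε (fun τ _ => p τ) U G τ ω)
        + choice ε (S.tie τ s) i
            (armClass ξ s i (M.memory S ξ ε (fun τ _ => p τ) U G τ ω)) (U τ ω)
          * (S.a (armCount s i (M.memory S ξ ε (fun τ _ => p τ) U G τ ω) + 1)
            * (M.armRate ζ s i (G τ ω)
              - armEstimate ζ s i (M.memory S ξ ε (fun τ _ => p τ) U G τ ω))) := by
  cases i <;>
    simp only [armEstimate, armCount, armClass, armRate, choice, memory, update, stateAt_fixed, h,
      decision_eq, true_and, neg_neg] <;>
    by_cases hd : direction ε (S.tie τ s) (SignType.sign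
      ((M.memory S ξ ε (fun τ _ => p τ) U G τ ω).mobile s
        - ξ * (M.memory S ξ ε (fun τ _ => p τ) U G τ ω).static s)) (U τ ω) = true <;>
    simp [hd]
  ring

theorem armCount_step (i : Bool) (ω : Ω) (τ : ℕ) (h : M.path S.s₀ p τ = s) :
    armCount s i (M.memory S ξ ε (fun τ _ => p τ) U G (τ + 1) ω)
      = armCount s i (M.memory S ξ ε (fun τ _ => p τ) U G τ ω)
        + if choice ε (S.tie τ s) i
            (armClass ξ s i (M.memory S ξ ε (fun τ _ => p τ) U G τ ω)) (U τ ω) = 1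
          then 1 else 0 := by
  cases i <;>
    simp only [armCount, armClass, choice, memory, update, stateAt_fixed, h,
      decision_eq, true_and, neg_neg] <;>
    by_cases hd : direction ε (S.tie τ s) (SignType.sign
      ((M.memory S ξ ε (fun τ _ => p τ) U G τ ω).mobile s
        - ξ * (M.memory S ξ ε (fun τ _ => p τ) U G τ ω).static s)) (U τ ω) = true <;>
    simp [hd]

/-- What is known before slot `τ`, without the arrivals. -/
abbrev known (U : ℕ → Ω → ℝ) (G : ℕ → Ω → L → M.gainSet) (τ : ℕ) : MeasurableSpace Ω :=
  (⨆ i ∈ Set.Iio τ, MeasurableSpace.comap (U i) inferInstance)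
    ⊔ ⨆ i : Fin τ, MeasurableSpace.comap (G i) inferInstance

theorem known_mono : Monotone (known U G) := fun τ τ' h =>
  sup_le_sup (biSup_mono fun _ hi => lt_of_lt_of_le hi h)
    (iSup_le fun i => le_iSup_of_le (⟨i, by omega⟩ : Fin τ') le_rfl)

theorem comap_unif_le_known {i τ : ℕ} (h : i < τ) :
    MeasurableSpace.comap (U i) inferInstance ≤ known U G τ :=
  (le_iSup₂_of_le (f := fun i (_ : i ∈ Set.Iio τ) => MeasurableSpace.comap (U i) inferInstance)
    i h le_rfl).trans le_sup_left

theorem comap_gain_le_known {i τ : ℕ} (h : i < τ) :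
    MeasurableSpace.comap (G i) inferInstance ≤ known U G τ :=
  (le_iSup_of_le (f := fun i : Fin τ => MeasurableSpace.comap (G i) inferInstance)
    ⟨i, h⟩ le_rfl).trans le_sup_right

theorem comap_pi {E : Type*} [mE : MeasurableSpace E] (f : ℕ → Ω → E) :
    MeasurableSpace.comap (fun ω τ => f τ ω) inferInstance
      = ⨆ τ, MeasurableSpace.comap (f τ) mE := by
  simp only [MeasurableSpace.pi, MeasurableSpace.comap_iSup, MeasurableSpace.comap_comp]
  rfl

variable [mΩ : MeasurableSpace Ω] {P : Measure Ω}

theorem known_le (hU : ∀ τ, Measurable (U τ)) (hG : ∀ τ, Measurable (G τ)) (τ : ℕ) :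
    known U G τ ≤ mΩ :=
  sup_le (iSup₂_le fun i _ => (hU i).comap_le) (iSup_le fun i => (hG i).comap_le)

/-- Later randomizations are independent of the past and of the fading. -/
theorem indep_known [IsProbabilityMeasure P] {A : ℕ → Ω → Fin n → ℕ} (hin : M.IsInput P A U G)
    (τ : ℕ) : Indep (⨆ i ∈ Set.Ici τ, MeasurableSpace.comap (U i) inferInstance)
      (known U G τ ⊔ ⨆ i, MeasurableSpace.comap (G i) inferInstance) P := by
  have hU := hin.measurable_unif
  have hG := hin.measurable_gain
  have e : known U G τ ⊔ ⨆ i, MeasurableSpace.comap (G i) inferInstance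
      = (⨆ i ∈ Set.Iio τ, MeasurableSpace.comap (U i) inferInstance)
        ⊔ ⨆ i, MeasurableSpace.comap (G i) inferInstance := by
    have h : ⨆ i : Fin τ, MeasurableSpace.comap (G i) inferInstance
        ≤ ⨆ i, MeasurableSpace.comap (G i) inferInstance :=
      iSup_le fun i => le_iSup (fun i => MeasurableSpace.comap (G i) inferInstance) (i : ℕ)
    rw [known, sup_assoc, sup_eq_right.2 h]
  rw [e]
  have h2 : Indep (⨆ i, MeasurableSpace.comap (U i) inferInstance)
      (⨆ i, MeasurableSpace.comap (G i) inferInstance) P := by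
    have := hin.indep_unif_gain
    rwa [IndepFun_iff_Indep, comap_pi, comap_pi] at this
  refine indep_sup_right (iSup₂_le fun i _ => (hU i).comap_le) (iSup₂_le fun i _ => (hU i).comap_le)
    (iSup_le fun i => (hG i).comap_le) ?_ (indep_of_indep_of_le_left h2 ?_)
  · refine indep_iSup_of_disjoint (fun i => (hU i).comap_le) hin.unif_indep ?_
    exact Set.disjoint_left.2 fun i h1 h2 => absurd (Set.mem_Iio.1 h2) (not_lt.2 h1)
  · exact sup_le (iSup₂_le fun i _ => le_iSup (fun i => MeasurableSpace.comap (U i) inferInstance) i)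
      (iSup₂_le fun i _ => le_iSup (fun i => MeasurableSpace.comap (U i) inferInstance) i)

theorem measurableSet_sign_eq (c : SignType) : MeasurableSet {x : ℝ | SignType.sign x = c} := by
  cases c
  · simp only [SignType.zero_eq_zero, sign_eq_zero_iff]; exact measurableSet_singleton 0
  · simp only [SignType.neg_eq_neg_one, sign_eq_neg_one_iff]; exact measurableSet_Iio
  · simp only [SignType.pos_eq_one, sign_eq_one_iff]; exact measurableSet_Ioi

/-- The estimates in a state that is visited infinitely often are a pair of competing estimates. The
estimate for the static users is scaled by `ζ`: if `ζ = ξ`, the class is the sign of the difference of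
the two estimates, but `ξ` may be zero, and then the scaled estimate would carry no information. -/
theorem exists_arms [IsProbabilityMeasure P] {A : ℕ → Ω → Fin n → ℕ} (hin : M.IsInput P A U G)
    {π : Measure (L → M.gainSet)} [IsProbabilityMeasure π]
    (herg : UniformlyErgodic M.fadingKernel π)
    (ha_pos : ∀ t, 1 ≤ t → 0 < S.a t) (ha_anti : ∀ t, 1 ≤ t → S.a (t + 1) ≤ S.a t)
    (ha_sum : ¬ Summable S.a) (ha_sq : Summable (fun t => S.a t ^ 2))
    (htie : ∀ τ s, Measurable (S.tie τ s)) (hε0 : 0 < ε) (hε1 : ε ≤ 1)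
    (hs : {τ | M.path S.s₀ p τ = s}.Infinite) {ζ : ℝ} (hζ : 0 ≤ ζ) :
    ∃ W : Arms P,
      (∀ i j ω, W.X i j ω = armEstimate ζ s i
        (M.memory S ξ ε (fun τ _ => p τ) U G (M.visit S.s₀ p s j) ω)) ∧
      (∀ i j ω, W.cls i j ω = armClass ξ s i
        (M.memory S ξ ε (fun τ _ => p τ) U G (M.visit S.s₀ p s j) ω)) ∧
      (∀ i, W.mean i = ∫ g, M.armRate ζ s i g ∂π) ∧
      (∀ j ω, 0 ≤ W.R true j ω) := by
  classical
  have hU := hin.measurable_unif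
  have hG := hin.measurable_gain
  have := M.fadingKernel_markov
  obtain ⟨γ, hγ0, hγa, hγs, hγ⟩ := exists_mixing_rate herg
  obtain ⟨C, hC⟩ := M.exists_armRate_le hζ s
  have hC' : ∀ i g, |M.armRate ζ s i g| ≤ C := fun i g => by
    rw [abs_of_nonneg (M.armRate_nonneg hζ s i g)]; exact hC i g
  have hgain : ∀ τ, Measurable[⨆ i, MeasurableSpace.comap (G i) inferInstance] (G τ) := fun τ =>
    (comap_measurable (G τ)).mono
      (le_iSup (fun i => MeasurableSpace.comap (G i) inferInstance) τ) le_rfl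
  set v := M.visit S.s₀ p s with hv
  have hvs : StrictMono v := Nat.nth_strictMono hs
  have hvp : ∀ j, M.path S.s₀ p (v j) = s := fun j => Nat.nth_mem_of_infinite hs j
  have hvk : ∀ t k, k ≤ v (t + k) - v t := fun t k => by
    have : k + v t ≤ v (t + k) := by
      induction k with
      | zero => simp
      | succ k ih =>
        have := hvs (show t + k < t + (k + 1) by omega)
        omega
    omega
  set mem := fun j ω => M.memory S ξ ε (fun τ _ => p τ) U G (v j) ω with hmem
  have hmm : ∀ j, (Measurable[known U G (v j)] fun ω => (mem j ω).mobile s) ∧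
      (Measurable[known U G (v j)] fun ω => (mem j ω).static s) := fun j => by
    have := @measurable_memory n L M Ω (known U G (v j)) S ξ ε (fun τ _ => p τ) U G htie
      (fun i => measurable_const) (v j)
      (fun i hi => (comap_measurable (U i)).mono (comap_unif_le_known hi) le_rfl)
      (fun i hi => (comap_measurable (G i)).mono (comap_gain_le_known hi) le_rfl) s
    exact ⟨this.1, this.2.1⟩
  refine ⟨{
    a := fun k => S.a (k + 1)
    a_pos := fun k => ha_pos _ (by omega)
    a_anti := antitone_nat_of_succ_le fun k => ha_anti _ (by omega)
    a_sum := fun h => ha_sum ((summable_nat_add_iff 1).1 h)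
    a_sq := (summable_nat_add_iff 1).2 ha_sq
    past := ⟨fun j => known U G (v j), fun j j' h => known_mono (hvs.monotone h),
      fun j => known_le hU hG _⟩
    rnd := fun j => MeasurableSpace.comap (U (v j)) inferInstance
    rew := ⨆ i, MeasurableSpace.comap (G i) inferInstance
    rnd_le := fun j => comap_unif_le_known (hvs (Nat.lt_succ_self j))
    rew_le := iSup_le fun i => (hG i).comap_le
    indep := fun t => indep_of_indep_of_le_left (indep_known hin (v t)) (iSup_le fun k =>
      le_iSup₂_of_le (f := fun i (_ : i ∈ Set.Ici (v t)) =>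
        MeasurableSpace.comap (U i) inferInstance) (v (t + k))
        (hvs.monotone (Nat.le_add_right t k)) le_rfl)
    R := fun i j ω => M.armRate ζ s i (G (v j) ω)
    C := C
    R_bdd := fun i j ω => hC' i _
    R_past := fun i j => (M.measurable_armRate ζ s i).comp
      ((comap_measurable (G (v j))).mono
        (comap_gain_le_known (hvs (Nat.lt_succ_self j))) le_rfl)
    R_rew := fun i j => (M.measurable_armRate ζ s i).comp (hgain _)
    mean := fun i => ∫ g, M.armRate ζ s i g ∂π
    mix := fun k => γ k * C
    mix_nonneg := fun k => ?_
    mix_summable := hγs.mul_right C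
    mixing := fun i t k => ?_
    α := ε / 2
    α_pos := by linarith
    α_le := by linarith
    β := fun i c j ω => choice ε (S.tie (v j) s) i c (U (v j) ω)
    β_val := fun i c j ω => choice_val _ _ _ _ _
    β_mono := fun i j ω => choice_mono _ _ _ _
    β_not := fun i c j ω => choice_not _ _ _ _ _
    β_meas := fun i c j => (measurable_choice ε (htie _ _) i c).comp (comap_measurable _)
    β_neg := fun i j => ?_
    cls := fun i j ω => armClass ξ s i (mem j ω)
    cls_not := fun i j ω => by cases i <;> simp [armClass]
    cls_meas := fun i j c => ?_
    X := fun i j ω => armEstimate ζ s i (mem j ω)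
    N := fun i j ω => armCount s i (mem j ω)
    x₀ := fun i => armEstimate ζ s i ⟨S.mobile₀, S.static₀, fun _ => 0, fun _ => 0⟩
    X_zero := fun i ω => ?_
    N_zero := fun i ω => ?_
    X_succ := fun i j ω => ?_
    N_succ := fun i j ω => ?_ }, fun _ _ _ => rfl, fun _ _ _ => rfl, fun _ => rfl,
    fun j ω => M.rateMobile_nonneg _ _⟩
  · exact mul_nonneg (hγ0 k) ((M.armRate_nonneg hζ s true (Classical.choice
      (nonempty_of_isProbabilityMeasure π))).trans (hC _ _))
  · have h2 : Indep (⨆ i, MeasurableSpace.comap (U i) inferInstance)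
        (⨆ i, MeasurableSpace.comap (G i) inferInstance) P := by
      have := hin.indep_unif_gain
      rwa [IndepFun_iff_Indep, comap_pi, comap_pi] at this
    have h3 := ae_abs_condExp_gain_sub_le (m := known U G (v t)) hG hin.gain_markov
      (iSup_le fun i => (hU i).comap_le) h2 hγa hγ (M.measurable_armRate ζ s i)
      (M.armRate_nonneg hζ s i) (hC i) (v t) (v (t + k)) (hvs.monotone (Nat.le_add_right t k))
      (sup_le_sup (iSup₂_le fun i _ =>
        le_iSup (fun i => MeasurableSpace.comap (U i) inferInstance) i) le_rfl)
    filter_upwards [h3] with ω hω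
    refine hω.trans (mul_le_mul_of_nonneg_right (hγa (hvk t k)) ?_)
    exact (M.armRate_nonneg hζ s i (G 0 ω)).trans (hC _ _)
  · have h1 := integral_map (μ := P) (hU (v j)).aemeasurable (f := choice ε (S.tie (v j) s) i (-1))
      (measurable_choice ε (htie _ _) i (-1)).aestronglyMeasurable
    rw [hin.unif_law, integral_choice hε0 hε1] at h1
    exact h1.symm
  · have h1 : ∀ c, MeasurableSet[known U G (v j)]
        {ω | SignType.sign ((mem j ω).mobile s - ξ * (mem j ω).static s) = c} := fun c =>
      ((hmm j).1.sub ((hmm j).2.const_mul ξ)) (measurableSet_sign_eq c)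
    cases i
    · simpa only [armClass, neg_eq_iff_eq_neg] using h1 (-c)
    · exact h1 c
  · have := eq_nth_count hs (f := fun τ => armEstimate ζ s i
      (M.memory S ξ ε (fun τ _ => p τ) U G τ ω)) (fun τ h => armEstimate_of_ne ζ i ω τ h) 0
    rw [Nat.count_zero] at this
    exact this.symm
  · have := eq_nth_count hs (f := fun τ => armCount s i
      (M.memory S ξ ε (fun τ _ => p τ) U G τ ω)) (fun τ h => armCount_of_ne i ω τ h) 0
    rw [Nat.count_zero] at this
    refine Eq.trans this.symm ?_
    cases i <;> rfl
  · have := apply_nth_succ hs (f := fun τ => armEstimate ζ s i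
      (M.memory S ξ ε (fun τ _ => p τ) U G τ ω)) (fun τ h => armEstimate_of_ne ζ i ω τ h) j
    exact this.trans (armEstimate_step ζ i ω (v j) (hvp j))
  · have := apply_nth_succ hs (f := fun τ => armCount s i
      (M.memory S ξ ε (fun τ _ => p τ) U G τ ω)) (fun τ h => armCount_of_ne i ω τ h) j
    exact this.trans (armCount_step i ω (v j) (hvp j))

end Fixed

end Cell

/-! ### Consistency of the estimates of the algorithm -/

namespace Arms

variable {Ω : Type*} [mΩ : MeasurableSpace Ω] {P : Measure Ω} (W : Arms P)

/-- If the rewards of an arm are nonnegative, then the sign of its estimate settles: as soon as the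
step sizes are less than `1`, the estimate cannot leave the positive numbers, nor the nonnegative
numbers. -/
theorem exists_sign_eq (i : Bool) (hR : ∀ t ω, 0 ≤ W.R i t ω) (ω : Ω) :
    ∃ T, ∀ t, T ≤ t → SignType.sign (W.X i t ω) = SignType.sign (W.X i T ω) := by
  have ha : Tendsto W.a atTop (𝓝 0) := by
    have h := W.a_sq.tendsto_atTop_zero.sqrt
    simpa only [Real.sqrt_sq (W.a_pos _).le, Real.sqrt_zero] using h
  obtain ⟨k₀, hk₀⟩ := eventually_atTop.1 (ha.eventually (gt_mem_nhds one_pos))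
  set T₀ := Function.argmin (fun t => k₀ - W.N i t ω) with hT₀
  have hmin : ∀ t, k₀ - W.N i T₀ ω ≤ k₀ - W.N i t ω := fun t =>
    Function.argmin_le (fun t => k₀ - W.N i t ω) t
  have hN : Monotone fun t => W.N i t ω := monotone_nat_of_le_succ fun t => by
    rw [W.N_step]; omega
  have hstep : ∀ t, T₀ ≤ t → ∃ c, 0 ≤ c ∧ c < 1 ∧
      W.X i (t + 1) ω = (1 - c) * W.X i t ω + c * W.R i t ω := by
    intro t ht
    refine ⟨W.b i t ω * W.s i t ω, mul_nonneg (W.b_nonneg i t ω) (W.s_pos i t ω).le, ?_, ?_⟩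
    · rcases W.b_val i t ω with h | h
      · rw [h]; simp
      · rw [h, one_mul]
        refine hk₀ _ ?_
        by_contra hlt
        have h1 := hN ht
        have h2 := hmin (t + 1)
        rw [W.N_step, if_pos h] at h2
        simp only at h1
        omega
    · rw [W.X_step]; ring
  have hpos : ∀ t₁, T₀ ≤ t₁ → 0 < W.X i t₁ ω → ∀ t, t₁ ≤ t → 0 < W.X i t ω := by
    intro t₁ h1 h2 t ht
    induction t, ht using Nat.le_induction with
    | base => exact h2
    | succ t ht ih =>
      obtain ⟨c, hc0, hc1, hc⟩ := hstep t (h1.trans ht)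
      rw [hc]
      have := mul_nonneg hc0 (hR t ω)
      have := mul_pos (sub_pos.2 hc1) ih
      linarith
  have hnonneg : ∀ t₁, T₀ ≤ t₁ → 0 ≤ W.X i t₁ ω → ∀ t, t₁ ≤ t → 0 ≤ W.X i t ω := by
    intro t₁ h1 h2 t ht
    induction t, ht using Nat.le_induction with
    | base => exact h2
    | succ t ht ih =>
      obtain ⟨c, hc0, hc1, hc⟩ := hstep t (h1.trans ht)
      rw [hc]
      have := mul_nonneg hc0 (hR t ω)
      have := mul_nonneg (sub_pos.2 hc1).le ih
      linarith
  by_cases h1 : ∃ t₁, T₀ ≤ t₁ ∧ 0 < W.X i t₁ ω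
  · obtain ⟨t₁, h2, h3⟩ := h1
    exact ⟨t₁, fun t ht => by rw [sign_pos h3, sign_pos (hpos t₁ h2 h3 t ht)]⟩
  by_cases h4 : ∃ t₁, T₀ ≤ t₁ ∧ 0 ≤ W.X i t₁ ω
  · obtain ⟨t₁, h2, h3⟩ := h4
    have h5 : ∀ t, t₁ ≤ t → W.X i t ω = 0 := fun t ht =>
      le_antisymm (not_lt.1 fun h => h1 ⟨t, h2.trans ht, h⟩) (hnonneg t₁ h2 h3 t ht)
    exact ⟨t₁, fun t ht => by rw [h5 t ht, h5 t₁ le_rfl]⟩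
  · push Not at h4
    exact ⟨T₀, fun t ht => by rw [sign_neg (h4 t ht), sign_neg (h4 T₀ le_rfl)]⟩

/-- The estimates are consistent if the class is the sign of the estimate of an arm with nonnegative
rewards. -/
theorem ae_tendsto_mean_of_nonneg [IsProbabilityMeasure P] (hR : ∀ t ω, 0 ≤ W.R true t ω)
    (hcls : ∀ t ω, W.cls true t ω = SignType.sign (W.X true t ω)) :
    ∀ᵐ ω ∂P, ∀ i, Tendsto (fun t => W.X i t ω) atTop (𝓝 (W.mean i)) := by
  have hc : ∀ i t ω, W.cls i t ω
      = if i then SignType.sign (W.X true t ω) else -SignType.sign (W.X true t ω) := by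
    intro i t ω
    cases i
    · have := W.cls_not true t ω
      simpa [hcls] using this
    · simpa using hcls t ω
  refine ae_all_iff.2 fun i => ?_
  filter_upwards [W.ae_tendsto_of_summable_jump i] with ω hω
  refine hω ?_
  obtain ⟨T, hT⟩ := W.exists_sign_eq true hR ω
  refine summable_of_ne_finset_zero (s := Finset.range T) fun t ht => ?_
  have ht' : T ≤ t := by simpa using ht
  unfold jump chg
  rw [if_pos (by rw [hc, hc, hT t ht', hT (t + 1) (by omega)]), mul_zero]

end Arms

namespace Cell

variable {n : ℕ} {L : Type*} {M : Cell n L} {S : Setup n} {ξ ε : ℝ} {s : State n}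
  {Ω : Type*} {A : ℕ → Ω → Fin n → ℕ} {U : ℕ → Ω → ℝ} {G : ℕ → Ω → L → M.gainSet}

theorem memory_congr {Ω' : Type*} {A' : ℕ → Ω' → Fin n → ℕ} {U' : ℕ → Ω' → ℝ}
    {G' : ℕ → Ω' → L → M.gainSet} {ω : Ω} {ω' : Ω'} (hA : ∀ τ, A τ ω = A' τ ω')
    (hU : ∀ τ, U τ ω = U' τ ω') (hG : ∀ τ, G τ ω = G' τ ω') (τ : ℕ) :
    M.memory S ξ ε A U G τ ω = M.memory S ξ ε A' U' G' τ ω' := by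
  induction τ with
  | zero => rfl
  | succ τ ih =>
    simp only [memory]
    rw [ih, hU, hG, M.stateAt_congr S.s₀ fun j _ => hA j]

variable [mΩ : MeasurableSpace Ω] {P : Measure Ω}

/-- Consistency for fixed arrivals. -/
theorem ae_tendsto_fixed [IsProbabilityMeasure P] (hin : M.IsInput P A U G)
    {π : Measure (L → M.gainSet)} [IsProbabilityMeasure π]
    (herg : UniformlyErgodic M.fadingKernel π) (hξ : 0 ≤ ξ)
    (ha_pos : ∀ t, 1 ≤ t → 0 < S.a t) (ha_anti : ∀ t, 1 ≤ t → S.a (t + 1) ≤ S.a t)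
    (ha_sum : ¬ Summable S.a) (ha_sq : Summable (fun t => S.a t ^ 2))
    (htie : ∀ τ s, Measurable (S.tie τ s)) (hε0 : 0 < ε) (hε1 : ε ≤ 1) {p : ℕ → Fin n → ℕ}
    (hs : {τ | M.path S.s₀ p τ = s}.Infinite) : ∀ᵐ ω ∂P,
      Tendsto (fun τ => (M.memory S ξ ε (fun τ _ => p τ) U G τ ω).mobile s) atTop
        (𝓝 (M.meanMobile π s)) ∧
      Tendsto (fun τ => (M.memory S ξ ε (fun τ _ => p τ) U G τ ω).static s) atTop
        (𝓝 (M.meanStatic π s)) := by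
  classical
  -- with `ξ = 0`, the static users do not influence the greedy decisions
  obtain ⟨ζ, hζ, h⟩ : ∃ ζ : ℝ, 0 < ζ ∧ ∀ᵐ ω ∂P, ∀ i, Tendsto (fun j => armEstimate ζ s i
        (M.memory S ξ ε (fun τ _ => p τ) U G (M.visit S.s₀ p s j) ω)) atTop
        (𝓝 (∫ g, M.armRate ζ s i g ∂π)) := by
    rcases hξ.eq_or_lt with rfl | hξ
    · obtain ⟨W, hX, hc, hm, hR⟩ := exists_arms (s := s) hin herg ha_pos ha_anti ha_sum ha_sq htie
        hε0 hε1 hs (ζ := 1) zero_le_one (ξ := 0)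
      refine ⟨1, one_pos, ?_⟩
      filter_upwards [W.ae_tendsto_mean_of_nonneg hR fun t ω => by
        rw [hX, hc]; simp [armClass, armEstimate]] with ω hω i
      simpa only [hX, hm] using hω i
    · obtain ⟨W, hX, hc, hm, hR⟩ := exists_arms (s := s) hin herg ha_pos ha_anti ha_sum ha_sq htie
        hε0 hε1 hs hξ.le (ξ := ξ)
      refine ⟨ξ, hξ, ?_⟩
      filter_upwards [W.ae_tendsto_mean fun i t ω => by
        rw [hX, hX, hc]
        cases i
        · simp only [armClass, armEstimate, Bool.not_false]
          rw [← Left.sign_neg, neg_sub]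
        · rfl] with ω hω i
      simpa only [hX, hm] using hω i
  filter_upwards [h] with ω hω
  have h1 := fun i => tendsto_of_tendsto_nth hs (f := fun τ => armEstimate ζ s i
    (M.memory S ξ ε (fun τ _ => p τ) U G τ ω)) (fun τ h => armEstimate_of_ne ζ i ω τ h) (hω i)
  refine ⟨h1 true, ?_⟩
  have h2 := (h1 false).const_mul ζ⁻¹
  simp only [armEstimate, armRate, integral_const_mul] at h2
  simpa only [meanStatic, ← mul_assoc, inv_mul_cancel₀ hζ.ne', one_mul] using h2

/-- The estimates in a state of positive probability are consistent. -/
theorem ae_tendsto_memory [IsProbabilityMeasure P] (hin : M.IsInput P A U G)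
    {π : Measure (L → M.gainSet)} [IsProbabilityMeasure π]
    (herg : UniformlyErgodic M.fadingKernel π) (hξ : 0 ≤ ξ)
    (ha_pos : ∀ t, 1 ≤ t → 0 < S.a t) (ha_anti : ∀ t, 1 ≤ t → S.a (t + 1) ≤ S.a t)
    (ha_sum : ¬ Summable S.a) (ha_sq : Summable (fun t => S.a t ^ 2))
    (htie : ∀ τ s, Measurable (S.tie τ s)) (hs₀ : M.IsState S.s₀) (hε0 : 0 < ε) (hε1 : ε ≤ 1)
    (hs : s ∈ M.limitLaw.support) : ∀ᵐ ω ∂P,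
      Tendsto (fun τ => (M.memory S ξ ε A U G τ ω).mobile s) atTop (𝓝 (M.meanMobile π s)) ∧
      Tendsto (fun τ => (M.memory S ξ ε A U G τ ω).static s) atTop (𝓝 (M.meanStatic π s)) := by
  have hA := measurable_pi_lambda (fun ω τ => A τ ω) hin.measurable_arrival
  have hU := measurable_pi_lambda (fun ω τ => U τ ω) hin.measurable_unif
  have hG := measurable_pi_lambda (fun ω τ => G τ ω) hin.measurable_gain
  set E := (ℕ → Fin n → ℕ) × ((ℕ → ℝ) × (ℕ → L → M.gainSet)) with hE
  set mem : ℕ → E → Memory n := fun τ x =>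
    M.memory S ξ ε (fun τ (x : E) => x.1 τ) (fun τ x => x.2.1 τ) (fun τ x => x.2.2 τ) τ x
    with hmem
  have hm := fun τ => M.measurable_memory (Ω := E) (A := fun τ (x : E) => x.1 τ)
    (U := fun τ x => x.2.1 τ) (G := fun τ x => x.2.2 τ) (S := S) (ξ := ξ) (ε := ε) htie
    (fun i => (measurable_pi_apply i).comp measurable_fst) τ
    (fun i _ => (measurable_pi_apply i).comp (measurable_fst.comp measurable_snd))
    (fun i _ => (measurable_pi_apply i).comp (measurable_snd.comp measurable_snd)) s
  set D : Set E := {x | Tendsto (fun τ => (mem τ x).mobile s) atTop (𝓝 (M.meanMobile π s)) ∧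
    Tendsto (fun τ => (mem τ x).static s) atTop (𝓝 (M.meanStatic π s))} with hD
  have hDm : MeasurableSet D :=
    (measurableSet_tendsto (𝓝 (M.meanMobile π s)) fun τ => (hm τ).1).inter
      (measurableSet_tendsto (𝓝 (M.meanStatic π s)) fun τ => (hm τ).2.1)
  have hprod := (indepFun_iff_map_prod_eq_prod_map_map hA.aemeasurable
    (hU.prodMk hG).aemeasurable).1 hin.indep_arrival
  have hvis : ∀ᵐ q ∂(P.map fun ω τ => A τ ω), {τ | M.path S.s₀ q τ = s}.Infinite := by
    have hpm : ∀ τ, Measurable fun q : ℕ → Fin n → ℕ => M.path S.s₀ q τ := fun τ => by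
      have := M.measurable_stateAt (A := fun τ (q : ℕ → Fin n → ℕ) => q τ) S.s₀
        (fun i => measurable_pi_apply i) τ
      have e : M.stateAt S.s₀ (fun τ (q : ℕ → Fin n → ℕ) => q τ) τ
          = fun q => M.path S.s₀ q τ := by
        funext q; exact M.stateAt_congr S.s₀ fun _ _ => rfl
      rwa [e] at this
    have hset : MeasurableSet {q : ℕ → Fin n → ℕ | {τ | M.path S.s₀ q τ = s}.Infinite} := by
      have e : {q : ℕ → Fin n → ℕ | {τ | M.path S.s₀ q τ = s}.Infinite}
          = ⋂ a : ℕ, ⋃ b : ℕ, ⋃ _ : a < b, (fun q => M.path S.s₀ q b) ⁻¹' {s} := by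
        ext q
        simp only [Set.mem_ofPred_eq, Set.mem_iInter, Set.mem_iUnion, Set.mem_preimage,
          Set.mem_singleton_iff, exists_prop]
        constructor
        · intro h a
          obtain ⟨b, hb, hab⟩ := h.exists_gt a
          exact ⟨b, hab, hb⟩
        · intro h
          refine Set.infinite_of_forall_exists_gt fun a => ?_
          obtain ⟨b, hab, hb⟩ := h a
          exact ⟨b, hb, hab⟩
      rw [e]
      exact MeasurableSet.iInter fun a => MeasurableSet.iUnion fun b => MeasurableSet.iUnion fun _ =>
        hpm b (measurableSet_singleton s)
    rw [ae_map_iff hA.aemeasurable hset]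
    filter_upwards [M.ae_frequently_stateAt hs₀ hin.measurable_arrival hin.arrival_law
      hin.arrival_indep hs] with ω hω
    refine Set.infinite_of_forall_exists_gt fun a => ?_
    obtain ⟨b, hab, hb⟩ := frequently_atTop.1 hω (a + 1)
    refine ⟨b, ?_, by omega⟩
    rw [Set.mem_ofPred_eq, ← hb]
    exact M.stateAt_congr S.s₀ fun _ _ => rfl
  have hfix : ∀ᵐ x ∂(P.map fun ω => ((fun τ => A τ ω), (fun τ => U τ ω, fun τ => G τ ω))),
      x ∈ D := by
    rw [hprod, Measure.ae_prod_mem_iff_ae_ae_mem hDm]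
    filter_upwards [hvis] with q hq
    rw [ae_map_iff (hU.prodMk hG).aemeasurable (measurable_prodMk_left hDm)]
    filter_upwards [ae_tendsto_fixed hin herg hξ ha_pos ha_anti ha_sum ha_sq htie hε0 hε1 hq]
      with ω hω
    have e : ∀ τ, mem τ ((q, (fun τ => U τ ω, fun τ => G τ ω)) : E)
        = M.memory S ξ ε (fun τ _ => q τ) U G τ ω :=
      memory_congr (fun τ => rfl) (fun τ => rfl) (fun τ => rfl)
    change Tendsto (fun τ => (mem τ _).mobile s) atTop _ ∧
      Tendsto (fun τ => (mem τ _).static s) atTop _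
    simpa only [e] using hω
  have := ae_of_ae_map (hA.prodMk (hU.prodMk hG)).aemeasurable hfix
  filter_upwards [this] with ω hω
  have e : ∀ τ, mem τ (((fun τ => A τ ω), (fun τ => U τ ω, fun τ => G τ ω)) : E)
      = M.memory S ξ ε A U G τ ω := memory_congr (fun τ => rfl) (fun τ => rfl) (fun τ => rfl)
  simpa only [hD, Set.mem_ofPred_eq, e] using hω

end Cell

namespace Cell

/-! ### The average rewards -/

section Values

variable {n : ℕ} {L : Type*} (M : Cell n L) (π : Measure (L → M.gainSet)) (ξ : ℝ)

theorem reward_eq (s : State n) (x : ℝ) : M.reward π ξ s x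
    = ξ * M.meanStatic π s + x * (M.meanMobile π s - ξ * M.meanStatic π s) := by
  unfold reward; ring

/-- Largest expected reward in a state. -/
def bestReward (s : State n) : ℝ := max (M.meanMobile π s) (ξ * M.meanStatic π s)

theorem reward_le_bestReward (s : State n) {x : ℝ} (h0 : 0 ≤ x) (h1 : x ≤ 1) :
    M.reward π ξ s x ≤ M.bestReward π ξ s := by
  have h2 : M.meanMobile π s ≤ M.bestReward π ξ s := le_max_left _ _
  have h3 : ξ * M.meanStatic π s ≤ M.bestReward π ξ s := le_max_right _ _
  have := mul_le_mul_of_nonneg_left h2 h0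
  have := mul_le_mul_of_nonneg_left h3 (sub_nonneg.2 h1)
  unfold reward
  linarith

/-- Expected reward in a state, if the decision is greedy except for forced decisions of total
probability `ε`. -/
def exploreReward (ε : ℝ) (s : State n) : ℝ :=
  ε / 2 * (M.meanMobile π s + ξ * M.meanStatic π s) + (1 - ε) * M.bestReward π ξ s

/-- The limit law of the state is carried by a finite set. -/
def limitStates : Finset (State n) := (M.finite_support_stateLaw 0 M.horizon).toFinset

theorem mem_limitStates {s : State n} : s ∈ M.limitStates ↔ s ∈ M.limitLaw.support :=
  Set.Finite.mem_toFinset _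

/-- Stationary mean of a function of the state. -/
def stationaryMean (f : State n → ℝ) : ℝ :=
  ∑ s ∈ M.limitStates, (M.limitLaw s).toReal * f s

theorem stationaryMean_mono {f g : State n → ℝ} (h : ∀ s, f s ≤ g s) :
    M.stationaryMean f ≤ M.stationaryMean g :=
  Finset.sum_le_sum fun s _ => mul_le_mul_of_nonneg_left (h s) ENNReal.toReal_nonneg

/-- Averages of a convergent sequence. -/
theorem tendsto_average {f : ℕ → ℝ} {l : ℝ} (h : Tendsto f atTop (𝓝 l)) :
    Tendsto (fun N : ℕ => (1 / (N : ℝ)) * ∑ τ ∈ Finset.range N, f τ) atTop (𝓝 l) := by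
  simpa only [one_div] using h.cesaro

section Policies

variable {s₀ : State n}

theorem policyValue_eq (hs₀ : M.IsState s₀) (η : Policy n) : M.policyValue π ξ s₀ η
    = M.stationaryMean fun s => ∫ x : Set.Icc (0 : ℝ) 1, M.reward π ξ s x
        ∂(η s : Measure (Set.Icc (0 : ℝ) 1)) := by
  refine (tendsto_average (tendsto_const_nhds.congr' ?_)).liminf_eq
  filter_upwards [eventually_ge_atTop M.horizon] with τ hτ
  unfold policyReward stationaryMean
  rw [M.stateLaw_eq hs₀ hτ]
  refine (tsum_eq_sum fun s hs => ?_).symm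
  rw [mem_limitStates, PMF.mem_support_iff, not_not] at hs
  rw [hs, ENNReal.toReal_zero, zero_mul]

/-- The optimal value is attained by the policy that is greedy for the true mean rates. -/
theorem optimalValue_eq (hs₀ : M.IsState s₀) :
    M.optimalValue π ξ s₀ = M.stationaryMean (M.bestReward π ξ) := by
  classical
  have hle : ∀ η : Policy n, M.policyValue π ξ s₀ η ≤ M.stationaryMean (M.bestReward π ξ) := by
    intro η
    rw [M.policyValue_eq π ξ hs₀]
    refine M.stationaryMean_mono fun s => ?_
    have hi : Integrable (fun x : Set.Icc (0 : ℝ) 1 => M.reward π ξ s x)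
        (η s : Measure (Set.Icc (0 : ℝ) 1)) := by
      refine Continuous.integrable_of_hasCompactSupport ?_ (HasCompactSupport.of_compactSpace _)
      unfold reward; fun_prop
    refine (integral_mono hi (integrable_const (M.bestReward π ξ s)) fun x =>
      M.reward_le_bestReward π ξ s x.2.1 x.2.2).trans ?_
    simp
  set η : Policy n := fun s => ⟨Measure.dirac
    (if ξ * M.meanStatic π s ≤ M.meanMobile π s then 1 else 0), inferInstance⟩ with hη
  have : Nonempty (Policy n) := ⟨η⟩
  refine le_antisymm (ciSup_le hle) ?_
  refine le_trans (le_of_eq ?_) (le_ciSup ⟨_, Set.forall_mem_range.2 hle⟩ η)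
  rw [M.policyValue_eq π ξ hs₀]
  congr 1
  funext s
  simp only [hη, ProbabilityMeasure.coe_mk]
  rw [integral_dirac]
  unfold bestReward reward
  split_ifs with h
  · simp [max_eq_left h]
  · simp [max_eq_right (le_of_not_ge h)]

end Policies

end Values

section Explore

variable {n : ℕ} {L : Type*} {M : Cell n L} {S : Setup n} {ξ ε : ℝ} {s : State n}
  {π : Measure (L → M.gainSet)}
  {Ω : Type*} [mΩ : MeasurableSpace Ω] {P : Measure Ω}
  {A : ℕ → Ω → Fin n → ℕ} {U : ℕ → Ω → ℝ} {G : ℕ → Ω → L → M.gainSet}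

theorem integral_choice_unif (hin : M.IsInput P A U G) (h0 : 0 < ε) (h1 : ε ≤ 1)
    {tie : ℝ → Bool} (htie : Measurable tie) (i : Bool) (τ : ℕ) :
    ∫ ω, choice ε tie i (-1) (U τ ω) ∂P = ε / 2 := by
  have h := integral_map (μ := P) (hin.measurable_unif τ).aemeasurable
    (f := choice ε tie i (-1)) (measurable_choice ε htie i (-1)).aestronglyMeasurable
  rw [hin.unif_law, integral_choice h0 h1] at h
  exact h.symm

theorem abs_choice_le (tie : ℝ → Bool) (i : Bool) (c : SignType) (u : ℝ) :
    |choice ε tie i c u| ≤ 1 := by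
  rcases choice_val ε tie i c u with h | h <;> rw [h] <;> simp

theorem integrable_choice [IsProbabilityMeasure P] (hin : M.IsInput P A U G) {tie : ℝ → Bool}
    (htie : Measurable tie) (i : Bool) (c : SignType) (τ : ℕ) :
    Integrable (fun ω => choice ε tie i c (U τ ω)) P :=
  integrable_of_abs_le ((measurable_choice ε htie i c).comp (hin.measurable_unif τ))
    fun _ => abs_choice_le tie i c _

/-- Expected reward of a decision that is greedy for the true mean rates, unless forced. -/
theorem integral_reward_choice [IsProbabilityMeasure P] (hin : M.IsInput P A U G) (h0 : 0 < ε)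
    (h1 : ε ≤ 1) {tie : ℝ → Bool} (htie : Measurable tie) (τ : ℕ) :
    ∫ ω, M.reward π ξ s (choice ε tie true
      (SignType.sign (M.meanMobile π s - ξ * M.meanStatic π s)) (U τ ω)) ∂P
      = M.exploreReward π ξ ε s := by
  set d := M.meanMobile π s - ξ * M.meanStatic π s with hd
  have hi := (integrable_choice (ε := ε) hin htie true (SignType.sign d) τ).mul_const d
  simp_rw [reward_eq]
  rw [integral_add (integrable_const _) hi, integral_mul_const d, integral_const]
  unfold exploreReward bestReward
  rcases lt_trichotomy d 0 with h | h | h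
  · rw [sign_neg h, integral_choice_unif hin h0 h1 htie, max_eq_right (by linarith)]
    simp [hd]; ring
  · rw [h, max_eq_left (by linarith)]
    have : M.meanMobile π s = ξ * M.meanStatic π s := by linarith
    simp [this]; ring
  · have e : ∫ ω, choice ε tie true 1 (U τ ω) ∂P = 1 - ε / 2 := by
      rw [← integral_choice_unif hin h0 h1 htie false τ]
      have h2 : ∀ ω, choice ε tie true 1 (U τ ω) = 1 - choice ε tie false (-1) (U τ ω) :=
        fun ω => by have := choice_not ε tie true 1 (U τ ω); simp at this; linarith
      simp_rw [h2]
      rw [integral_sub (integrable_const _) (integrable_choice hin htie _ _ _)]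
      simp
    rw [sign_pos h, e, max_eq_left (by linarith)]
    simp [hd]; ring

end Explore

end Cell

namespace Cell

section AlgorithmValue

variable {n : ℕ} {L : Type*} {M : Cell n L} {S : Setup n} {ξ ε : ℝ} {s : State n}
  {π : Measure (L → M.gainSet)}
  {Ω : Type*} [mΩ : MeasurableSpace Ω] {P : Measure Ω}
  {A : ℕ → Ω → Fin n → ℕ} {U : ℕ → Ω → ℝ} {G : ℕ → Ω → L → M.gainSet}

/-- The states do not depend on the randomizations. -/
theorem indepFun_stateAt_unif [IsProbabilityMeasure P] (hin : M.IsInput P A U G) (s₀ : State n)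
    (τ : ℕ) : IndepFun (M.stateAt s₀ A τ) (U τ) P := by
  have h1 := hin.indep_arrival.comp
    (M.measurable_stateAt (A := fun τ (q : ℕ → Fin n → ℕ) => q τ) s₀
      (fun i => measurable_pi_apply i) τ)
    ((measurable_pi_apply τ).comp
      (measurable_fst : Measurable (Prod.fst : (ℕ → ℝ) × (ℕ → L → M.gainSet) → ℕ → ℝ)))
  have e : M.stateAt s₀ (fun τ (q : ℕ → Fin n → ℕ) => q τ) τ ∘ (fun ω τ => A τ ω)
      = M.stateAt s₀ A τ := by
    funext ω; exact M.stateAt_congr s₀ fun _ _ => rfl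
  rw [e] at h1
  exact h1

/-- Expected reward in a state, in one slot of the algorithm. -/
theorem tendsto_integral_indicator_reward [IsProbabilityMeasure P] (hin : M.IsInput P A U G)
    [IsProbabilityMeasure π]
    (herg : UniformlyErgodic M.fadingKernel π) (hξ : 0 ≤ ξ)
    (ha_pos : ∀ t, 1 ≤ t → 0 < S.a t) (ha_anti : ∀ t, 1 ≤ t → S.a (t + 1) ≤ S.a t)
    (ha_sum : ¬ Summable S.a) (ha_sq : Summable (fun t => S.a t ^ 2))
    (htie : ∀ τ s, Measurable (S.tie τ s)) (hs₀ : M.IsState S.s₀) (hε0 : 0 < ε) (hε1 : ε ≤ 1)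
    (hs : s ∈ M.limitLaw.support) :
    (∀ τ, Integrable (fun ω => {ω | M.stateAt S.s₀ A τ ω = s}.indicator
      (fun ω => M.reward π ξ s (M.action S ξ ε A U G τ ω)) ω) P) ∧
    Tendsto (fun τ => ∫ ω, {ω | M.stateAt S.s₀ A τ ω = s}.indicator
      (fun ω => M.reward π ξ s (M.action S ξ ε A U G τ ω)) ω ∂P) atTop
      (𝓝 ((M.limitLaw s).toReal * M.exploreReward π ξ ε s)) := by
  set d := M.meanMobile π s - ξ * M.meanStatic π s with hd
  set B := fun τ => {ω | M.stateAt S.s₀ A τ ω = s} with hB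
  set I := fun τ => (B τ).indicator (fun _ => (1 : ℝ)) with hI
  set est := fun τ ω => (M.memory S ξ ε A U G τ ω).mobile s
    - ξ * (M.memory S ξ ε A U G τ ω).static s with hest
  -- the decision of the algorithm in state `s`, and the one for the true mean rates
  set x := fun τ ω => choice ε (S.tie τ s) true (SignType.sign (est τ ω)) (U τ ω) with hx
  set y := fun τ ω => choice ε (S.tie τ s) true (SignType.sign d) (U τ ω) with hy
  have hBm : ∀ τ, MeasurableSet (B τ) := fun τ =>
    M.measurable_stateAt S.s₀ hin.measurable_arrival τ (measurableSet_singleton s)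
  have hIm : ∀ τ, Measurable (I τ) := fun τ => measurable_const.indicator (hBm τ)
  have hI1 : ∀ τ ω, |I τ ω| ≤ 1 := fun τ ω => by
    simp only [hI, Set.indicator]; split_ifs <;> simp
  have hxm : ∀ τ, Measurable (x τ) := fun τ => by
    have h := M.measurable_memory (ξ := ξ) (ε := ε) htie hin.measurable_arrival τ
      (fun i _ => hin.measurable_unif i) (fun i _ => hin.measurable_gain i) s
    have h2 := measurable_decision (ξ := ξ) (ε := ε) htie τ s h.1 h.2.1 (hin.measurable_unif τ)
    simp only [decision_eq] at h2
    exact Measurable.ite (h2 (measurableSet_singleton true)) measurable_const measurable_const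
  have hym : ∀ τ, Measurable (y τ) := fun τ =>
    (measurable_choice ε (htie τ s) true _).comp (hin.measurable_unif τ)
  have hx1 : ∀ τ ω, |x τ ω| ≤ 1 := fun τ ω => abs_choice_le _ _ _ _
  have hy1 : ∀ τ ω, |y τ ω| ≤ 1 := fun τ ω => abs_choice_le _ _ _ _
  have e1 : ∀ τ ω, (B τ).indicator (fun ω => M.reward π ξ s (M.action S ξ ε A U G τ ω)) ω
      = I τ ω * M.reward π ξ s (y τ ω) + I τ ω * ((x τ ω - y τ ω) * d) := by
    intro τ ω
    by_cases h : ω ∈ B τ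
    · have h' : M.stateAt S.s₀ A τ ω = s := h
      have h2 : M.action S ξ ε A U G τ ω = x τ ω := by
        simp only [action, h', decision_eq, hx, choice, hest]
      rw [Set.indicator_of_mem h, h2, reward_eq, reward_eq]
      simp only [hI, Set.indicator_of_mem h, hd]; ring
    · simp [hI, Set.indicator_of_notMem h]
  have hi1 : ∀ τ, Integrable (fun ω => I τ ω * M.reward π ξ s (y τ ω)) P := fun τ => by
    simp only [reward_eq]
    refine integrable_of_abs_le (K := 1 * (|ξ * M.meanStatic π s| + 1 * |d|))
      ((hIm τ).mul (((hym τ).mul_const d).const_add _)) fun ω => ?_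
    rw [abs_mul]
    refine mul_le_mul (hI1 τ ω) ((abs_add_le _ _).trans ?_) (abs_nonneg _) zero_le_one
    rw [abs_mul (y τ ω)]
    gcongr
    exact hy1 τ ω
  have hb2 : ∀ τ ω, |I τ ω * ((x τ ω - y τ ω) * d)| ≤ 2 * |d| := by
    intro τ ω
    rw [abs_mul, abs_mul]
    have h1 : |x τ ω - y τ ω| ≤ 2 := (abs_sub _ _).trans (by linarith [hx1 τ ω, hy1 τ ω])
    calc |I τ ω| * (|x τ ω - y τ ω| * |d|) ≤ 1 * (2 * |d|) :=
          mul_le_mul (hI1 τ ω) (mul_le_mul_of_nonneg_right h1 (abs_nonneg d)) (by positivity) (by norm_num)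
      _ = 2 * |d| := one_mul _
  have hm2 : ∀ τ, Measurable (fun ω => I τ ω * ((x τ ω - y τ ω) * d)) := fun τ =>
    (hIm τ).mul (((hxm τ).sub (hym τ)).mul_const d)
  have hi2 : ∀ τ, Integrable (fun ω => I τ ω * ((x τ ω - y τ ω) * d)) P := fun τ =>
    integrable_of_abs_le (hm2 τ) (hb2 τ)
  have h1 : Tendsto (fun τ => ∫ ω, I τ ω * M.reward π ξ s (y τ ω) ∂P) atTop
      (𝓝 ((M.limitLaw s).toReal * M.exploreReward π ξ ε s)) := by
    refine tendsto_const_nhds.congr' ?_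
    filter_upwards [eventually_ge_atTop M.horizon] with τ hτ
    have hind := (indepFun_stateAt_unif hin S.s₀ τ).comp
      (measurable_of_countable (({s} : Set (State n)).indicator (fun _ => (1 : ℝ))))
      (show Measurable (fun u => M.reward π ξ s (choice ε (S.tie τ s) true (SignType.sign d) u)) by
        simp only [reward_eq]
        exact ((measurable_choice ε (htie τ s) true _).mul_const _).const_add _)
    have h2 := hind.integral_fun_mul_eq_mul_integral
      ((measurable_of_countable _).comp
        (M.measurable_stateAt S.s₀ hin.measurable_arrival τ)).aestronglyMeasurable
      ((show Measurable (fun u => M.reward π ξ s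
          (choice ε (S.tie τ s) true (SignType.sign d) u)) by
        simp only [reward_eq]
        exact ((measurable_choice ε (htie τ s) true _).mul_const _).const_add _).comp
          (hin.measurable_unif τ)).aestronglyMeasurable
    have h3 : ∫ ω, I τ ω ∂P = (M.limitLaw s).toReal := by
      rw [integral_indicator (hBm τ)]
      have := M.measure_stateAt_eq S.s₀ hin.measurable_arrival hin.arrival_law hin.arrival_indep τ s
      simp only [integral_const, measureReal_restrict_apply_univ, smul_eq_mul, mul_one]
      rw [measureReal_def, hB, this, M.stateLaw_eq hs₀ hτ]
    have h4 := integral_reward_choice (s := s) (π := π) (ξ := ξ) hin hε0 hε1 (htie τ s) τ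
    rw [← h3, ← h4]
    exact h2.symm
  have h2 : Tendsto (fun τ => ∫ ω, I τ ω * ((x τ ω - y τ ω) * d) ∂P) atTop (𝓝 0) := by
    have h0 : ∫ _ : Ω, (0 : ℝ) ∂P = 0 := integral_zero _ _
    rw [← h0]
    refine tendsto_integral_of_dominated_convergence (fun _ => 2 * |d|)
      (fun τ => (hm2 τ).aestronglyMeasurable) (integrable_const _)
      (fun τ => ae_of_all _ fun ω => by rw [Real.norm_eq_abs]; exact hb2 τ ω) ?_
    by_cases hd0 : d = 0
    · simp [hd0]
    filter_upwards [ae_tendsto_memory hin herg hξ ha_pos ha_anti ha_sum ha_sq htie hs₀ hε0 hε1 hs]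
      with ω hω
    have hlim : Tendsto (fun τ => est τ ω) atTop (𝓝 d) := hω.1.sub (hω.2.const_mul ξ)
    have hsign : ∀ᶠ τ in atTop, SignType.sign (est τ ω) = SignType.sign d := by
      rcases lt_or_gt_of_ne hd0 with h | h
      · filter_upwards [hlim.eventually (gt_mem_nhds h)] with τ hτ
        rw [sign_neg h, sign_neg hτ]
      · filter_upwards [hlim.eventually (lt_mem_nhds h)] with τ hτ
        rw [sign_pos h, sign_pos hτ]
    refine tendsto_const_nhds.congr' ?_
    filter_upwards [hsign] with τ hτ
    simp [hx, hy, hτ]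
  have h3 := h1.add h2
  rw [add_zero] at h3
  refine ⟨fun τ => ((hi1 τ).add (hi2 τ)).congr (ae_of_all _ fun ω => (e1 τ ω).symm),
    h3.congr fun τ => ?_⟩
  rw [← integral_add (hi1 τ) (hi2 τ)]
  exact integral_congr_ae (ae_of_all _ fun ω => (e1 τ ω).symm)

/-- Expected reward in one slot of the algorithm. -/
theorem tendsto_integral_reward [IsProbabilityMeasure P] (hin : M.IsInput P A U G)
    [IsProbabilityMeasure π]
    (herg : UniformlyErgodic M.fadingKernel π) (hξ : 0 ≤ ξ)
    (ha_pos : ∀ t, 1 ≤ t → 0 < S.a t) (ha_anti : ∀ t, 1 ≤ t → S.a (t + 1) ≤ S.a t)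
    (ha_sum : ¬ Summable S.a) (ha_sq : Summable (fun t => S.a t ^ 2))
    (htie : ∀ τ s, Measurable (S.tie τ s)) (hs₀ : M.IsState S.s₀) (hε0 : 0 < ε) (hε1 : ε ≤ 1) :
    Tendsto (fun τ => ∫ ω, M.reward π ξ (M.stateAt S.s₀ A τ ω) (M.action S ξ ε A U G τ ω) ∂P) atTop
      (𝓝 (M.stationaryMean (M.exploreReward π ξ ε))) := by
  have hstate := fun s hs => tendsto_integral_indicator_reward (s := s) (π := π) hin herg hξ ha_pos
    ha_anti ha_sum ha_sq htie hs₀ hε0 hε1 (M.mem_limitStates.1 hs)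
  have h1 := tendsto_finsetSum M.limitStates fun s hs =>
    (hstate s hs).2
  refine h1.congr' ?_
  filter_upwards [eventually_ge_atTop M.horizon] with τ hτ
  rw [← integral_finsetSum]
  · refine integral_congr_ae ?_
    have h2 : ∀ᵐ ω ∂P, M.stateAt S.s₀ A τ ω ∈ M.limitStates := by
      have h3 : ∀ᵐ s' ∂(P.map (M.stateAt S.s₀ A τ)), s' ∈ M.limitStates := by
        rw [M.map_stateAt S.s₀ hin.measurable_arrival hin.arrival_law hin.arrival_indep,
          M.stateLaw_eq hs₀ hτ, ae_iff, PMF.toMeasure_apply_eq_zero_iff _ (MeasurableSet.of_discrete)]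
        exact Set.disjoint_left.2 fun s' h1 h2 => h2 (M.mem_limitStates.2 h1)
      exact ae_of_ae_map (M.measurable_stateAt S.s₀ hin.measurable_arrival τ).aemeasurable h3
    filter_upwards [h2] with ω hω
    rw [Finset.sum_eq_single_of_mem _ hω]
    · rw [Set.indicator_of_mem (by exact rfl)]
    · intro s' _ hs'
      have h : ω ∉ {ω | M.stateAt S.s₀ A τ ω = s'} := fun h => hs' (Eq.symm h)
      exact Set.indicator_of_notMem h _
  · exact fun s hs => (hstate s hs).1 τ

/-- Average reward of the algorithm. -/
theorem tendsto_averageReward [IsProbabilityMeasure P] (hin : M.IsInput P A U G)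
    [IsProbabilityMeasure π]
    (herg : UniformlyErgodic M.fadingKernel π) (hξ : 0 ≤ ξ)
    (ha_pos : ∀ t, 1 ≤ t → 0 < S.a t) (ha_anti : ∀ t, 1 ≤ t → S.a (t + 1) ≤ S.a t)
    (ha_sum : ¬ Summable S.a) (ha_sq : Summable (fun t => S.a t ^ 2))
    (htie : ∀ τ s, Measurable (S.tie τ s)) (hs₀ : M.IsState S.s₀) (hε0 : 0 < ε) (hε1 : ε ≤ 1) :
    Tendsto (fun N => M.averageReward S ξ ε A U G P π N) atTop
      (𝓝 (M.stationaryMean (M.exploreReward π ξ ε))) :=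
  tendsto_average (tendsto_integral_reward hin herg hξ ha_pos ha_anti ha_sum ha_sq htie hs₀ hε0 hε1)

/-- The loss caused by the forced decisions vanishes with their probability. -/
theorem tendsto_stationaryMean_exploreReward (M : Cell n L) (π : Measure (L → M.gainSet)) (ξ : ℝ) :
    Tendsto (fun ε => M.stationaryMean (M.exploreReward π ξ ε)) (𝓝[>] 0)
      (𝓝 (M.stationaryMean (M.bestReward π ξ))) := by
  have hc : Continuous fun ε => M.stationaryMean (M.exploreReward π ξ ε) := by
    unfold stationaryMean exploreReward; fun_prop
  have h := (hc.tendsto 0).mono_left (nhdsWithin_le_nhds (s := Set.Ioi 0))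
  have e : M.exploreReward π ξ 0 = M.bestReward π ξ := by
    funext s; unfold exploreReward; ring
  rwa [e] at h

end AlgorithmValue

end Cell

end BandwidthSharing

end

open BandwidthSharing in
theorem theorem3 {n : ℕ} {L : Type*} [Finite L] (M : Cell n L)
    (π : Measure (L → M.gainSet)) (hπ : IsProbabilityMeasure π)
    (hergodic : UniformlyErgodic M.fadingKernel π)
    (ξ : ℝ) (hξ : 0 ≤ ξ)
    (S : Cell.Setup n)
    (ha_pos : ∀ t, 1 ≤ t → 0 < S.a t)
    (ha_anti : ∀ t, 1 ≤ t → S.a (t + 1) ≤ S.a t)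
    (ha_sum : ¬ Summable S.a)
    (ha_sq : Summable (fun t => S.a t ^ 2))
    (htie : ∀ τ s, Measurable (S.tie τ s))
    (hs₀ : M.IsState S.s₀)
    {Ω : Type*} [MeasurableSpace Ω] (P : Measure Ω) [IsProbabilityMeasure P]
    (A : ℕ → Ω → Fin n → ℕ) (U : ℕ → Ω → ℝ) (G : ℕ → Ω → L → M.gainSet)
    (hinput : M.IsInput P A U G) :
    (∀ ε : ℝ, 0 < ε → ε ≤ 1 → ∀ s ∈ M.states, ∀ᵐ ω ∂P,
      Tendsto (fun τ => (M.memory S ξ ε A U G τ ω).mobile s) atTop (𝓝 (M.meanMobile π s)) ∧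
      Tendsto (fun τ => (M.memory S ξ ε A U G τ ω).static s) atTop (𝓝 (M.meanStatic π s))) ∧
    (∀ ε : ℝ, 0 < ε → ε ≤ 1 →
      Tendsto (fun N => M.averageReward S ξ ε A U G P π N) atTop
        (𝓝 (M.algorithmValue S ξ ε A U G P π))) ∧
    Tendsto (fun ε : ℝ => M.algorithmValue S ξ ε A U G P π) (𝓝[>] 0)
      (𝓝 (M.optimalValue π ξ S.s₀)) := by
  have hval : ∀ ε : ℝ, 0 < ε → ε ≤ 1 →
      Tendsto (fun N => M.averageReward S ξ ε A U G P π N) atTop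
        (𝓝 (M.stationaryMean (M.exploreReward π ξ ε))) := fun ε h0 h1 =>
    Cell.tendsto_averageReward hinput hergodic hξ ha_pos ha_anti ha_sum ha_sq htie hs₀ h0 h1
  have hlim : ∀ ε : ℝ, 0 < ε → ε ≤ 1 →
      M.algorithmValue S ξ ε A U G P π = M.stationaryMean (M.exploreReward π ξ ε) :=
    fun ε h0 h1 => (hval ε h0 h1).liminf_eq
  refine ⟨fun ε h0 h1 s hs => ?_, fun ε h0 h1 => ?_, ?_⟩
  · exact Cell.ae_tendsto_memory hinput hergodic hξ ha_pos ha_anti ha_sum ha_sq htie hs₀ h0 h1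
      (M.mem_support_limitLaw hs)
  · rw [hlim ε h0 h1]
    exact hval ε h0 h1
  · rw [M.optimalValue_eq π ξ hs₀]
    refine (Cell.tendsto_stationaryMean_exploreReward M π ξ).congr' ?_
    filter_upwards [Ioc_mem_nhdsGT one_pos] with ε hε
    exact (hlim ε hε.1 hε.2).symm
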